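/- **Theorem 1 (Consistency of the Deep Copula Classifier).** Let $d,K\ge 1$ and let $P$ be the law of a pair $(X,Y)\in\mathbb R^d\times\{1,\dots,K\}$, with priors $\pi_y=P(Y=y)$ and marginal distribution functions $F_{j|y}(t)=P(X_j\le t\mid Y=y)$. Let $r>d/2$. Assume, for all $y$ and $j$: 1. $\pi_y>0$; given $Y=y$, $X$ has a continuous joint density $p_y$; $F_{j|y}$ is differentiable on $\mathbb R$ and strictly increasing on $\{0<F_{j|y}<1\}$, and $f_{j|y}=F_{j|y}'$ is bounded, is $C^2$ on $\{0<F_{j|y}<1\}$, and $X_j\mid Y=y$ has sub-exponential (in particular possibly sub-Gaussian) tails. 2. There is a copula $C_y$ with $P(X_1\le x_1,\dots,X_d\le x_d\mid Y=y)=C_y(F_{1|y}(x_1),\dots,F_{d|y}(x_d))$, and $C_y$ has a density $c_y$ on $[0,1]^d$ such that $p_y(x)=c_y(F_{1|y}(x_1),\dots,F_{d|y}(x_d))\prod_j f_{j|y}(x_j)$ for all $x\in\mathbb R^d$; $c_y$ lies in the Sobolev class $W_2^r((0,1)^d)$ and is Lipschitz on $[0,1]^d$ (hence bounded), with constant at most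 $L_c$ for the maximum norm. *Classifier.* Let $(X^{(i)},Y^{(i)})$, $i\le n$, be i.i.d. from $P$, $n_y=\#\{i\le n:Y^{(i)}=y\}$, $\hat\pi_y=n_y/n$. Let $\widehat F_{j|y}$ be the empirical distribution function and $\widehat f_{j|y}$ the kernel density estimator of feature $j$ from the sample of class $y$, with a second-order kernel ($\int k=1$, $\int tk=0$, $0<\int t^2k<\infty$) and deterministic bandwidths $h_{j,y}(n_y)$, $h_{j,y}(m)\asymp m^{-1/5}$. Put $\hat u_y(x)=(\widehat F_{1|y}(x_1),\dots,\widehat F_{d|y}(x_d))$. Let $NN(\cdot;\theta)$ be ReLU networks on $[0,1]^d$ with softplus output, depth $\asymp\log n$, and width at most $W_n$. For each $y$ let $V^{(1)},\dots,V^{(M_n)}$ be i.i.d. uniform on $[0,1]^d$, and set $$\widehat Z_y(\theta)=\frac1{M_n}\sum_{m\le M_n}NN(V^{(m)};\theta),\qquad \tilde c_y(u;\theta)=\frac{NN(u;\theta)}{\widehat Z_y(\theta)}.$$ Let $\Theta_n$ be the set of parameters with at most $S_n$ nonzero entries for which $NN(\cdot;\theta)/\int_{[0,1]^d}NN(v;\theta)\,dv$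 is Lipschitz on $[0,1]^d$ with constant at most $\Lambda$ (maximum norm), where $\Lambda>L_c$ is fixed. Let $\hat\theta_y=\hat\theta_{y,n}$ be a measurable (near-)maximizer over $\Theta_n$ of $$\frac1{n_y}\sum_{i\le n:\,Y^{(i)}=y}\log\tilde c_y(\hat u_y(X^{(i)});\theta)-\lambda_n\sum_{j=1}^d\int_0^1\Big(\int_{[0,1]^{d-1}}\tilde c_y(u;\theta)\,du_{-j}-1\Big)^2du_j ,$$ that is: with probability tending to one, $\hat\theta_y\in\Theta_n$ and its value is within a deterministic $\delta_n\to0$ of the supremum over $\Theta_n$ (exact maximizers are included). Set $$\widehat p_y(x)=\tilde c_y(\hat u_y(x);\hat\theta_y)\prod_{j=1}^d\widehat f_{j|y}(x_j),\quad \widehat Y_n(x)=\operatorname*{arg\,max}_y\hat\pi_y\widehat p_y(x),\quad Y^*(x)=\operatorname*{arg\,max}_y\pi_yp_y(x),$$ ties being broken by the smallest index. *Growth.* Suppose that $W_n$ and $S_n$ are $\asymp n^{d/(2r+d)}$ up to powers of $\log n$; $M_n\to\infty$ with $M_n^{-1/2}=o(n^{-r/(2r+d)})$; $\lambda_n\to\infty$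 and $\lambda_n=O((\log n)^k)$ for some $k$. Then, for a test pair $(X,Y)\sim P$ independent of the training sample, the Monte-Carlo draws and the fitted parameters, $$\lim_{n\to\infty}\mathbb P\big(\widehat Y_n(X)\ne Y\big)=\mathbb P\big(Y^*(X)\ne Y\big).$$ -/

import Mathlib

open MeasureTheory ProbabilityTheory Filter Topology Asymptotics
open scoped ENNReal NNReal

noncomputable section

namespace DCC

/-! ### Domains -/

/-- A labelled observation: a feature vector in `ℝ^d` and a class label. -/
abbrev Obs (d K : ℕ) : Type := (Fin d → ℝ) × Fin K

/-- The closed unit cube `[0,1]^d`. -/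
def cube (d : ℕ) : Set (Fin d → ℝ) := Set.Icc 0 1

/-- The open unit cube `(0,1)^d`. -/
def openCube (d : ℕ) : Set (Fin d → ℝ) := {u | ∀ j, 0 < u j ∧ u j < 1}

/-! ### Sobolev classes `W_2^r` -/

/-- The iterated partial derivative of `φ` along the coordinate directions `α 0, …, α (k-1)`. -/
def iterPartial {d k : ℕ} (α : Fin k → Fin d) (φ : (Fin d → ℝ) → ℝ) (x : Fin d → ℝ) : ℝ :=
  iteratedFDeriv ℝ k φ x (fun i => Pi.single (α i) 1)

/-- `g` is the weak partial derivative of `f` on `U` along the directions `α`. -/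
def IsWeakPartial {d k : ℕ} (U : Set (Fin d → ℝ)) (f g : (Fin d → ℝ) → ℝ)
    (α : Fin k → Fin d) : Prop :=
  ∀ φ : (Fin d → ℝ) → ℝ, ContDiff ℝ ((⊤ : ℕ∞) : WithTop ℕ∞) φ → HasCompactSupport φ → tsupport φ ⊆ U →
    ∫ x in U, f x * iterPartial α φ x = (-1) ^ k * ∫ x in U, g x * φ x

/-- The Sobolev class `W_2^r(U)`: all weak partial derivatives of order at most `⌊r⌋` are in
`L^2(U)` and, for non-integer `r`, those of order `⌊r⌋` have finite Slobodeckij seminorm of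
order `r - ⌊r⌋`. -/
def MemSobolev {d : ℕ} (r : ℝ) (U : Set (Fin d → ℝ)) (f : (Fin d → ℝ) → ℝ) : Prop :=
  MemLp f 2 (volume.restrict U) ∧
  ∃ D : (k : ℕ) → (Fin k → Fin d) → (Fin d → ℝ) → ℝ,
    (∀ k : ℕ, k ≤ ⌊r⌋₊ → ∀ α : Fin k → Fin d,
      MemLp (D k α) 2 (volume.restrict U) ∧ IsWeakPartial U f (D k α) α) ∧
    (r ≠ (⌊r⌋₊ : ℝ) → ∀ α : Fin ⌊r⌋₊ → Fin d,
      ∫⁻ x in U, ∫⁻ y in U, ENNReal.ofReal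
        ((D ⌊r⌋₊ α x - D ⌊r⌋₊ α y) ^ 2 / ‖x - y‖ ^ ((d : ℝ) + 2 * (r - (⌊r⌋₊ : ℝ)))) < ∞)

/-! ### Copulas -/

/-- A `d`-dimensional copula. -/
structure IsCopula {d : ℕ} (C : (Fin d → ℝ) → ℝ) : Prop where
  mem_Icc : ∀ u ∈ cube d, C u ∈ Set.Icc (0 : ℝ) 1
  grounded : ∀ u ∈ cube d, (∃ i, u i = 0) → C u = 0
  margin : ∀ i : Fin d, ∀ t ∈ Set.Icc (0 : ℝ) 1,
    C (Function.update (1 : Fin d → ℝ) i t) = t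
  increasing : ∀ a ∈ cube d, ∀ b ∈ cube d, a ≤ b →
    0 ≤ ∑ s : Finset (Fin d), (-1 : ℝ) ^ (d - s.card) * C (fun j => if j ∈ s then b j else a j)

/-- `c` is a density of the copula `C` on the unit cube. -/
structure IsCopulaDensity {d : ℕ} (C c : (Fin d → ℝ) → ℝ) : Prop where
  nonneg : ∀ u ∈ cube d, 0 ≤ c u
  integrable : IntegrableOn c (cube d)
  eq_integral : ∀ u ∈ cube d, C u = ∫ v in Set.Icc 0 u, c v

/-! ### The population: priors, class-conditional laws, margins -/

section Population

variable {d K : ℕ}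

/-- The prior `π_y = P(Y = y)`. -/
def prior (P : Measure (Obs d K)) (y : Fin K) : ℝ := P.real (Prod.snd ⁻¹' {y})

/-- The conditional law of `X` given `Y = y`. -/
def classLaw (P : Measure (Obs d K)) (y : Fin K) : Measure (Fin d → ℝ) :=
  (P[|Prod.snd ⁻¹' {y}]).map Prod.fst

/-- The marginal distribution function `F_{j|y}`. -/
def margCDF (P : Measure (Obs d K)) (j : Fin d) (y : Fin K) (t : ℝ) : ℝ :=
  (classLaw P y).real {x | x j ≤ t}

/-- The marginal density `f_{j|y}`, the derivative of `F_{j|y}`. -/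
def margPDF (P : Measure (Obs d K)) (j : Fin d) (y : Fin K) : ℝ → ℝ := deriv (margCDF P j y)

/-- The joint distribution function of `X` given `Y = y`. -/
def jointCDF (P : Measure (Obs d K)) (y : Fin K) (x : Fin d → ℝ) : ℝ :=
  (classLaw P y).real (Set.Iic x)

/-- The regularity conditions on the population `P`, with class-conditional densities `p y`,
copulas `C y`, copula densities `c y`, Sobolev order `r` and Lipschitz constant `Lc` (for the
maximum norm) of the copula densities. -/
structure Regular (P : Measure (Obs d K)) (r : ℝ) (p C c : Fin K → (Fin d → ℝ) → ℝ)
    (Lc : ℝ≥0) : Prop where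
  /-- every class has positive probability -/
  prior_pos : ∀ y, 0 < prior P y
  /-- continuous class-conditional joint densities -/
  density_continuous : ∀ y, Continuous (p y)
  density_nonneg : ∀ y x, 0 ≤ p y x
  density : ∀ y, classLaw P y = volume.withDensity (fun x => ENNReal.ofReal (p y x))
  /-- the marginal distribution functions are differentiable, and strictly increasing on the
  interval where they are neither `0` nor `1` -/
  cdf_differentiable : ∀ j y, Differentiable ℝ (margCDF P j y)
  cdf_strictMono : ∀ j y,
    StrictMonoOn (margCDF P j y) {t | 0 < margCDF P j y t ∧ margCDF P j y t < 1}
  /-- the marginal densities are bounded and twice continuously differentiable on that interval -/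
  pdf_contDiff : ∀ j y,
    ContDiffOn ℝ 2 (margPDF P j y) {t | 0 < margCDF P j y t ∧ margCDF P j y t < 1}
  pdf_bounded : ∀ j y, ∃ B, ∀ t, margPDF P j y t ≤ B
  /-- sub-exponential (in particular: sub-Gaussian) tails -/
  tails : ∀ j y, ∃ A a : ℝ, 0 < a ∧
    ∀ t : ℝ, 0 ≤ t → (classLaw P y).real {x | t < |x j|} ≤ A * Real.exp (-a * t)
  /-- the copula `C y` of the class and its density `c y` -/
  copula : ∀ y, IsCopula (C y)
  sklar : ∀ y x, jointCDF P y x = C y (fun j => margCDF P j y (x j))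
  copula_density : ∀ y, IsCopulaDensity (C y) (c y)
  factorization : ∀ y x,
    p y x = c y (fun j => margCDF P j y (x j)) * ∏ j, margPDF P j y (x j)
  /-- smoothness of the copula density; boundedness follows from the Lipschitz property -/
  copula_sobolev : ∀ y, MemSobolev r (openCube d) (c y)
  copula_lipschitz : ∀ y, LipschitzOnWith Lc (c y) (cube d)

end Population

/-! ### Decision rules -/

/-- The smallest index at which `s` attains its maximum. -/
def firstArgmax {K : ℕ} [NeZero K] (s : Fin K → ℝ) : Fin K :=
  (Finset.univ.filter (fun y => ∀ y', s y' ≤ s y)).min' (by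
    obtain ⟨y, hy⟩ := Finite.exists_max s
    exact ⟨y, by simpa using hy⟩)

/-- The Bayes rule `x ↦ argmax_y π_y p_y(x)`. -/
def bayesRule {d K : ℕ} [NeZero K] (P : Measure (Obs d K)) (p : Fin K → (Fin d → ℝ) → ℝ)
    (x : Fin d → ℝ) : Fin K :=
  firstArgmax (fun y => prior P y * p y x)

/-! ### Marginal estimators -/

/-- A kernel of second order. -/
structure IsSecondOrderKernel (κ : ℝ → ℝ) : Prop where
  measurable : Measurable κ
  integrable : Integrable κ
  integral_eq_one : ∫ t, κ t = 1
  integrable_sq : Integrable (fun t => t ^ 2 * κ t)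
  first_moment : ∫ t, t * κ t = 0
  second_moment : 0 < ∫ t, t ^ 2 * κ t

section Estimators

variable {d K : ℕ}

/-- The indices below `n` of the training points in class `y`. -/
def classIdx (D : ℕ → Obs d K) (n : ℕ) (y : Fin K) : Finset ℕ :=
  (Finset.range n).filter (fun i => (D i).2 = y)

/-- The class count `n_y`. -/
def classCount (D : ℕ → Obs d K) (n : ℕ) (y : Fin K) : ℕ := (classIdx D n y).card

/-- The empirical prior `n_y / n`. -/
def empPrior (D : ℕ → Obs d K) (n : ℕ) (y : Fin K) : ℝ := (classCount D n y : ℝ) / n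

/-- The empirical distribution function of feature `j` in class `y`. -/
def ecdf (D : ℕ → Obs d K) (n : ℕ) (j : Fin d) (y : Fin K) (t : ℝ) : ℝ :=
  (((classIdx D n y).filter (fun i => (D i).1 j ≤ t)).card : ℝ) / classCount D n y

/-- The kernel density estimator of feature `j` in class `y`, with kernel `κ` and
bandwidth `h n_y`. -/
def kde (κ : ℝ → ℝ) (h : ℕ → ℝ) (D : ℕ → Obs d K) (n : ℕ) (j : Fin d) (y : Fin K) (t : ℝ) : ℝ :=
  (∑ i ∈ classIdx D n y, κ ((t - (D i).1 j) / h (classCount D n y))) /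
    (classCount D n y * h (classCount D n y))

/-- The empirical probability integral transform of class `y`. -/
def pit (D : ℕ → Obs d K) (n : ℕ) (y : Fin K) (x : Fin d → ℝ) : Fin d → ℝ :=
  fun j => ecdf D n j y (x j)

end Estimators

/-! ### Neural copulas -/

/-- Parameters of a ReLU network on `ℝ^d` of width `W` with `L + 1` hidden layers: weights and
biases of the first hidden layer, of the `L` further ones, and of the scalar output. -/
abbrev NetParam (d L W : ℕ) : Type :=
  ((Fin W → Fin d → ℝ) × (Fin W → ℝ)) ×
    (Fin L → (Fin W → Fin W → ℝ) × (Fin W → ℝ)) × ((Fin W → ℝ) × ℝ)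

def relu (t : ℝ) : ℝ := max t 0

def softplus (t : ℝ) : ℝ := Real.log (1 + Real.exp t)

/-- One layer with ReLU activation. -/
def reluLayer {m k : ℕ} (A : Fin k → Fin m → ℝ) (b : Fin k → ℝ) (z : Fin m → ℝ) : Fin k → ℝ :=
  fun i => relu (∑ j, A i j * z j + b i)

section Network

variable {d L W : ℕ}

/-- The activations of the last hidden layer. -/
def hidden (θ : NetParam d L W) (u : Fin d → ℝ) : Fin W → ℝ :=
  Fin.foldl L (fun z l => reluLayer (θ.2.1 l).1 (θ.2.1 l).2 z) (reluLayer θ.1.1 θ.1.2 u)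

/-- The positive network `NN(u; θ)`: ReLU hidden layers and softplus output. -/
def nn (θ : NetParam d L W) (u : Fin d → ℝ) : ℝ :=
  softplus (∑ i, θ.2.2.1 i * hidden θ u i + θ.2.2.2)

/-- The size of the network: the number of its nonzero weights and biases. -/
def size (θ : NetParam d L W) : ℕ :=
  {q : Fin W × Fin d | θ.1.1 q.1 q.2 ≠ 0}.ncard + {i : Fin W | θ.1.2 i ≠ 0}.ncard +
  {q : Fin L × Fin W × Fin W | (θ.2.1 q.1).1 q.2.1 q.2.2 ≠ 0}.ncard +
  {q : Fin L × Fin W | (θ.2.1 q.1).2 q.2 ≠ 0}.ncard +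
  {i : Fin W | θ.2.2.1 i ≠ 0}.ncard + {_i : Unit | θ.2.2.2 ≠ 0}.ncard

/-- The sieve: networks of size at most `S` whose normalized density `NN / ∫ NN` lies in the
Lipschitz ball of radius `Λ` (for the maximum norm on the cube). -/
def sieve (S : ℕ) (Λ : ℝ≥0) : Set (NetParam d L W) :=
  {θ | size θ ≤ S ∧ LipschitzOnWith Λ (fun u => nn θ u / ∫ v in cube d, nn θ v) (cube d)}

/-- The Monte-Carlo normalizer from the first `M` draws of `v`. -/
def mcNormalizer (M : ℕ) (v : ℕ → Fin d → ℝ) (θ : NetParam d L W) : ℝ :=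
  (∑ m ∈ Finset.range M, nn θ (v m)) / M

/-- The Monte-Carlo-normalized neural copula density. -/
def neuralCopula (M : ℕ) (v : ℕ → Fin d → ℝ) (θ : NetParam d L W) (u : Fin d → ℝ) : ℝ :=
  nn θ u / mcNormalizer M v θ

/-- The non-uniformity of the margins of a function on the cube. The inner integral also runs
over the overwritten `i`-th coordinate, which has no effect as `[0,1]` has length one. -/
def marginDefect (g : (Fin d → ℝ) → ℝ) : ℝ :=
  ∑ i : Fin d, ∫ t in (0 : ℝ)..1, ((∫ v in cube d, g (Function.update v i t)) - 1) ^ 2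

/-- The penalized log-likelihood of class `y`. -/
def objective {K : ℕ} (D : ℕ → Obs d K) (n M : ℕ) (v : ℕ → Fin d → ℝ) (lam : ℝ) (y : Fin K)
    (θ : NetParam d L W) : ℝ :=
  (∑ i ∈ classIdx D n y, Real.log (neuralCopula M v θ (pit D n y (D i).1))) / classCount D n y
    - lam * marginDefect (neuralCopula M v θ)

/-- The estimated class-conditional density. -/
def densityEst {K : ℕ} (κ : ℝ → ℝ) (h : Fin d → Fin K → ℕ → ℝ) (D : ℕ → Obs d K) (n M : ℕ)
    (v : ℕ → Fin d → ℝ) (θ : NetParam d L W) (y : Fin K) (x : Fin d → ℝ) : ℝ :=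
  neuralCopula M v θ (pit D n y x) * ∏ j, kde κ (h j y) D n j y (x j)

/-- The deep copula classifier with fitted parameters `θ y` and Monte-Carlo draws `v y`. -/
def classifier {K : ℕ} [NeZero K] (κ : ℝ → ℝ) (h : Fin d → Fin K → ℕ → ℝ) (D : ℕ → Obs d K)
    (n M : ℕ) (v : Fin K → ℕ → Fin d → ℝ) (θ : Fin K → NetParam d L W) (x : Fin d → ℝ) : Fin K :=
  firstArgmax (fun y => empPrior D n y * densityEst κ h D n M (v y) (θ y) y x)

end Network

/-! ### Growth of the tuning sequences -/

/-- `a ≍ b` up to powers of `log n`. -/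
def EqUpToLogs (a b : ℕ → ℝ) : Prop :=
  ∃ A : ℝ, 0 < A ∧ ∃ k : ℕ, ∀ᶠ n : ℕ in atTop,
    a n ≤ A * Real.log n ^ k * b n ∧ b n ≤ A * Real.log n ^ k * a n

/-- Growth of depth `L`, width `W`, size `S`, Monte-Carlo sample size `M` and penalty
weight `lam` with the training sample size. -/
structure Growth (d : ℕ) (r : ℝ) (L W S M : ℕ → ℕ) (lam : ℕ → ℝ) : Prop where
  depth : (fun n => (L n : ℝ)) =Θ[atTop] (fun n : ℕ => Real.log n)
  width : EqUpToLogs (fun n => (W n : ℝ)) (fun n => (n : ℝ) ^ ((d : ℝ) / (2 * r + d)))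
  size : EqUpToLogs (fun n => (S n : ℝ)) (fun n => (n : ℝ) ^ ((d : ℝ) / (2 * r + d)))
  mc_tendsto : Tendsto M atTop atTop
  mc_rate : (fun n => (M n : ℝ) ^ (-(1 / 2) : ℝ)) =o[atTop]
    (fun n : ℕ => (n : ℝ) ^ (-(r / (2 * r + d))))
  penalty_tendsto : Tendsto lam atTop atTop
  penalty_slow : ∃ k : ℕ, lam =O[atTop] (fun n : ℕ => Real.log n ^ k)

/-- Bandwidths of exact order `m^{-1/5}` in the class sample size `m`. -/
def IsBandwidth (h : ℕ → ℝ) : Prop :=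
  ∃ a A : ℝ, 0 < a ∧ ∀ m : ℕ, 1 ≤ m →
    a * (m : ℝ) ^ (-(1 / 5) : ℝ) ≤ h m ∧ h m ≤ A * (m : ℝ) ^ (-(1 / 5) : ℝ)

end DCC

end

/-! With finitely many classes, convergence of the estimated scores to the Bayes scores makes the
chosen class eventually a maximizer of the posterior (`eventually_apply_firstArgmax_eq`). The error
of a rule trained on independent data is one minus the mean posterior probability of its choice, so
dominated convergence gives the limit (`Regular.tendsto_error`). It is enough to argue almost surely
along a further subsequence of any subsequence; Borel-Cantelli then upgrades every convergence in
probability.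

Priors converge by the strong law and empirical ranks by Glivenko-Cantelli. The kernel estimator has
a random bandwidth, a function of the class count, and is handled by moments on events fixing that
count (`Regular.tendsto_measure_kde`). An independent test point falls almost surely at continuity
points of the marginal densities.

The core is uniform convergence of the fitted copula density
(`Regular.ae_tendstoUniformlyOn_nnDensity`). Normalized densities in the sieve are equi-Lipschitz
with mean one, hence lie in a compact set of continuous functions, so Arzelà-Ascoli takes the place
of entropy bounds. Along a convergent subsequence with limit `g`, averages over empirical ranks and
Monte-Carlo normalizers converge. The limit then has at least the likelihood of every mixture `(1 -
η) c + η`, provided `η` is also added to `g` inside the logarithm. A Hellinger bound, as `η → 0`,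
forces `g = c` (`eqOn_of_integral_log_le`).

The likelihood lower bound comes from deterministic comparators in the sieve
(`Regular.exists_comparator`): min-max ReLU networks computing a McShane extension of a mixture from
its values on a dyadic grid, multiplied by a large factor so that softplus is nearly the identity.
Normalization removes the factor and the Lipschitz constant does not increase
(`exists_sieve_approx`). The penalty is dropped for the fitted network because it is nonnegative.
For the comparators it tends to zero, because a copula density has uniform margins
(`IsCopulaDensity.integral_update_eq_one`) and the Monte-Carlo error beats the penalty weight. A
mesh `2 ^ (-s)` with `s` of order `√(log n)` meets all size and depth constraints
(`Growth.exists_scale`). -/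

namespace DCC

/-! ### ReLU networks computing binary trees of maxima and minima. -/

section Networks

variable {d : ℕ}

/-- `g` agrees on the cube with an affine combination of the first `w` functions `ν j`. -/
def InSpan (w : ℕ) (ν : ℕ → (Fin d → ℝ) → ℝ) (g : (Fin d → ℝ) → ℝ) : Prop :=
  ∃ (B : ℕ → ℝ) (β : ℝ), ∀ u ∈ cube d, g u = ∑ j ∈ Finset.range w, B j * ν j u + β

/-- The first `w` functions `ν i` are, on the cube, the activations of the hidden layer number `l`
of a ReLU network of width `w`. -/
def IsLayer (w : ℕ) : ℕ → (ℕ → (Fin d → ℝ) → ℝ) → Prop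
  | 0, ν => ∃ (A : ℕ → Fin d → ℝ) (b : ℕ → ℝ), ∀ i < w, ∀ u ∈ cube d,
      ν i u = relu (∑ j, A i j * u j + b i)
  | l + 1, ν => ∃ ν', IsLayer w l ν' ∧ ∃ (A : ℕ → ℕ → ℝ) (b : ℕ → ℝ), ∀ i < w, ∀ u ∈ cube d,
      ν i u = relu (∑ j ∈ Finset.range w, A i j * ν' j u + b i)

variable {w : ℕ} {ν : ℕ → (Fin d → ℝ) → ℝ} {f g : (Fin d → ℝ) → ℝ}

lemma InSpan.congr (hf : InSpan w ν f) (h : ∀ u ∈ cube d, g u = f u) : InSpan w ν g := by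
  obtain ⟨B, β, hB⟩ := hf
  exact ⟨B, β, fun u hu => (h u hu).trans (hB u hu)⟩

lemma InSpan.add (hf : InSpan w ν f) (hg : InSpan w ν g) : InSpan w ν (fun u => f u + g u) := by
  obtain ⟨B, β, hB⟩ := hf
  obtain ⟨B', β', hB'⟩ := hg
  refine ⟨fun j => B j + B' j, β + β', fun u hu => ?_⟩
  simp only [hB u hu, hB' u hu, add_mul, Finset.sum_add_distrib]
  ring

lemma InSpan.const_mul (a : ℝ) (hf : InSpan w ν f) : InSpan w ν (fun u => a * f u) := by
  obtain ⟨B, β, hB⟩ := hf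
  refine ⟨fun j => a * B j, a * β, fun u hu => ?_⟩
  simp only [hB u hu, mul_add, Finset.mul_sum, mul_assoc]

lemma InSpan.const (a : ℝ) : InSpan w ν (fun _ => a) :=
  ⟨fun _ => 0, a, fun u _ => by simp⟩

lemma InSpan.neuron {i : ℕ} (hi : i < w) : InSpan w ν (ν i) := by
  refine ⟨fun j => if j = i then 1 else 0, 0, fun u _ => ?_⟩
  simp [ite_mul, Finset.sum_ite_eq', hi]

lemma IsLayer.succ {l : ℕ} {ν' : ℕ → (Fin d → ℝ) → ℝ} (hν : IsLayer w l ν)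
    (h : ∀ i < w, ∃ g, InSpan w ν g ∧ ∀ u ∈ cube d, ν' i u = relu (g u)) :
    IsLayer w (l + 1) ν' := by
  have h' : ∀ i, ∃ (B : ℕ → ℝ) (β : ℝ), i < w → ∀ u ∈ cube d,
      ν' i u = relu (∑ j ∈ Finset.range w, B j * ν j u + β) := by
    intro i
    by_cases hi : i < w
    · obtain ⟨g, ⟨B, β, hB⟩, hg⟩ := h i hi
      exact ⟨B, β, fun _ u hu => by rw [hg u hu, hB u hu]⟩
    · exact ⟨0, 0, fun h => absurd h hi⟩
  choose B β hB using h'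
  exact ⟨ν, hν, B, β, hB⟩

lemma relu_of_nonneg {t : ℝ} (ht : 0 ≤ t) : relu t = t := max_eq_left ht

/-- One further layer computes a signed pairwise operation. -/
lemma IsLayer.pair {l m : ℕ} (s : ℝ) (hν : IsLayer w l ν) {a : ℕ → (Fin d → ℝ) → ℝ}
    (ha : ∀ i < 2 * m, InSpan w ν (a i)) (ha0 : ∀ i < 2 * m, ∀ u ∈ cube d, 0 ≤ a i u)
    (hm : 2 * m ≤ w) :
    ∃ ν', IsLayer w (l + 1) ν' ∧ ∀ i < m, InSpan w ν' (fun u =>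
      a (2 * i) u + s * relu (s * (a (2 * i + 1) u - a (2 * i) u))) := by
  classical
  -- Even neurons carry the first entry of a pair, unchanged by ReLU since it is nonnegative; odd
  -- neurons carry the signed difference. Surplus neurons are zero.
  let ν' : ℕ → (Fin d → ℝ) → ℝ := fun k u =>
    if k < 2 * m then
      (if k % 2 = 0 then relu (a k u) else relu (s * (a k u - a (k - 1) u))) else relu 0
  refine ⟨ν', hν.succ fun i _ => ?_, fun i hi => ?_⟩
  · by_cases him : i < 2 * m
    · by_cases hi2 : i % 2 = 0
      · exact ⟨a i, ha i him, fun u _ => by simp [ν', him, hi2]⟩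
      · refine ⟨fun u => s * (a i u + (-1) * a (i - 1) u),
          ((ha i him).add ((ha (i - 1) (by omega)).const_mul (-1))).const_mul s, fun u _ => ?_⟩
        simp only [ν', him, hi2, if_true, if_false]
        congr 1
        ring
    · exact ⟨fun _ => 0, InSpan.const 0, fun u _ => by simp [ν', him]⟩
  · have h1 : InSpan w ν' (ν' (2 * i)) := InSpan.neuron (by omega)
    have h2 : InSpan w ν' (ν' (2 * i + 1)) := InSpan.neuron (by omega)
    refine (h1.add (h2.const_mul s)).congr fun u hu => ?_
    have e1 : 2 * i < 2 * m := by omega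
    have e2 : 2 * i + 1 < 2 * m := by omega
    have e3 : (2 * i + 1) % 2 ≠ 0 := by omega
    simp only [ν', e1, e2, e3, if_true, if_false, Nat.mul_mod_right, Nat.add_sub_cancel]
    rw [relu_of_nonneg (ha0 _ e1 u hu)]

/-- Iterated pairwise reduction of an array: `pairFold f m a i` combines the `2 ^ m` entries of `a`
in the block number `i`. -/
def pairFold (f : ℝ → ℝ → ℝ) : ℕ → (ℕ → ℝ) → ℕ → ℝ
  | 0, a => a
  | m + 1, a => pairFold f m (fun i => f (a (2 * i)) (a (2 * i + 1)))

/-- A transitive relation between each combination and its two arguments propagates down the tree.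
An abstract relation serves both `≤` for minima and `≥` for maxima. -/
lemma pairFold_rel {f : ℝ → ℝ → ℝ} {R : ℝ → ℝ → Prop} (hR : ∀ a, R a a)
    (htrans : ∀ a b c, R a b → R b c → R a c) (hl : ∀ a b, R (f a b) a) (hr : ∀ a b, R (f a b) b)
    (m : ℕ) (a : ℕ → ℝ) (i : ℕ) : ∀ k < 2 ^ m, R (pairFold f m a i) (a (i * 2 ^ m + k)) := by
  induction m generalizing a with
  | zero => intro k hk; obtain rfl : k = 0 := by omega
            simpa [pairFold] using hR (a i)
  | succ m ih =>
    intro k hk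
    -- After one halving, entry `k` of a block sits in pair `k / 2`, as left or right member
    -- according to its parity.
    have h := ih (fun i => f (a (2 * i)) (a (2 * i + 1))) (k / 2) (by rw [pow_succ] at hk; omega)
    refine htrans _ _ _ h ?_
    have e : i * 2 ^ (m + 1) = 2 * (i * 2 ^ m) := by ring
    rcases Nat.mod_two_eq_zero_or_one k with hk2 | hk2
    · have : i * 2 ^ (m + 1) + k = 2 * (i * 2 ^ m + k / 2) := by omega
      rw [this]
      exact hl _ _
    · have : i * 2 ^ (m + 1) + k = 2 * (i * 2 ^ m + k / 2) + 1 := by omega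
      rw [this]
      exact hr _ _

/-- An operation that selects one of its arguments selects a leaf at the root. Together with
`pairFold_rel` this identifies the fold with the extremum over the block. -/
lemma pairFold_mem {f : ℝ → ℝ → ℝ} (hf : ∀ a b, f a b = a ∨ f a b = b)
    (m : ℕ) (a : ℕ → ℝ) (i : ℕ) : ∃ k < 2 ^ m, pairFold f m a i = a (i * 2 ^ m + k) := by
  induction m generalizing a with
  | zero => exact ⟨0, by simp, by simp [pairFold]⟩
  | succ m ih =>
    obtain ⟨k, hk, h⟩ := ih (fun i => f (a (2 * i)) (a (2 * i + 1)))
    have e : i * 2 ^ (m + 1) = 2 * (i * 2 ^ m) := by ring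
    have e' : 2 ^ (m + 1) = 2 * 2 ^ m := by ring
    rcases hf (a (2 * (i * 2 ^ m + k))) (a (2 * (i * 2 ^ m + k) + 1)) with h' | h'
    · exact ⟨2 * k, by omega, by rw [pairFold, h, h']; congr 1; omega⟩
    · exact ⟨2 * k + 1, by omega, by rw [pairFold, h, h']; congr 1; omega⟩

/-- Pairwise reductions of arrays are computed by one further layer for each halving. -/
lemma IsLayer.pairFold {f : ℝ → ℝ → ℝ} {s : ℝ} (hf : ∀ a b, f a b = a + s * relu (s * (b - a)))
    (hf0 : ∀ a b, 0 ≤ a → 0 ≤ b → 0 ≤ f a b) (m : ℕ) {l N : ℕ} {ν : ℕ → (Fin d → ℝ) → ℝ}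
    (hν : IsLayer w l ν) {a : ℕ → (Fin d → ℝ) → ℝ}
    (ha : ∀ i < N * 2 ^ m, InSpan w ν (a i)) (ha0 : ∀ i < N * 2 ^ m, ∀ u ∈ cube d, 0 ≤ a i u)
    (hN : N * 2 ^ m ≤ w) :
    ∃ ν', IsLayer w (l + m) ν' ∧ ∀ i < N,
      InSpan w ν' (fun u => DCC.pairFold f m (fun k => a k u) i) ∧
      ∀ u ∈ cube d, 0 ≤ DCC.pairFold f m (fun k => a k u) i := by
  induction m generalizing a l ν with
  | zero =>
    exact ⟨ν, hν, fun i hi => ⟨ha i (by simpa using hi), ha0 i (by simpa using hi)⟩⟩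
  | succ m ih =>
    have e : N * 2 ^ (m + 1) = 2 * (N * 2 ^ m) := by ring
    rw [e] at ha ha0 hN
    obtain ⟨ν₁, hν₁, h₁⟩ := hν.pair s ha ha0 hN
    obtain ⟨ν', hν', h'⟩ := ih (a := fun i u => f (a (2 * i) u) (a (2 * i + 1) u)) hν₁
      (fun i hi => (h₁ i hi).congr fun u _ => hf _ _)
      (fun i hi u hu => hf0 _ _ (ha0 _ (by omega) u hu) (ha0 _ (by omega) u hu)) (by omega)
    refine ⟨ν', ?_, h'⟩
    rwa [show l + (m + 1) = l + 1 + m by ring]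

/-- ReLU fixes a nonnegative function, so one neuron per layer carries it onward. This pads a
network to a prescribed depth. -/
lemma IsLayer.pass {l : ℕ} (hν : IsLayer w l ν) (hw : 1 ≤ w) (hg : InSpan w ν g)
    (hg0 : ∀ u ∈ cube d, 0 ≤ g u) (k : ℕ) : ∃ ν', IsLayer w (l + k) ν' ∧ InSpan w ν' g := by
  induction k with
  | zero => exact ⟨ν, hν, hg⟩
  | succ k ih =>
    obtain ⟨ν', hν', hg'⟩ := ih
    refine ⟨fun _ u => relu (g u), hν'.succ fun i _ => ⟨g, hg', fun u _ => rfl⟩, ?_⟩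
    exact (InSpan.neuron (i := 0) hw).congr fun u hu => (relu_of_nonneg (hg0 u hu)).symm

/-- The factors `1` bring maximum and minimum to the common signed pattern of `IsLayer.pair`. -/
lemma max_eq_add_relu (a b : ℝ) : max a b = a + 1 * relu (1 * (b - a)) := by
  rcases le_total a b with h | h <;> simp [relu, h]

lemma min_eq_add_relu (a b : ℝ) : min a b = a + (-1) * relu ((-1) * (b - a)) := by
  rcases le_total a b with h | h <;> simp [relu, h]

/-- The minimum over `2 ^ T` blocks of the maximum over `2 ^ m` nonnegative affine functions. -/
lemma exists_isLayer_minmax (m T : ℕ) (A : ℕ → Fin d → ℝ) (b : ℕ → ℝ)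
    (h0 : ∀ i, ∀ u ∈ cube d, 0 ≤ ∑ j, A i j * u j + b i) {l : ℕ} (hl : m + T ≤ l) :
    ∃ ν, IsLayer (2 ^ (T + m)) l ν ∧ InSpan (2 ^ (T + m)) ν (fun u =>
      pairFold min T (pairFold max m (fun i => ∑ j, A i j * u j + b i)) 0) := by
  set w := 2 ^ (T + m) with hw
  have hL0 : IsLayer (d := d) w 0 (fun i u => relu (∑ j, A i j * u j + b i)) :=
    ⟨A, b, fun i _ u _ => rfl⟩
  have hin : ∀ i < 2 ^ T * 2 ^ m, InSpan w (fun i u => relu (∑ j, A i j * u j + b i))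
      (fun u : Fin d → ℝ => ∑ j, A i j * u j + b i) := fun i hi =>
    (InSpan.neuron (w := w) (i := i) (ν := fun i u => relu (∑ j, A i j * u j + b i))
      (by rwa [hw, pow_add])).congr fun u hu => (relu_of_nonneg (h0 i u hu)).symm
  obtain ⟨ν₁, hν₁, h₁⟩ := hL0.pairFold max_eq_add_relu (fun a b ha _ => le_max_of_le_left ha) m
    hin (fun i _ => h0 i) (by rw [hw, pow_add])
  obtain ⟨ν₂, hν₂, h₂⟩ := hν₁.pairFold (N := 1) min_eq_add_relu (fun a b ha hb => le_min ha hb) T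
    (fun i hi => (h₁ i (by simpa using hi)).1) (fun i hi => (h₁ i (by simpa using hi)).2)
    (by rw [hw, pow_add, one_mul]; exact Nat.le_mul_of_pos_right _ (by positivity))
  -- The two trees use `m + T` layers beyond the first; the rest of the prescribed depth is filled
  -- by passing the root value on.
  obtain ⟨ν₃, hν₃, h₃⟩ := hν₂.pass Nat.one_le_two_pow (h₂ 0 one_pos).1 (h₂ 0 one_pos).2
    (l - (m + T))
  refine ⟨ν₃, ?_, h₃⟩
  rwa [show 0 + m + T + (l - (m + T)) = l by omega] at hν₃

/-- All nonzero hidden weights of `θ` belong to the first `w` neurons of each layer. -/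
structure SupportedIn (w : ℕ) {L W : ℕ} (θ : NetParam d L W) : Prop where
  first_weight : ∀ i j, θ.1.1 i j ≠ 0 → i.val < w
  first_bias : ∀ i, θ.1.2 i ≠ 0 → i.val < w
  weight : ∀ l i j, (θ.2.1 l).1 i j ≠ 0 → i.val < w ∧ j.val < w
  bias : ∀ l i, (θ.2.1 l).2 i ≠ 0 → i.val < w
  out : ∀ i, θ.2.2.1 i ≠ 0 → i.val < w

/-- Triples of naturals accommodate the index sets of every kind of hidden or output weight, so each
count reduces to the size of a product of ranges. -/
lemma ncard_le_of_injOn_range {α : Type*} {s : Set α} (t : Finset (ℕ × ℕ × ℕ)) (f : α → ℕ × ℕ × ℕ)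
    (hf : Function.Injective f) (hs : ∀ x ∈ s, f x ∈ t) : s.ncard ≤ t.card := by
  rw [← Set.ncard_coe_finset]
  exact Set.ncard_le_ncard_of_injOn f hs hf.injOn t.finite_toSet

lemma SupportedIn.size_le {L W : ℕ} {θ : NetParam d L W} (h : SupportedIn w θ) :
    size θ ≤ w * d + w + L * (w * w) + L * w + w + 1 := by
  have h1 := ncard_le_of_injOn_range (s := {q : Fin W × Fin d | θ.1.1 q.1 q.2 ≠ 0})
    (Finset.range w ×ˢ Finset.range d ×ˢ {0}) (fun q => (q.1.val, q.2.val, 0))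
    (fun q q' e => by simpa [Prod.ext_iff, Fin.ext_iff] using e)
    (fun q hq => by simpa using h.first_weight _ _ hq)
  have h2 := ncard_le_of_injOn_range (s := {i : Fin W | θ.1.2 i ≠ 0})
    (Finset.range w ×ˢ {0} ×ˢ {0}) (fun q => (q.val, 0, 0))
    (fun q q' e => by simpa [Prod.ext_iff, Fin.ext_iff] using e)
    (fun q hq => by simpa using h.first_bias _ hq)
  have h3 := ncard_le_of_injOn_range
    (s := {q : Fin L × Fin W × Fin W | (θ.2.1 q.1).1 q.2.1 q.2.2 ≠ 0})
    (Finset.range L ×ˢ Finset.range w ×ˢ Finset.range w) (fun q => (q.1.val, q.2.1.val, q.2.2.val))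
    (fun q q' e => by simpa [Prod.ext_iff, Fin.ext_iff] using e)
    (fun q hq => by simpa using h.weight _ _ _ hq)
  have h4 := ncard_le_of_injOn_range (s := {q : Fin L × Fin W | (θ.2.1 q.1).2 q.2 ≠ 0})
    (Finset.range L ×ˢ Finset.range w ×ˢ {0}) (fun q => (q.1.val, q.2.val, 0))
    (fun q q' e => by simpa [Prod.ext_iff, Fin.ext_iff] using e)
    (fun q hq => by simpa using h.bias _ _ hq)
  have h5 := ncard_le_of_injOn_range (s := {i : Fin W | θ.2.2.1 i ≠ 0})
    (Finset.range w ×ˢ {0} ×ˢ {0}) (fun q => (q.val, 0, 0))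
    (fun q q' e => by simpa [Prod.ext_iff, Fin.ext_iff] using e)
    (fun q hq => by simpa using h.out _ hq)
  have h6 : {_i : Unit | θ.2.2.2 ≠ 0}.ncard ≤ 1 :=
     Set.ncard_le_one_iff_subsingleton.2 Set.subsingleton_of_subsingleton
  simp only [Finset.card_product, Finset.card_range, Finset.card_singleton,
    mul_one] at h1 h2 h3 h4 h5
  unfold size
  omega

lemma hidden_snoc {L W : ℕ} (a : (Fin W → Fin d → ℝ) × (Fin W → ℝ))
    (b : Fin L → (Fin W → Fin W → ℝ) × (Fin W → ℝ)) (x : (Fin W → Fin W → ℝ) × (Fin W → ℝ))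
    (c : (Fin W → ℝ) × ℝ) (u : Fin d → ℝ) :
    hidden (L := L + 1) (a, Fin.snoc (α := fun _ => _) b x, c) u =
      reluLayer x.1 x.2 (hidden (L := L) (a, b, c) u) := by
  simp [hidden, Fin.foldl_succ_last]

lemma sum_fin_ite_eq_sum_range {W : ℕ} (hw : w ≤ W) (F : ℕ → ℝ) :
    ∑ j : Fin W, (if j.val < w then F j else 0) = ∑ j ∈ Finset.range w, F j := by
  rw [Fin.sum_univ_eq_sum_range (fun j => if j < w then F j else 0) W, ← Finset.sum_filter]
  congr 1
  ext j
  simp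
  omega

/-- Layers are realized by parameters of any larger width. -/
lemma IsLayer.exists_hidden {W : ℕ} (hw : w ≤ W) (l : ℕ) {ν : ℕ → (Fin d → ℝ) → ℝ}
    (hν : IsLayer w l ν) :
    ∃ (a : (Fin W → Fin d → ℝ) × (Fin W → ℝ))
      (b : Fin l → (Fin W → Fin W → ℝ) × (Fin W → ℝ)),
      SupportedIn w ((a, b, (0, 0)) : NetParam d l W) ∧
      ∀ c, ∀ u ∈ cube d, ∀ i : Fin W, hidden ((a, b, c) : NetParam d l W) u i =
        if i.val < w then ν i u else 0 := by
  induction l generalizing ν with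
  | zero =>
    obtain ⟨A, b, h⟩ := hν
    refine ⟨(fun i j => if i.val < w then A i j else 0, fun i => if i.val < w then b i else 0),
      Fin.elim0, ⟨?_, ?_, fun l => l.elim0, fun l => l.elim0, ?_⟩, ?_⟩
    · intro i j hij
      by_contra hi
      simp [hi] at hij
    · intro i hij
      by_contra hi
      simp [hi] at hij
    · intro i hi
      simp at hi
    · intro c u hu i
      by_cases hi : i.val < w
      · simp [hidden, reluLayer, hi, h i hi u hu]
      · simp [hidden, reluLayer, hi, relu]
  | succ l ih =>
    obtain ⟨ν', hν', A, β, h⟩ := hν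
    obtain ⟨a, b, hs, hab⟩ := ih hν'
    refine ⟨a, Fin.snoc (α := fun _ => _) b
      ((fun i j => if i.val < w ∧ j.val < w then A i j else 0),
        fun i => if i.val < w then β i else 0), ⟨hs.first_weight, hs.first_bias, ?_, ?_, ?_⟩, ?_⟩
    · intro k
      refine Fin.lastCases ?_ (fun k => ?_) k
      · intro i j hij
        by_contra hi
        simp [hi] at hij
      · simpa using hs.weight k
    · intro k
      refine Fin.lastCases ?_ (fun k => ?_) k
      · intro i hij
        by_contra hi
        simp [hi] at hij
      · simpa using hs.bias k
    · intro i hi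
      simp at hi
    · intro c u hu i
      rw [hidden_snoc]
      by_cases hi : i.val < w
      · simp only [reluLayer, hi, true_and, if_true, hab c u hu]
        rw [h i hi u hu, ← sum_fin_ite_eq_sum_range hw]
        congr 2
        refine Finset.sum_congr rfl fun j _ => ?_
        split_ifs <;> simp
      · simp [reluLayer, hi, relu]

/-- Functions in the span of the last hidden layer are the pre-activations of networks of dense
size. -/
lemma IsLayer.exists_nn {W l : ℕ} (hw : w ≤ W) (hν : IsLayer w l ν) (hg : InSpan w ν g) :
    ∃ θ : NetParam d l W, size θ ≤ w * d + w + l * (w * w) + l * w + w + 1 ∧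
      ∀ u ∈ cube d, nn θ u = softplus (g u) := by
  obtain ⟨a, b, hs, hab⟩ := hν.exists_hidden hw
  obtain ⟨B, β, hB⟩ := hg
  refine ⟨(a, b, (fun i => if i.val < w then B i else 0, β)),
    SupportedIn.size_le ⟨hs.first_weight, hs.first_bias, hs.weight, hs.bias, ?_⟩, ?_⟩
  · intro i hij
    by_contra hi
    simp [hi] at hij
  · intro u hu
    simp only [nn, hab _ u hu, hB u hu]
    rw [← sum_fin_ite_eq_sum_range hw]
    congr 2
    refine Finset.sum_congr rfl fun j _ => ?_
    split_ifs <;> simp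

end Networks

end DCC

namespace DCC

/-! ### The unit cube: Lipschitz functions, dyadic grids, and the maximum norm as a maximum of
linear forms. -/

section Cube

variable {d : ℕ}

lemma mem_cube {u : Fin d → ℝ} : u ∈ cube d ↔ ∀ j, 0 ≤ u j ∧ u j ≤ 1 := by
  simp [cube, Set.mem_Icc, Pi.le_def, forall_and]

lemma isCompact_cube : IsCompact (cube d) := isCompact_Icc

lemma measurableSet_cube : MeasurableSet (cube d) := measurableSet_Icc

lemma volume_cube : volume (cube d) = 1 := by
  simp [cube, Real.volume_Icc_pi]

instance : IsProbabilityMeasure ((volume : Measure (Fin d → ℝ)).restrict (cube d)) :=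
  ⟨by simp [volume_cube]⟩

lemma integral_cube_const (a : ℝ) : ∫ _ in cube d, a = a := by simp

lemma norm_sub_le_one_of_mem_cube {u v : Fin d → ℝ} (hu : u ∈ cube d) (hv : v ∈ cube d) :
    ‖u - v‖ ≤ 1 := by
  rw [pi_norm_le_iff_of_nonneg zero_le_one]
  intro j
  have h1 := mem_cube.1 hu j
  have h2 := mem_cube.1 hv j
  rw [Pi.sub_apply, Real.norm_eq_abs, abs_le]
  constructor <;> linarith

lemma _root_.LipschitzOnWith.abs_sub_le {f : (Fin d → ℝ) → ℝ} {K : ℝ≥0} {s : Set (Fin d → ℝ)}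
    (hf : LipschitzOnWith K f s) {u v : Fin d → ℝ} (hu : u ∈ s) (hv : v ∈ s) :
    |f u - f v| ≤ K * ‖u - v‖ := by
  have := hf.dist_le_mul u hu v hv
  rwa [Real.dist_eq, dist_eq_norm] at this

lemma integrableOn_cube_of_continuousOn {f : (Fin d → ℝ) → ℝ} (hf : ContinuousOn f (cube d)) :
    IntegrableOn f (cube d) := hf.integrableOn_compact isCompact_cube

/-- A Lipschitz function of mean one on the cube is bounded. -/
lemma le_one_add_of_integral_eq_one {f : (Fin d → ℝ) → ℝ} {K : ℝ≥0}
    (hf : LipschitzOnWith K f (cube d)) (hI : ∫ v in cube d, f v = 1) {u : Fin d → ℝ}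
    (hu : u ∈ cube d) : f u ≤ 1 + K := by
  have h : ∫ _ in cube d, (f u - K) ≤ ∫ v in cube d, f v := by
    refine setIntegral_mono_on (integrable_const _)
      (integrableOn_cube_of_continuousOn hf.continuousOn) measurableSet_cube fun v hv => ?_
    have h1 := (abs_le.1 (hf.abs_sub_le hu hv)).2
    have h2 := mul_le_mul_of_nonneg_left (norm_sub_le_one_of_mem_cube hu hv) K.2
    simp only [NNReal.val_eq_coe] at h2
    linarith
  rw [integral_cube_const, hI] at h
  linarith

/-- The grid consists of the lower corners of the dyadic cells; a power of two many points fill the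
leaves of a binary tree exactly. -/
lemma exists_grid (d s : ℕ) : ∃ x : ℕ → Fin d → ℝ, (∀ k, x k ∈ cube d) ∧
    ∀ u ∈ cube d, ∃ k < 2 ^ (s * d), ‖u - x k‖ ≤ (2 ^ s : ℝ)⁻¹ := by
  have hc : Fintype.card (Fin d → Fin (2 ^ s)) = 2 ^ (s * d) := by simp [pow_mul]
  let e := Fintype.equivFinOfCardEq hc
  have hpos : (0 : ℝ) < 2 ^ s := by positivity
  -- Reduction modulo the number of points makes the enumeration total in `k`.
  refine ⟨fun k j => ((e.symm ⟨k % 2 ^ (s * d), Nat.mod_lt _ (by positivity)⟩ j : ℕ) : ℝ) / 2 ^ s,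
    fun k => mem_cube.2 fun j => ⟨by positivity, ?_⟩, fun u hu => ?_⟩
  · rw [div_le_one hpos]
    exact_mod_cast (e.symm ⟨k % 2 ^ (s * d), Nat.mod_lt _ (by positivity)⟩ j).2.le
  -- The cap at `2 ^ s - 1` matters only for `u j = 1`, which is assigned to the last cell.
  · have hlt : ∀ j, min ⌊u j * 2 ^ s⌋₊ (2 ^ s - 1) < 2 ^ s := fun j =>
      (min_le_right _ _).trans_lt (Nat.sub_lt (by positivity) one_pos)
    refine ⟨e fun j => ⟨_, hlt j⟩, (e _).2, ?_⟩
    rw [pi_norm_le_iff_of_nonneg (by positivity)]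
    intro j
    have hmod : (⟨(e fun j => ⟨_, hlt j⟩ : ℕ) % 2 ^ (s * d), Nat.mod_lt _ (by positivity)⟩ :
        Fin (2 ^ (s * d))) = e fun j => ⟨_, hlt j⟩ := Fin.ext (Nat.mod_eq_of_lt (e _).2)
    simp only [hmod, Equiv.symm_apply_apply, Pi.sub_apply, Real.norm_eq_abs]
    obtain ⟨h0, h1⟩ := mem_cube.1 hu j
    have hfl := Nat.floor_le (mul_nonneg h0 hpos.le)
    have hfl' := Nat.lt_floor_add_one (u j * 2 ^ s)
    have key : |u j * 2 ^ s - (min ⌊u j * 2 ^ s⌋₊ (2 ^ s - 1) : ℕ)| ≤ 1 := by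
      rcases le_total ⌊u j * 2 ^ s⌋₊ (2 ^ s - 1) with h | h
      · rw [min_eq_left h, abs_le]
        constructor <;> linarith
      · rw [min_eq_right h, Nat.cast_sub Nat.one_le_two_pow]
        have h' : ((2 ^ s - 1 : ℕ) : ℝ) ≤ (⌊u j * 2 ^ s⌋₊ : ℝ) := by exact_mod_cast h
        rw [Nat.cast_sub Nat.one_le_two_pow] at h'
        push_cast at h' ⊢
        have : u j * 2 ^ s ≤ 2 ^ s := by nlinarith
        rw [abs_le]
        constructor <;> linarith
    have : u j - (min ⌊u j * 2 ^ s⌋₊ (2 ^ s - 1) : ℕ) / (2 : ℝ) ^ s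
        = (u j * 2 ^ s - (min ⌊u j * 2 ^ s⌋₊ (2 ^ s - 1) : ℕ)) * (2 ^ s : ℝ)⁻¹ := by
      field_simp
    rw [this, abs_mul, abs_of_pos (inv_pos.2 hpos)]
    exact mul_le_of_le_one_left (by positivity) key

/-- The sign vectors `e 0, …, e (d-1), -e 0, …, -e (d-1), 0, 0, …`. -/
def signVec (d q : ℕ) (j : Fin d) : ℝ := if q = j then 1 else if q = j + d then -1 else 0

lemma signVec_left (j : Fin d) (v : Fin d → ℝ) : ∑ i, signVec d j i * v i = v j := by
  rw [Finset.sum_eq_single j]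
  · simp [signVec]
  · intro i _ hij
    have h1 : (j : ℕ) ≠ i := fun h => hij (Fin.ext h.symm)
    have h2 : (j : ℕ) ≠ i + d := by omega
    simp [signVec, h1, h2]
  · simp

lemma signVec_right (j : Fin d) (v : Fin d → ℝ) : ∑ i, signVec d (j + d) i * v i = -v j := by
  rw [Finset.sum_eq_single j]
  · have : (j : ℕ) + d ≠ j := by omega
    simp [signVec]
    omega
  · intro i _ hij
    have h1 : (j : ℕ) + d ≠ i := by omega
    have h2 : (j : ℕ) + d ≠ i + d := fun h => hij (Fin.ext (by omega))
    simp [signVec, h1]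
    intro h
    omega
  · simp

lemma sum_signVec_le_norm (q : ℕ) (v : Fin d → ℝ) : |∑ i, signVec d q i * v i| ≤ ‖v‖ := by
  by_cases h : q < d
  · have := signVec_left ⟨q, h⟩ v
    simp only at this
    rw [this]
    exact norm_le_pi_norm v _
  by_cases h' : q < d + d
  · have := signVec_right ⟨q - d, by omega⟩ v
    simp only at this
    rw [Nat.sub_add_cancel (by omega)] at this
    rw [this, abs_neg]
    exact norm_le_pi_norm v _
  · have : ∑ i, signVec d q i * v i = 0 := Finset.sum_eq_zero fun i _ => by
      have h1 : q ≠ i := by omega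
      have h2 : q ≠ i + d := by omega
      simp [signVec, h1, h2]
    simp [this]

/-- The maximum norm is attained at some coordinate with some sign. The `2 * d` relevant forms fit
in a block of length `2 ^ (2 * d)`, a power of two as the tree requires; the padding forms vanish
and never exceed the norm. -/
lemma exists_sum_signVec_eq_norm (hd : 1 ≤ d) (v : Fin d → ℝ) :
    ∃ q < 2 ^ (2 * d), ∑ i, signVec d q i * v i = ‖v‖ := by
  have hlt : d + d < 2 ^ (2 * d) := by
    have := Nat.lt_two_pow_self (n := 2 * d)
    omega
  have : Nonempty (Fin d) := ⟨⟨0, hd⟩⟩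
  obtain ⟨j, hj⟩ : ∃ j, ‖v‖ = |v j| := by
    obtain ⟨j, hj⟩ := Finite.exists_max fun j => ‖v j‖
    exact ⟨j, le_antisymm ((pi_norm_le_iff_of_nonneg (norm_nonneg _)).2 hj) (norm_le_pi_norm v j)⟩
  rcases le_total 0 (v j) with h | h
  · exact ⟨j, by omega, by rw [signVec_left, hj, abs_of_nonneg h]⟩
  · exact ⟨j + d, by omega, by rw [signVec_right, hj, abs_of_nonpos h]⟩

end Cube

/-! ### Approximation of Lipschitz densities by normalized softplus networks. -/

noncomputable section Approximation

variable {d : ℕ}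

lemma le_softplus (t : ℝ) : t ≤ softplus t := by
  rw [softplus, Real.le_log_iff_exp_le (by positivity)]
  linarith

lemma softplus_pos (t : ℝ) : 0 < softplus t := Real.log_pos (by linarith [Real.exp_pos t])

lemma softplus_le_add_one {t : ℝ} (ht : 0 ≤ t) : softplus t ≤ t + 1 := by
  rw [softplus, Real.log_le_iff_le_exp (by positivity), Real.exp_add]
  have h1 := Real.add_one_le_exp (1 : ℝ)
  have h2 := Real.one_le_exp ht
  nlinarith

lemma softplus_mono : Monotone softplus := fun a b h => by
  unfold softplus
  gcongr

lemma softplus_sub_le {a b : ℝ} (h : a ≤ b) : softplus b - softplus a ≤ b - a := by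
  have : softplus b ≤ (b - a) + softplus a := by
    rw [softplus, softplus, Real.log_le_iff_le_exp (by positivity), Real.exp_add,
      Real.exp_log (by positivity), mul_add, ← Real.exp_add]
    have := Real.one_le_exp (sub_nonneg.2 h)
    simp only [sub_add_cancel]
    linarith
  linarith

lemma abs_softplus_sub_le (a b : ℝ) : |softplus a - softplus b| ≤ |a - b| := by
  rcases le_total a b with h | h
  · rw [abs_sub_comm, abs_of_nonneg (sub_nonneg.2 (softplus_mono h)), abs_sub_comm,
      abs_of_nonneg (sub_nonneg.2 h)]
    exact softplus_sub_le h
  · rw [abs_of_nonneg (sub_nonneg.2 (softplus_mono h)), abs_of_nonneg (sub_nonneg.2 h)]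
    exact softplus_sub_le h

lemma continuous_softplus : Continuous softplus := by
  unfold softplus
  exact Continuous.log (by fun_prop) fun x => by positivity

lemma continuous_relu : Continuous relu := by unfold relu; fun_prop

lemma continuous_foldl {α β : Type*} [TopologicalSpace α] [TopologicalSpace β] (L : ℕ)
    (f : α → β → Fin L → β) (hf : ∀ l, Continuous fun p : α × β => f p.1 p.2 l) (z : α → β)
    (hz : Continuous z) : Continuous fun x => Fin.foldl L (f x) (z x) := by
  induction L generalizing z with
  | zero => simpa using hz
  | succ L ih =>
    simp only [Fin.foldl_succ]
    exact ih (fun x b l => f x b l.succ) (fun l => hf l.succ) _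
      ((hf 0).comp (continuous_id.prodMk hz))

/-- Joint continuity in parameters and input is what makes a network with random parameters,
evaluated at a random point, measurable. -/
lemma continuous_nn_uncurry {L W : ℕ} :
    Continuous fun x : NetParam d L W × (Fin d → ℝ) => nn x.1 x.2 := by
  have h : Continuous fun x : NetParam d L W × (Fin d → ℝ) => hidden x.1 x.2 := by
    unfold hidden
    refine continuous_foldl L
      (fun x z l => reluLayer (x.1.2.1 l).1 (x.1.2.1 l).2 z) (fun l => ?_)
      (fun x : NetParam d L W × (Fin d → ℝ) => reluLayer x.1.1.1 x.1.1.2 x.2) ?_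
    · unfold reluLayer
      exact continuous_pi fun i => continuous_relu.comp (by fun_prop)
    · unfold reluLayer
      exact continuous_pi fun i => continuous_relu.comp (by fun_prop)
  unfold nn
  refine continuous_softplus.comp ?_
  fun_prop

lemma continuous_nn {L W : ℕ} (θ : NetParam d L W) : Continuous (nn θ) :=
  continuous_nn_uncurry.comp (continuous_const.prodMk continuous_id)

lemma nn_pos {L W : ℕ} (θ : NetParam d L W) (u : Fin d → ℝ) : 0 < nn θ u := softplus_pos _

/-- The network normalized to a probability density on the cube. -/
def nnDensity {L W : ℕ} (θ : NetParam d L W) (u : Fin d → ℝ) : ℝ := nn θ u / ∫ v in cube d, nn θ v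

/-- A min-max network computes, up to the constant `K`, the upper McShane extension of the values
of `c` on a grid of mesh `2 ^ (-s)`. -/
lemma exists_isLayer_mcShane (hd : 1 ≤ d) {c : (Fin d → ℝ) → ℝ} {K : ℝ≥0}
    (h0 : ∀ u ∈ cube d, 0 ≤ c u) (hL : LipschitzOnWith K c (cube d)) (s l : ℕ)
    (hl : 2 * d + s * d ≤ l) :
    ∃ ν g, IsLayer (2 ^ (s * d + 2 * d)) l ν ∧ InSpan (2 ^ (s * d + 2 * d)) ν g ∧
      (∀ u ∈ cube d, c u ≤ g u ∧ g u ≤ c u + 2 * K * (2 ^ s : ℝ)⁻¹) ∧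
      LipschitzOnWith K g (cube d) := by
  obtain ⟨x, hx, hgrid⟩ := exists_grid d s
  set m := 2 * d with hm
  -- Leaf `i` encodes a grid point by its quotient and a sign vector by its remainder modulo `2 ^
  -- m`. The maximum over a block is then the cone `c (x k) + K + K * ‖u - x k‖`.
  set A : ℕ → Fin d → ℝ := fun i j => K * signVec d (i % 2 ^ m) j with hA
  set b : ℕ → ℝ := fun i =>
    c (x (i / 2 ^ m)) + K - K * ∑ j, signVec d (i % 2 ^ m) j * x (i / 2 ^ m) j with hb
  have hleaf : ∀ i u, ∑ j, A i j * u j + b i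
      = c (x (i / 2 ^ m)) + K + K * ∑ j, signVec d (i % 2 ^ m) j * (u - x (i / 2 ^ m)) j := by
    intro i u
    simp only [hA, hb, Pi.sub_apply, mul_sub, Finset.sum_sub_distrib, Finset.mul_sum, mul_assoc]
    ring
  -- The offset `K` secures nonnegativity of all leaves, as the cube has diameter at most one; it is
  -- subtracted again at the output.
  have hnn : ∀ i, ∀ u ∈ cube d, 0 ≤ ∑ j, A i j * u j + b i := by
    intro i u hu
    rw [hleaf]
    have h1 := h0 _ (hx (i / 2 ^ m))
    have h2 := (abs_le.1 (sum_signVec_le_norm (i % 2 ^ m) (u - x (i / 2 ^ m)))).1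
    have h3 := norm_sub_le_one_of_mem_cube hu (hx (i / 2 ^ m))
    have h4 : 0 ≤ K * (1 + ∑ j, signVec d (i % 2 ^ m) j * (u - x (i / 2 ^ m)) j) :=
      mul_nonneg K.2 (by linarith)
    linarith
  obtain ⟨ν, hν, hspan⟩ := exists_isLayer_minmax m (s * d) A b hnn hl
  set G : (Fin d → ℝ) → ℝ := fun u =>
    pairFold min (s * d) (pairFold max m (fun i => ∑ j, A i j * u j + b i)) 0 with hG
  have hpos : 0 < 2 ^ m := by positivity
  have hmax : ∀ u k, pairFold max m (fun i => ∑ j, A i j * u j + b i) k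
      = c (x k) + K + K * ‖u - x k‖ := by
    intro u k
    have hdiv : ∀ q < 2 ^ m, (k * 2 ^ m + q) / 2 ^ m = k := fun q hq => by
      rw [mul_comm, Nat.mul_add_div hpos, Nat.div_eq_of_lt hq, add_zero]
    have hmod : ∀ q < 2 ^ m, (k * 2 ^ m + q) % 2 ^ m = q := fun q hq => by
      rw [mul_comm, Nat.mul_add_mod, Nat.mod_eq_of_lt hq]
    apply le_antisymm
    · obtain ⟨q, hq, h⟩ := pairFold_mem max_choice m (fun i => ∑ j, A i j * u j + b i) k
      rw [h, hleaf, hdiv q hq, hmod q hq]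
      have := (abs_le.1 (sum_signVec_le_norm q (u - x k))).2
      gcongr
    · obtain ⟨q, hq, h⟩ := exists_sum_signVec_eq_norm hd (u - x k)
      have h' := pairFold_rel (R := (· ≥ ·)) (fun a => le_rfl) (fun a b c h h' => h'.trans h)
        le_max_left le_max_right m (fun i => ∑ j, A i j * u j + b i) k q hq
      rwa [ge_iff_le, hleaf, hdiv q hq, hmod q hq, h] at h'
  have hle : ∀ u, ∀ k < 2 ^ (s * d), G u ≤ c (x k) + K + K * ‖u - x k‖ := by
    intro u k hk
    have := pairFold_rel (R := (· ≤ ·)) (fun a => le_rfl) (fun a b c h h' => h.trans h')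
      min_le_left min_le_right (s * d) (pairFold max m (fun i => ∑ j, A i j * u j + b i)) 0 k hk
    rwa [zero_mul, zero_add, hmax] at this
  have hex : ∀ u, ∃ k < 2 ^ (s * d), G u = c (x k) + K + K * ‖u - x k‖ := by
    intro u
    obtain ⟨k, hk, h⟩ := pairFold_mem min_choice (s * d)
      (pairFold max m (fun i => ∑ j, A i j * u j + b i)) 0
    exact ⟨k, hk, by rw [hG]; simp only; rw [h, zero_mul, zero_add, hmax]⟩
  refine ⟨ν, fun u => G u + (-(K : ℝ)), hν, hspan.add (InSpan.const _), fun u hu => ⟨?_, ?_⟩, ?_⟩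
  · obtain ⟨k, hk, h⟩ := hex u
    have := (abs_le.1 (hL.abs_sub_le hu (hx k))).2
    simp only [h]
    linarith
  · obtain ⟨k, hk, h⟩ := hgrid u hu
    have h1 := hle u k hk
    have h2 := (abs_le.1 (hL.abs_sub_le hu (hx k))).1
    have h3 := mul_le_mul_of_nonneg_left h K.2
    simp only [NNReal.val_eq_coe] at h3
    linarith
  -- A minimum of `K`-Lipschitz cones is `K`-Lipschitz: compare at the grid point attaining the
  -- minimum at `v`.
  · refine LipschitzOnWith.of_le_add_mul K fun u _ v _ => ?_
    obtain ⟨k, hk, h⟩ := hex v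
    have h1 := hle u k hk
    have h2 : ‖u - x k‖ ≤ ‖v - x k‖ + dist u v := by
      rw [dist_eq_norm, show u - x k = (v - x k) + (u - v) by abel]
      exact norm_add_le _ _
    have h3 := mul_le_mul_of_nonneg_left h2 K.2
    simp only [NNReal.val_eq_coe] at h3
    simp only [h]
    linarith

/-- Lipschitz densities on the cube are approximated at rate `2 ^ (-s)` by normalized networks
with the same Lipschitz constant. -/
theorem exists_sieve_approx (hd : 1 ≤ d) {c : (Fin d → ℝ) → ℝ} {K : ℝ≥0}
    (h0 : ∀ u ∈ cube d, 0 ≤ c u) (hL : LipschitzOnWith K c (cube d)) (hI : ∫ u in cube d, c u = 1)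
    {w : ℕ} (s : ℕ) {L W S : ℕ} (hw : w = 2 ^ (s * d + 2 * d)) (hdepth : 2 * d + s * d ≤ L)
    (hW : w ≤ W) (hS : w * d + w + L * (w * w) + L * w + w + 1 ≤ S) :
    ∃ θ : NetParam d L W, θ ∈ sieve S K ∧ ∀ u ∈ cube d,
      |nnDensity θ u - c u| ≤ (1 + K) * (2 * K + 1) * (2 ^ s : ℝ)⁻¹ := by
  obtain ⟨ν, g, hν, hg, hcg, hgL⟩ := exists_isLayer_mcShane hd h0 hL s L hdepth
  rw [← hw] at hν hg
  set B : ℝ := 2 ^ s with hB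
  have hB0 : 0 < B := by positivity
  -- On nonnegative arguments softplus differs from the identity by at most one. Scaling by `B = 2 ^
  -- s` makes this a relative error of order `2 ^ (-s)`, and the scale disappears on normalization.
  obtain ⟨θ, hsize, hθ⟩ := hν.exists_nn hW (hg.const_mul B)
  have hK : (0 : ℝ) ≤ K := K.2
  have hlow : ∀ u ∈ cube d, B * c u ≤ nn θ u := fun u hu => by
    rw [hθ u hu]
    exact (mul_le_mul_of_nonneg_left (hcg u hu).1 hB0.le).trans (le_softplus _)
  have hup : ∀ u ∈ cube d, nn θ u ≤ B * c u + (2 * K + 1) := fun u hu => by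
    rw [hθ u hu]
    have h1 := softplus_le_add_one (mul_nonneg hB0.le ((h0 u hu).trans (hcg u hu).1))
    have h2 := mul_le_mul_of_nonneg_left (hcg u hu).2 hB0.le
    have h3 : B * (c u + 2 * K * B⁻¹) = B * c u + 2 * K := by field_simp
    linarith
  have hci := integrableOn_cube_of_continuousOn hL.continuousOn
  have hni := integrableOn_cube_of_continuousOn (continuous_nn θ).continuousOn
  set Z := ∫ v in cube d, nn θ v with hZ
  have hZlow : B ≤ Z := by
    have := setIntegral_mono_on (hci.const_mul B) hni measurableSet_cube hlow
    rwa [integral_const_mul, hI, mul_one] at this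
  have hZup : Z ≤ B + (2 * K + 1) := by
    have := setIntegral_mono_on hni ((hci.const_mul B).add (integrable_const (2 * (K : ℝ) + 1)))
      measurableSet_cube hup
    simp only [Pi.add_apply] at this
    rwa [integral_add (hci.const_mul B) (integrable_const _), integral_const_mul, hI, mul_one,
      integral_cube_const] at this
  have hZ0 : 0 < Z := hB0.trans_le hZlow
  refine ⟨θ, ⟨hsize.trans hS, ?_⟩, fun u hu => ?_⟩
  -- Softplus is a contraction, so the network has Lipschitz constant `B * K`, and division by `Z ≥
  -- B` restores a constant at most `K`.
  · refine LipschitzOnWith.of_dist_le_mul fun u hu v hv => ?_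
    rw [Real.dist_eq, ← sub_div, abs_div, abs_of_pos hZ0, div_le_iff₀ hZ0, hθ u hu, hθ v hv]
    refine (abs_softplus_sub_le _ _).trans ?_
    rw [← mul_sub, abs_mul, abs_of_pos hB0]
    have h1 := hgL.abs_sub_le hu hv
    rw [← dist_eq_norm] at h1
    calc B * |g u - g v| ≤ Z * (K * dist u v) := by gcongr
      _ = K * dist u v * Z := by ring
  · rw [nnDensity, ← hZ]
    have hc1 := le_one_add_of_integral_eq_one hL hI hu
    rw [abs_le]
    constructor
    -- The loss from below comes from the normalizer alone, which exceeds `B` by at most `2 * K +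
    -- 1`.
    · have h1 : c u - (2 * K + 1) * c u * B⁻¹ ≤ nn θ u / Z := by
        rw [le_div_iff₀ hZ0]
        have h2 : c u * (Z - B) ≤ c u * (2 * K + 1) :=
          mul_le_mul_of_nonneg_left (by linarith) (h0 u hu)
        have h3 : c u * (2 * K + 1) ≤ (2 * K + 1) * c u * B⁻¹ * Z := by
          have : 1 ≤ B⁻¹ * Z := by rw [inv_mul_eq_div, one_le_div hB0]; exact hZlow
          nlinarith [mul_nonneg (h0 u hu) (by positivity : (0 : ℝ) ≤ 2 * K + 1)]
        have h4 := hlow u hu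
        nlinarith
      have h5 : (2 * K + 1) * c u * B⁻¹ ≤ (1 + K) * (2 * K + 1) * B⁻¹ := by
        rw [mul_comm (1 + (K : ℝ))]
        gcongr
      linarith
    · have h1 : nn θ u / Z ≤ (B * c u + (2 * K + 1)) / B :=
        div_le_div₀ ((nn_pos θ u).le.trans (hup u hu)) (hup u hu) hB0 hZlow
      have h2 : (B * c u + (2 * K + 1)) / B = c u + (2 * K + 1) * B⁻¹ := by field_simp
      have h3 : (2 * K + 1) * B⁻¹ ≤ (1 + K) * (2 * K + 1) * B⁻¹ := by
        have : 0 ≤ (2 * K + 1) * B⁻¹ := by positivity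
        nlinarith
      linarith

end Approximation

end DCC

namespace DCC

/-! ### Averages of uniformly convergent functions along perturbed designs. -/

noncomputable section Averages

/-- The arithmetic mean of `f` over `I`. -/
def finAvg {ι : Type*} (I : Finset ι) (f : ι → ℝ) : ℝ := (∑ i ∈ I, f i) / I.card

variable {d : ℕ} {ι : Type*}

lemma finAvg_mono {I : Finset ι} {f g : ι → ℝ} (h : ∀ i ∈ I, f i ≤ g i) :
    finAvg I f ≤ finAvg I g :=
  div_le_div_of_nonneg_right (Finset.sum_le_sum h) (Nat.cast_nonneg _)

lemma abs_finAvg_sub_le {I : Finset ι} {f g : ι → ℝ} {ε : ℝ} (hε : 0 ≤ ε)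
    (h : ∀ i ∈ I, |f i - g i| ≤ ε) : |finAvg I f - finAvg I g| ≤ ε := by
  rw [finAvg, finAvg, ← sub_div, ← Finset.sum_sub_distrib, abs_div, Nat.abs_cast]
  -- An empty average is `0 / 0 = 0`, so no nonemptiness is needed.
  rcases I.eq_empty_or_nonempty with rfl | hI
  · simpa using hε
  · rw [div_le_iff₀ (by exact_mod_cast hI.card_pos)]
    refine (Finset.abs_sum_le_sum_abs _ _).trans ((Finset.sum_le_card_nsmul _ _ _ h).trans_eq ?_)
    rw [nsmul_eq_mul, mul_comm]

lemma abs_log_sub_le {η a b : ℝ} (hη : 0 < η) (ha : η ≤ a) (hb : η ≤ b) :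
    |Real.log a - Real.log b| ≤ |a - b| / η := by
  have key : ∀ a b : ℝ, η ≤ a → η ≤ b → Real.log a - Real.log b ≤ |a - b| / η := by
    intro a b ha hb
    have ha0 := hη.trans_le ha
    have hb0 := hη.trans_le hb
    rw [← Real.log_div ha0.ne' hb0.ne']
    refine (Real.log_le_sub_one_of_pos (div_pos ha0 hb0)).trans ?_
    rw [div_sub_one hb0.ne']
    exact div_le_div₀ (abs_nonneg _) (le_abs_self _) hη hb
  rw [abs_le]
  have h1 := key a b ha hb
  have h2 := key b a hb ha
  rw [abs_sub_comm] at h2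
  constructor <;> linarith

/-- Logarithms of functions bounded away from zero converge uniformly. -/
lemma _root_.TendstoUniformlyOn.log_of_le {α : Type*} {l : Filter ι} {s : Set α} {η : ℝ}
    (hη : 0 < η) {F : ι → α → ℝ} {f : α → ℝ} (h : TendstoUniformlyOn F f l s)
    (hf : ∀ x ∈ s, η ≤ f x) :
    TendstoUniformlyOn (fun j x => Real.log (F j x)) (fun x => Real.log (f x)) l s := by
  rw [Metric.tendstoUniformlyOn_iff] at h ⊢
  intro ε hε
  -- The first bound keeps the approximants above `η / 2`, where the logarithm is `2 / η`-Lipschitz;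
  -- the second turns this into an error below `ε`.
  filter_upwards [h (min (η / 2) (ε * (η / 2))) (by positivity)] with j hj x hx
  have h1 := hj x hx
  rw [Real.dist_eq] at h1 ⊢
  have h2 := (abs_lt.1 (h1.trans_le (min_le_left _ _))).2
  have h3 := hf x hx
  refine (abs_log_sub_le (half_pos hη) (by linarith) (by linarith)).trans_lt ?_
  rw [div_lt_iff₀ (half_pos hη)]
  exact h1.trans_le (min_le_right _ _)

/-- A countable family of bounded measurable functions which is uniformly dense in the continuous
functions on the cube. -/
lemma exists_dense_seq_cube (d : ℕ) : ∃ G : ℕ → (Fin d → ℝ) → ℝ, (∀ k, Measurable (G k)) ∧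
    (∀ k, ∃ R, ∀ u, |G k u| ≤ R) ∧
    ∀ φ, ContinuousOn φ (cube d) → ∀ ε > 0, ∃ k, ∀ u ∈ cube d, |φ u - G k u| ≤ ε := by
  have : CompactSpace (cube d) := isCompact_iff_compactSpace.1 isCompact_cube
  have : Nonempty C(cube d, ℝ) := ⟨0⟩
  set g := TopologicalSpace.denseSeq C(cube d, ℝ) with hg
  have hval : ∀ k (u) (hu : u ∈ cube d),
      Function.extend Subtype.val (g k) 0 u = g k ⟨u, hu⟩ := fun k u hu =>
    Subtype.val_injective.extend_apply (g k) 0 ⟨u, hu⟩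
  refine ⟨fun k => Function.extend Subtype.val (g k) 0, fun k => ?_, fun k => ?_,
    fun φ hφ ε hε => ?_⟩
  · exact (MeasurableEmbedding.subtype_coe measurableSet_cube).measurable_extend
      (g k).continuous.measurable measurable_const
  · refine ⟨‖g k‖, fun u => ?_⟩
    simp only
    by_cases hu : u ∈ cube d
    · rw [hval k u hu]
      exact (g k).norm_coe_le_norm _
    · rw [Function.extend_apply' _ _ _ (fun ⟨x, hx⟩ => hu (hx ▸ x.2))]
      simp
  · obtain ⟨k, hk⟩ := (TopologicalSpace.denseRange_denseSeq C(cube d, ℝ)).exists_dist_lt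
      (⟨(cube d).domRestrict φ, continuousOn_iff_continuous_domRestrict.1 hφ⟩ : C(cube d, ℝ)) hε
    refine ⟨k, fun u hu => ?_⟩
    simp only [hval k u hu]
    have := (ContinuousMap.dist_lt_iff hε).1 hk ⟨u, hu⟩
    exact this.le

/-- Convergence of averages for a uniformly dense family of test functions implies convergence for
all continuous test functions. -/
lemma tendsto_finAvg_of_dense {l : Filter ℕ} {ν : Measure (Fin d → ℝ)} [IsProbabilityMeasure ν]
    (hν : ∀ᵐ u ∂ν, u ∈ cube d) {G : ℕ → (Fin d → ℝ) → ℝ} (hGm : ∀ k, Measurable (G k))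
    (hGb : ∀ k, ∃ R, ∀ u, |G k u| ≤ R)
    (hGd : ∀ φ, ContinuousOn φ (cube d) → ∀ ε > 0, ∃ k, ∀ u ∈ cube d, |φ u - G k u| ≤ ε)
    {I : ℕ → Finset ι} {x : ℕ → ι → Fin d → ℝ} (hx : ∀ j, ∀ i ∈ I j, x j i ∈ cube d)
    (h : ∀ k, Tendsto (fun j => finAvg (I j) fun i => G k (x j i)) l (𝓝 (∫ u, G k u ∂ν)))
    {φ : (Fin d → ℝ) → ℝ} (hφ : ContinuousOn φ (cube d)) :
    Tendsto (fun j => finAvg (I j) fun i => φ (x j i)) l (𝓝 (∫ u, φ u ∂ν)) := by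
  rw [Metric.tendsto_nhds]
  intro ε hε
  obtain ⟨k, hk⟩ := hGd φ hφ (ε / 4) (by positivity)
  have hGi : Integrable (G k) ν := by
    obtain ⟨R, hR⟩ := hGb k
    exact Integrable.of_bound (hGm k).aestronglyMeasurable R (ae_of_all _ hR)
  have hφi : Integrable φ ν := by
    have hres : ν.restrict (cube d) = ν := Measure.restrict_eq_self_of_ae_mem hν
    have := hφ.integrableOn_compact (μ := ν) isCompact_cube
    rwa [IntegrableOn, hres] at this
  have hI : |∫ u, φ u ∂ν - ∫ u, G k u ∂ν| ≤ ε / 4 := by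
    rw [← integral_sub hφi hGi]
    have := norm_integral_le_of_norm_le_const (μ := ν) (f := fun u => φ u - G k u) (C := ε / 4)
      (hν.mono fun u hu => hk u hu)
    simpa using this
  filter_upwards [Metric.tendsto_nhds.1 (h k) (ε / 4) (by positivity)] with j hj
  have h1 := abs_finAvg_sub_le (I := I j) (f := fun i => φ (x j i)) (g := fun i => G k (x j i))
    (by positivity : 0 ≤ ε / 4) fun i hi => hk _ (hx j i hi)
  rw [Real.dist_eq] at hj ⊢
  rw [abs_le] at h1 hI
  rw [abs_lt] at hj ⊢
  constructor <;> linarith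

/-- Averages along perturbed points of a uniformly convergent sequence of functions. -/
lemma tendsto_finAvg_of_tendstoUniformlyOn {l : Filter ℕ} {ℓ : ((Fin d → ℝ) → ℝ) → ℝ}
    {I : ℕ → Finset ι} {x x' : ℕ → ι → Fin d → ℝ} (hx : ∀ j, ∀ i ∈ I j, x j i ∈ cube d)
    (hx' : ∀ j, ∀ i ∈ I j, x' j i ∈ cube d)
    (hxx' : ∀ ε > 0, ∀ᶠ j in l, ∀ i ∈ I j, dist (x' j i) (x j i) < ε)
    (h : ∀ φ, ContinuousOn φ (cube d) →
      Tendsto (fun j => finAvg (I j) fun i => φ (x j i)) l (𝓝 (ℓ φ)))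
    {g : ℕ → (Fin d → ℝ) → ℝ} {φ : (Fin d → ℝ) → ℝ} (hφ : ContinuousOn φ (cube d))
    (hg : TendstoUniformlyOn g φ l (cube d)) :
    Tendsto (fun j => finAvg (I j) fun i => g j (x' j i)) l (𝓝 (ℓ φ)) := by
  rw [Metric.tendsto_nhds]
  intro ε hε
  obtain ⟨δ, hδ, hu⟩ := Metric.uniformContinuousOn_iff.1
    (isCompact_cube.uniformContinuousOn_of_continuous hφ) (ε / 4) (by positivity)
  filter_upwards [Metric.tendsto_nhds.1 (h φ hφ) (ε / 4) (by positivity), hxx' δ hδ,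
    Metric.tendstoUniformlyOn_iff.1 hg (ε / 4) (by positivity)] with j h1 h2 h3
  have h4 := abs_finAvg_sub_le (I := I j) (f := fun i => g j (x' j i)) (g := fun i => φ (x j i))
    (by positivity : 0 ≤ ε / 4 + ε / 4) fun i hi => by
      have e1 := h3 _ (hx' j i hi)
      have e2 := hu _ (hx' j i hi) _ (hx j i hi) (h2 i hi)
      rw [Real.dist_eq, abs_lt] at e1 e2
      rw [abs_le]
      constructor <;> linarith
  rw [Real.dist_eq] at h1 ⊢
  rw [abs_le] at h4
  rw [abs_lt] at h1 ⊢
  constructor <;> linarith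

end Averages

/-! ### Identification of the likelihood limit by the Hellinger distance, and compactness. -/

section Identification

variable {d : ℕ}

/-- This is what upgrades almost everywhere equality of continuous functions to equality on the
whole cube, boundary included. -/
lemma cube_subset_closure_interior : cube d ⊆ closure (interior (cube d)) := by
  have hne : (interior (cube d)).Nonempty := by
    refine ⟨fun _ => 1 / 2, mem_interior_iff_mem_nhds.2 ?_⟩
    rw [cube, ← Set.pi_univ_Icc]
    exact set_pi_mem_nhds Set.finite_univ fun i _ => Icc_mem_nhds (by norm_num) (by norm_num)
  have hconv : Convex ℝ (cube d) := convex_Icc 0 1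
  rw [hconv.closure_interior_eq_closure_of_nonempty_interior hne]
  exact subset_closure

/-- From `log x ≤ 2 * (√x - 1)` and `(1 - η) * c ≤ a`. After integration the right side involves the
affinity `∫ √(c * q)` and terms that disappear with `η`, with no need for positivity of either
density. -/
lemma hellinger_bound {a c q η : ℝ} (hη : 0 < η) (hη1 : η < 1) (hc : 0 ≤ c) (hq : 0 ≤ q)
    (ha : a = (1 - η) * c + η) :
    c * Real.log (q + η) - c * Real.log a ≤
      2 * ((√(c * q) + √η * √c) / √(1 - η)) - 2 * c := by
  have h1 : 0 < 1 - η := by linarith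
  have ha0 : 0 < a := by rw [ha]; positivity
  have hb0 : 0 < q + η := by positivity
  rw [← mul_sub, ← Real.log_div hb0.ne' ha0.ne']
  have hlog : Real.log ((q + η) / a) ≤ 2 * (√((q + η) / a) - 1) := by
    have := Real.log_le_sub_one_of_pos (Real.sqrt_pos.2 (div_pos hb0 ha0))
    rw [Real.log_sqrt (div_pos hb0 ha0).le] at this
    linarith
  have hkey : c * √((q + η) / a) ≤ (√(c * q) + √η * √c) / √(1 - η) := by
    have e1 : c * √((q + η) / a) = √(c ^ 2 * ((q + η) / a)) := by
      rw [Real.sqrt_mul (sq_nonneg c), Real.sqrt_sq hc]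
    have e2 : c ^ 2 * ((q + η) / a) ≤ (c * q + η * c) / (1 - η) := by
      rw [← mul_div_assoc, div_le_div_iff₀ ha0 h1]
      have : c * (1 - η) ≤ a := by rw [ha]; nlinarith
      calc c ^ 2 * (q + η) * (1 - η) = c * (q + η) * (c * (1 - η)) := by ring
        _ ≤ c * (q + η) * a := by gcongr
        _ = (c * q + η * c) * a := by ring
    have e3 : √(c * q + η * c) ≤ √(c * q) + √η * √c := by
      rw [← Real.sqrt_mul hη.le]
      rw [Real.sqrt_le_left (by positivity)]
      nlinarith [Real.sq_sqrt (mul_nonneg hc hq), Real.sq_sqrt (mul_nonneg hη.le hc),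
        Real.sqrt_nonneg (c * q), Real.sqrt_nonneg (η * c)]
    rw [e1]
    refine (Real.sqrt_le_sqrt e2).trans ?_
    rw [Real.sqrt_div (by positivity)]
    gcongr
  nlinarith [mul_le_mul_of_nonneg_left hlog hc]

/-- Two continuous densities on the cube coincide if the log-likelihood of (regularizations of) the
second is at least the log-likelihood of (mixtures with the uniform density of) the first. -/
theorem eqOn_of_integral_log_le {c q : (Fin d → ℝ) → ℝ} (hc : ContinuousOn c (cube d))
    (hq : ContinuousOn q (cube d)) (hc0 : ∀ u ∈ cube d, 0 ≤ c u) (hq0 : ∀ u ∈ cube d, 0 ≤ q u)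
    (hcI : ∫ u in cube d, c u = 1) (hqI : ∫ u in cube d, q u = 1)
    {e : ℕ → ℝ} (he : ∀ k, e k ∈ Set.Ioo 0 1) (he0 : Tendsto e atTop (𝓝 0))
    (h : ∀ k, ∫ u in cube d, c u * Real.log ((1 - e k) * c u + e k) ≤
      ∫ u in cube d, c u * Real.log (q u + e k)) : Set.EqOn q c (cube d) := by
  have hi1 : IntegrableOn (fun u => √(c u * q u)) (cube d) :=
    integrableOn_cube_of_continuousOn (hc.mul hq).sqrt
  have hi2 : IntegrableOn (fun u => √(c u)) (cube d) :=
    integrableOn_cube_of_continuousOn hc.sqrt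
  have hci := integrableOn_cube_of_continuousOn hc
  have hqi := integrableOn_cube_of_continuousOn hq
  have key : ∀ k,
      1 ≤ ((∫ u in cube d, √(c u * q u)) + √(e k) * ∫ u in cube d, √(c u)) / √(1 - e k) := by
    intro k
    obtain ⟨hη, hη1⟩ := he k
    have hk := h k
    generalize e k = η at hη hη1 hk ⊢
    have hl1 : IntegrableOn (fun u => c u * Real.log (q u + η)) (cube d) :=
      integrableOn_cube_of_continuousOn (hc.mul (ContinuousOn.log (hq.add continuousOn_const)
        fun u hu => (add_pos_of_nonneg_of_pos (hq0 u hu) hη).ne'))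
    have hl2 : IntegrableOn (fun u => c u * Real.log ((1 - η) * c u + η)) (cube d) :=
      integrableOn_cube_of_continuousOn (hc.mul (ContinuousOn.log
        ((continuousOn_const.mul hc).add continuousOn_const)
        fun u hu => (add_pos_of_nonneg_of_pos (mul_nonneg (by linarith) (hc0 u hu)) hη).ne'))
    have hr1 : IntegrableOn (fun u => √(c u * q u) + √η * √(c u)) (cube d) :=
      hi1.add (hi2.const_mul _)
    have hr2 : IntegrableOn (fun u => 2 * ((√(c u * q u) + √η * √(c u)) / √(1 - η))) (cube d) :=
      (hr1.div_const _).const_mul 2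
    have hm := setIntegral_mono_on (hl1.sub hl2) (hr2.sub (hci.const_mul 2))
      measurableSet_cube fun u hu => hellinger_bound hη hη1 (hc0 u hu) (hq0 u hu) rfl
    simp only [Pi.sub_apply] at hm
    rw [integral_sub hl1 hl2, integral_sub hr2 (hci.const_mul 2), integral_const_mul,
      integral_const_mul, hcI, integral_div, integral_add hi1 (hi2.const_mul √η),
      integral_const_mul] at hm
    linarith [hk]
  -- Letting `η → 0` in the integrated bound gives affinity at least one. The squared Hellinger
  -- distance is two minus twice the affinity, so it vanishes.
  have hlim : 1 ≤ ∫ u in cube d, √(c u * q u) := by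
    have hcont : ContinuousAt (fun η : ℝ =>
        ((∫ u in cube d, √(c u * q u)) + √η * ∫ u in cube d, √(c u)) / √(1 - η)) 0 := by
      refine ContinuousAt.div (by fun_prop) (by fun_prop) (by simp)
    have ht := hcont.tendsto.comp he0
    simp only [Real.sqrt_zero, zero_mul, add_zero, sub_zero, Real.sqrt_one, div_one] at ht
    exact ge_of_tendsto' ht key
  have hsq : ∫ u in cube d, (√(c u) - √(q u)) ^ 2 = 0 := by
    refine le_antisymm ?_ (integral_nonneg fun u => sq_nonneg _)
    have e : ∫ u in cube d, (√(c u) - √(q u)) ^ 2 =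
        ∫ u in cube d, (c u + q u - 2 * √(c u * q u)) := by
      refine setIntegral_congr_fun measurableSet_cube fun u hu => ?_
      simp only [sub_sq, Real.sq_sqrt (hc0 u hu), Real.sq_sqrt (hq0 u hu),
        Real.sqrt_mul (hc0 u hu)]
      ring
    have hcq : IntegrableOn (fun u => c u + q u) (cube d) := hci.add hqi
    rw [e, integral_sub hcq (hi1.const_mul 2), integral_add hci hqi, hcI, hqI,
      integral_const_mul]
    linarith
  have hsqi : IntegrableOn (fun u => (√(c u) - √(q u)) ^ 2) (cube d) :=
    integrableOn_cube_of_continuousOn ((hc.sqrt.sub hq.sqrt).pow 2)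
  rw [integral_eq_zero_iff_of_nonneg (fun u => sq_nonneg _) hsqi] at hsq
  have hs := Measure.eqOn_of_ae_eq (f := fun u => √(q u)) (g := fun u => √(c u))
    (hsq.mono fun u hu => by
      have : √(c u) - √(q u) = 0 := pow_eq_zero_iff (two_ne_zero) |>.1 hu
      linarith) hq.sqrt hc.sqrt cube_subset_closure_interior
  intro u hu
  have := hs hu
  rw [← Real.sq_sqrt (hq0 u hu), ← Real.sq_sqrt (hc0 u hu)]
  simp only at this
  rw [this]

/-- Uniformly bounded, equi-Lipschitz sequences on the cube have uniformly convergent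
subsequences. -/
lemma exists_tendstoUniformlyOn_subseq {K : ℝ≥0} {R : ℝ} {q : ℕ → (Fin d → ℝ) → ℝ}
    (hq : ∀ j, LipschitzOnWith K (q j) (cube d)) (hR : ∀ j, ∀ u ∈ cube d, q j u ∈ Set.Icc 0 R) :
    ∃ (g : (Fin d → ℝ) → ℝ) (φ : ℕ → ℕ), StrictMono φ ∧
      TendstoUniformlyOn (fun j => q (φ j)) g atTop (cube d) := by
  have : CompactSpace (cube d) := isCompact_iff_compactSpace.1 isCompact_cube
  let Q : ℕ → BoundedContinuousFunction (cube d) ℝ := fun j =>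
    BoundedContinuousFunction.mkOfCompact ⟨(cube d).domRestrict (q j),
      continuousOn_iff_continuous_domRestrict.1 (hq j).continuousOn⟩
  have hcomp : IsCompact (closure (Set.range Q)) := by
    refine BoundedContinuousFunction.arzela_ascoli (Set.Icc 0 R) isCompact_Icc _ ?_ ?_
    · rintro _ u ⟨j, rfl⟩
      exact hR j u u.2
    · refine (LipschitzWith.uniformEquicontinuous _ K ?_).equicontinuous
      rintro ⟨_, ⟨j, rfl⟩⟩
      exact (hq j).to_restrict
  obtain ⟨g, -, φ, hφ, hg⟩ := hcomp.tendsto_subseq fun j => subset_closure (Set.mem_range_self j)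
  refine ⟨Function.extend Subtype.val g 0, φ, hφ, ?_⟩
  rw [Metric.tendstoUniformlyOn_iff]
  intro ε hε
  filter_upwards [Metric.tendsto_nhds.1 hg ε hε] with j hj u hu
  have e : Function.extend Subtype.val (g : cube d → ℝ) 0 u = g ⟨u, hu⟩ :=
    Subtype.val_injective.extend_apply g 0 ⟨u, hu⟩
  rw [e, dist_comm]
  exact (BoundedContinuousFunction.dist_coe_le_dist ⟨u, hu⟩).trans_lt hj

/-- Consistency of approximate maximum likelihood over a class of equi-Lipschitz densities, for a
deterministic design whose averages converge to those of the density `c`. -/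
theorem tendstoUniformlyOn_of_logLikelihood {ι : Type*} {c : (Fin d → ℝ) → ℝ}
    (hc : ContinuousOn c (cube d)) (hc0 : ∀ u ∈ cube d, 0 ≤ c u) (hcI : ∫ u in cube d, c u = 1)
    {I : ℕ → Finset ι} {x x' : ℕ → ι → Fin d → ℝ} (hx : ∀ j, ∀ i ∈ I j, x j i ∈ cube d)
    (hx' : ∀ j, ∀ i ∈ I j, x' j i ∈ cube d)
    (hxx' : ∀ ε > 0, ∀ᶠ j in atTop, ∀ i ∈ I j, dist (x' j i) (x j i) < ε)
    (hI : ∀ φ, ContinuousOn φ (cube d) → Tendsto (fun j => finAvg (I j) fun i => φ (x j i)) atTop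
      (𝓝 (∫ u in cube d, c u * φ u)))
    {J : ℕ → Finset ι} {v : ℕ → ι → Fin d → ℝ} (hv : ∀ j, ∀ i ∈ J j, v j i ∈ cube d)
    (hJ : ∀ φ, ContinuousOn φ (cube d) → Tendsto (fun j => finAvg (J j) fun i => φ (v j i)) atTop
      (𝓝 (∫ u in cube d, φ u)))
    {K : ℝ≥0} {q : ℕ → (Fin d → ℝ) → ℝ} (hq0 : ∀ j, ∀ u ∈ cube d, 0 < q j u)
    (hq : ∀ j, LipschitzOnWith K (q j) (cube d)) (hqI : ∀ j, ∫ u in cube d, q j u = 1)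
    {e : ℕ → ℝ} (he : ∀ k, e k ∈ Set.Ioo 0 1) (he0 : Tendsto e atTop (𝓝 0))
    (hlow : ∀ k, ∃ b : ℕ → ℝ,
      Tendsto b atTop (𝓝 (∫ u in cube d, c u * Real.log ((1 - e k) * c u + e k))) ∧
      ∀ᶠ j in atTop, b j ≤ finAvg (I j) fun i =>
        Real.log (q j (x' j i) / finAvg (J j) fun m => q j (v j m))) :
    TendstoUniformlyOn q c atTop (cube d) ∧
      Tendsto (fun j => finAvg (J j) fun m => q j (v j m)) atTop (𝓝 1) := by
  have hunif : TendstoUniformlyOn q c atTop (cube d) := by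
    rw [Metric.tendstoUniformlyOn_iff]
    -- If uniform convergence fails, some subsequence stays `ε` away from `c`; compactness gives it
    -- a uniformly convergent subsequence, whose limit turns out to be `c` after all.
    by_contra! hcon
    obtain ⟨ε, hε, hfreq⟩ := hcon
    obtain ⟨φ, hφ, hbad⟩ := extraction_of_frequently_atTop hfreq
    obtain ⟨g, ψ, hψ, hg⟩ := exists_tendstoUniformlyOn_subseq (fun j => hq (φ j))
      (fun j u hu => ⟨(hq0 _ u hu).le, le_one_add_of_integral_eq_one (hq (φ j)) (hqI _) hu⟩)
    set χ := fun j => φ (ψ j) with hχ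
    have hχt : Tendsto χ atTop atTop := (hφ.comp hψ).tendsto_atTop
    have hgc : ContinuousOn g (cube d) :=
      hg.continuousOn (Frequently.of_forall fun j => (hq _).continuousOn)
    have hg0 : ∀ u ∈ cube d, 0 ≤ g u := fun u hu =>
      ge_of_tendsto' (hg.tendsto_at hu) fun j => (hq0 _ u hu).le
    have hgI : ∫ u in cube d, g u = 1 := by
      have ht : Tendsto (fun j => ∫ u in cube d, q (χ j) u) atTop (𝓝 (∫ u in cube d, g u)) := by
        refine tendsto_integral_of_dominated_convergence (fun _ => 1 + K)
          (fun j => (hq (χ j)).continuousOn.aestronglyMeasurable measurableSet_cube)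
          (integrable_const _) (fun j => ?_) ?_
        · filter_upwards [ae_restrict_mem measurableSet_cube] with u hu
          rw [Real.norm_eq_abs, abs_of_pos (hq0 _ u hu)]
          exact le_one_add_of_integral_eq_one (hq _) (hqI _) hu
        · filter_upwards [ae_restrict_mem measurableSet_cube] with u hu
          exact hg.tendsto_at hu
      simp only [hqI] at ht
      exact (tendsto_nhds_unique ht tendsto_const_nhds)
    have hρ : Tendsto (fun j => finAvg (J (χ j)) fun m => q (χ j) (v (χ j) m)) atTop (𝓝 1) := by
      rw [← hgI]
      exact tendsto_finAvg_of_tendstoUniformlyOn (ℓ := fun φ => ∫ u in cube d, φ u)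
        (fun j => hv (χ j)) (fun j => hv (χ j)) (fun ε hε => Eventually.of_forall fun j i _ => by
          simpa using hε) (fun φ hφ => (hJ φ hφ).comp hχt) hgc hg
    have hgeq : Set.EqOn g c (cube d) := by
      refine eqOn_of_integral_log_le hc hgc hc0 hg0 hcI hgI he he0 fun k => ?_
      obtain ⟨b, hb, hbl⟩ := hlow k
      obtain ⟨hη, hη1⟩ := he k
      generalize e k = η at hη hη1 hb ⊢
      -- The limit `g` might vanish somewhere. Adding `η` inside the logarithm only increases the
      -- likelihood and makes the logarithms converge uniformly.
      have hlu : TendstoUniformlyOn (fun j u => Real.log (q (χ j) u + η) -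
          Real.log (finAvg (J (χ j)) fun m => q (χ j) (v (χ j) m)))
          (fun u => Real.log (g u + η) - Real.log 1) atTop (cube d) := by
        refine TendstoUniformlyOn.sub ?_ ?_
        · refine TendstoUniformlyOn.log_of_le hη (hg.add ?_) (fun u hu => ?_)
          · exact (tendsto_const_nhds (x := η)).tendstoUniformlyOn_const _
          · linarith [hg0 u hu]
        · exact (hρ.log one_ne_zero).tendstoUniformlyOn_const _
      have hlc : ContinuousOn (fun u => Real.log (g u + η) - Real.log 1) (cube d) :=
        ((hgc.add continuousOn_const).log fun u hu =>
          (add_pos_of_nonneg_of_pos (hg0 u hu) hη).ne').sub continuousOn_const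
      have ht := tendsto_finAvg_of_tendstoUniformlyOn
        (ℓ := fun φ => ∫ u in cube d, c u * φ u) (fun j => hx (χ j)) (fun j => hx' (χ j))
        (fun ε hε => hχt.eventually (hxx' ε hε)) (fun φ hφ => (hI φ hφ).comp hχt)
        hlc hlu
      simp only [Real.log_one, sub_zero] at ht
      refine le_of_tendsto_of_tendsto (hb.comp hχt) ht ?_
      filter_upwards [hχt.eventually hbl, hρ.eventually (lt_mem_nhds one_pos)] with j hj hρj
      refine hj.trans (finAvg_mono fun i hi => ?_)
      have hqp := hq0 (χ j) _ (hx' (χ j) i hi)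
      rw [Real.log_div hqp.ne' hρj.ne']
      gcongr
      linarith
    obtain ⟨j, hj⟩ := ((Metric.tendstoUniformlyOn_iff.1 hg) ε hε).exists
    obtain ⟨u, hu, hbu⟩ := hbad (ψ j)
    have := hj u hu
    rw [hgeq hu] at this
    exact absurd this (not_lt.2 hbu)
  refine ⟨hunif, ?_⟩
  rw [← hcI]
  exact tendsto_finAvg_of_tendstoUniformlyOn (ℓ := fun φ => ∫ u in cube d, φ u) hv hv
    (fun ε hε => Eventually.of_forall fun j i _ => by simpa using hε) hJ hc hunif

end Identification

end DCC

namespace DCC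

/-! ### Laws on the line: densities, probability integral transform, continuity points. -/

section OneDim

variable {μ : Measure ℝ} [IsProbabilityMeasure μ] {F : ℝ → ℝ}

/-- A law on the line with differentiable distribution function has the derivative as density. -/
lemma eq_withDensity_deriv (hF : ∀ t, F t = μ.real (Set.Iic t)) (hd : Differentiable ℝ F) :
    μ = volume.withDensity fun t => ENNReal.ofReal (deriv F t) := by
  have hmono : Monotone F := fun a b hab => by
    rw [hF, hF]
    exact measureReal_mono (Set.Iic_subset_Iic.2 hab)
  have hd0 : ∀ t, 0 ≤ deriv F t := fun t => hmono.deriv_nonneg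
  refine Measure.ext_of_Ioc _ _ fun a b hab => ?_
  have hi : IntegrableOn (deriv F) (Set.Ioc a b) :=
    intervalIntegral.integrableOn_deriv_of_nonneg hd.continuous.continuousOn
      (fun x _ => (hd x).hasDerivAt) fun x _ => hd0 x
  rw [withDensity_apply _ measurableSet_Ioc, ← ofReal_integral_eq_lintegral_ofReal hi
    (ae_of_all _ hd0), ← intervalIntegral.integral_of_le hab.le,
    intervalIntegral.integral_eq_sub_of_hasDerivAt (fun x _ => (hd x).hasDerivAt)
      ((intervalIntegrable_iff_integrableOn_Ioc_of_le hab.le).2 hi), hF, hF,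
    ← measureReal_sdiff (Set.Iic_subset_Iic.2 hab.le) measurableSet_Iic, Set.Iic_sdiff_Iic,
    ofReal_measureReal]

/-- The probability integral transform. -/
lemma map_cdf_eq_uniform (hF : ∀ t, F t = μ.real (Set.Iic t)) (hd : Differentiable ℝ F)
    (hs : StrictMonoOn F {t | 0 < F t ∧ F t < 1}) :
    μ.map F = volume.restrict (Set.Icc 0 1) := by
  have hcdf : F = cdf μ := funext fun t => by rw [hF, cdf_eq_real]
  have h0 : ∀ t, 0 ≤ F t := fun t => by rw [hcdf]; exact cdf_nonneg μ t
  have h1 : ∀ t, F t ≤ 1 := fun t => by rw [hcdf]; exact cdf_le_one μ t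
  set s := {t | 0 < F t ∧ F t < 1} with hsdef
  have hsm : MeasurableSet s :=
    (measurableSet_lt measurable_const hd.continuous.measurable).inter
      (measurableSet_lt hd.continuous.measurable measurable_const)
  have himg : F '' s = Set.Ioo 0 1 := by
    ext z
    constructor
    · rintro ⟨t, ht, rfl⟩
      exact ht
    · intro hz
      have e0 : ∃ t, F t ≤ z := by
        have := tendsto_cdf_atBot μ
        rw [← hcdf] at this
        exact ((this.eventually (gt_mem_nhds hz.1)).exists).imp fun t h => h.le
      have e1 : ∃ t, z ≤ F t := by
        have := tendsto_cdf_atTop μ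
        rw [← hcdf] at this
        exact ((this.eventually (lt_mem_nhds hz.2)).exists).imp fun t h => h.le
      obtain ⟨t, rfl⟩ := mem_range_of_exists_le_of_exists_ge hd.continuous e0 e1
      exact ⟨t, hz, rfl⟩
  -- Where `F` equals `0` or `1` it has a global extremum, so the density vanishes there. All mass
  -- lives on `s`, where `F` is injective and the change of variables applies.
  have hoff : ∀ t, t ∉ s → deriv F t = 0 := by
    intro t ht
    by_cases h : F t = 0
    · exact IsLocalMin.deriv_eq_zero (Eventually.of_forall fun x => by rw [h]; exact h0 x)
    · have : F t = 1 := by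
        by_contra h'
        exact ht ⟨lt_of_le_of_ne (h0 t) (Ne.symm h), lt_of_le_of_ne (h1 t) h'⟩
      exact IsLocalMax.deriv_eq_zero (Eventually.of_forall fun x => by rw [this]; exact h1 x)
  have hmono : Monotone F := by rw [hcdf]; exact monotone_cdf μ
  ext A hA
  rw [Measure.map_apply hd.continuous.measurable hA, eq_withDensity_deriv hF hd,
    withDensity_apply _ (hd.continuous.measurable hA), Measure.restrict_apply hA]
  have e1 : ∫⁻ t in F ⁻¹' A, ENNReal.ofReal (deriv F t) =
      ∫⁻ t in s, ENNReal.ofReal |deriv F t| * A.indicator 1 (F t) := by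
    rw [← lintegral_indicator (hd.continuous.measurable hA), ← lintegral_indicator hsm]
    congr 1
    ext t
    by_cases hts : t ∈ s
    · by_cases htA : F t ∈ A
      · simp [Set.indicator, hts, htA, abs_of_nonneg hmono.deriv_nonneg]
      · simp [Set.indicator, htA]
    · simp [Set.indicator, hts, hoff t hts]
  rw [e1, ← lintegral_image_eq_lintegral_abs_deriv_mul hsm
    (fun x _ => (hd x).hasDerivAt.hasDerivWithinAt) hs.injOn, himg, lintegral_indicator_one hA,
    Measure.restrict_apply hA]
  exact measure_congr ((ae_eq_refl A).inter Ioo_ae_eq_Icc)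

/-- The density of a law which is continuous where the distribution function is neither `0` nor `1`
is continuous almost everywhere. -/
lemma ae_continuousAt_deriv (hF : ∀ t, F t = μ.real (Set.Iic t)) (hd : Differentiable ℝ F)
    (hc : ContinuousOn (deriv F) {t | 0 < F t ∧ F t < 1}) :
    ∀ᵐ t, ContinuousAt (deriv F) t := by
  have hcdf : F = cdf μ := funext fun t => by rw [hF, cdf_eq_real]
  have h0 : ∀ t, 0 ≤ F t := fun t => by rw [hcdf]; exact cdf_nonneg μ t
  have h1 : ∀ t, F t ≤ 1 := fun t => by rw [hcdf]; exact cdf_le_one μ t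
  have hmono : Monotone F := by rw [hcdf]; exact monotone_cdf μ
  -- Level sets of a monotone function are convex, hence have null frontier. In the interior of a
  -- level set the density is locally zero, so only null endpoints escape.
  have hfr : ∀ a, ∀ᵐ t, t ∉ frontier (F ⁻¹' {a}) := fun a => by
    refine measure_eq_zero_iff_ae_notMem.1 (Convex.addHaar_frontier _ ?_)
    exact ((Set.ordConnected_singleton (a := a)).preimage_mono hmono).convex
  filter_upwards [hfr 0, hfr 1] with t ht0 ht1
  have hflat : ∀ a, F t = a → t ∉ frontier (F ⁻¹' {a}) → ContinuousAt (deriv F) t := by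
    intro a ha hta
    have hint : t ∈ interior (F ⁻¹' {a}) := by
      by_contra h
      exact hta ⟨subset_closure ha, h⟩
    have hev : ∀ᶠ x in 𝓝 t, deriv F x = 0 := by
      have : ∀ᶠ x in 𝓝 t, F x = a := mem_interior_iff_mem_nhds.1 hint
      filter_upwards [this.eventually_nhds] with x hx
      have : F =ᶠ[𝓝 x] fun _ => a := hx
      rw [this.deriv_eq, deriv_const]
    exact (continuousAt_const (y := (0 : ℝ))).congr (hev.mono fun x hx => hx.symm)
  by_cases e0 : F t = 0
  · exact hflat 0 e0 ht0
  by_cases e1 : F t = 1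
  · exact hflat 1 e1 ht1
  have hopen : IsOpen {t | 0 < F t ∧ F t < 1} :=
    (isOpen_lt continuous_const hd.continuous).inter (isOpen_lt hd.continuous continuous_const)
  exact hc.continuousAt (hopen.mem_nhds ⟨lt_of_le_of_ne (h0 t) (Ne.symm e0),
    lt_of_le_of_ne (h1 t) e1⟩)

end OneDim

/-! ### Product densities and the uniform law on the cube. -/

section Product

variable {d : ℕ}

/-- The product of laws with densities has the product density. -/
lemma pi_withDensity_ofReal {f : Fin d → ℝ → ℝ} (hf : ∀ j, Integrable (f j))
    (hf0 : ∀ j t, 0 ≤ f j t)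
    [∀ j, SigmaFinite (volume.withDensity fun t => ENNReal.ofReal (f j t))] :
    Measure.pi (fun j => volume.withDensity fun t => ENNReal.ofReal (f j t)) =
      (volume : Measure (Fin d → ℝ)).withDensity fun x => ENNReal.ofReal (∏ j, f j (x j)) := by
  refine Measure.pi_eq fun s hs => ?_
  have hi : ∀ j, Integrable ((s j).indicator (f j)) := fun j => (hf j).indicator (hs j)
  have hi0 : ∀ j t, 0 ≤ (s j).indicator (f j) t := fun j t =>
    Set.indicator_nonneg (fun t _ => hf0 j t) t
  have e : ∀ x : Fin d → ℝ, (Set.univ.pi s).indicator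
      (fun x => ENNReal.ofReal (∏ j, f j (x j))) x =
      ENNReal.ofReal (∏ j, (s j).indicator (f j) (x j)) := by
    intro x
    by_cases hx : x ∈ Set.univ.pi s
    · rw [Set.indicator_of_mem hx]
      congr 1
      exact Finset.prod_congr rfl fun j _ => (Set.indicator_of_mem (hx j (Set.mem_univ j)) _).symm
    · rw [Set.indicator_of_notMem hx]
      simp only [Set.mem_pi, Set.mem_univ, forall_true_left, not_forall] at hx
      obtain ⟨j, hj⟩ := hx
      rw [Finset.prod_eq_zero (Finset.mem_univ j) (Set.indicator_of_notMem hj _),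
        ENNReal.ofReal_zero]
  rw [withDensity_apply _ (MeasurableSet.univ_pi hs), ← lintegral_indicator (.univ_pi hs),
    lintegral_congr e, volume_pi, ← ofReal_integral_eq_lintegral_ofReal (Integrable.fintype_prod hi)
      (ae_of_all _ fun x => Finset.prod_nonneg fun j _ => hi0 j _),
    integral_fintype_prod_eq_prod,
    ENNReal.ofReal_prod_of_nonneg fun j _ => integral_nonneg (hi0 j)]
  refine Finset.prod_congr rfl fun j _ => ?_
  rw [withDensity_apply _ (hs j), integral_indicator (hs j),
    ofReal_integral_eq_lintegral_ofReal (hf j).integrableOn (ae_of_all _ (hf0 j))]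

lemma volume_restrict_cube : (volume : Measure (Fin d → ℝ)).restrict (cube d) =
    Measure.pi fun _ => volume.restrict (Set.Icc 0 1) := by
  rw [← Measure.restrict_pi_pi, cube, ← Set.pi_univ_Icc, volume_pi]
  rfl

/-- Copula and network densities are controlled on the cube only; cutting off outside yields
globally measurable representatives. -/
lemma measurable_indicator_cube {f : (Fin d → ℝ) → ℝ} (hf : ContinuousOn f (cube d)) :
    Measurable ((cube d).indicator f) := by
  classical
  rw [← Set.piecewise_eq_indicator]
  exact hf.measurable_piecewise continuousOn_const measurableSet_cube

lemma update_mem_cube {v : Fin d → ℝ} (hv : v ∈ cube d) (i : Fin d) {t : ℝ}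
    (ht : t ∈ Set.Icc (0 : ℝ) 1) : Function.update v i t ∈ cube d := by
  refine mem_cube.2 fun j => ?_
  by_cases h : j = i
  · subst h
    simpa using ht
  · simpa [h] using mem_cube.1 hv j

/-- Overwriting one coordinate of a uniform vector by an independent uniform variable. -/
lemma map_update_cube (i : Fin d) :
    (((volume : Measure (Fin d → ℝ)).restrict (cube d)).prod
      ((volume : Measure ℝ).restrict (Set.Icc 0 1))).map
        (fun p => Function.update p.1 i p.2) = volume.restrict (cube d) := by
  have : IsProbabilityMeasure ((volume : Measure ℝ).restrict (Set.Icc 0 1)) := ⟨by simp⟩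
  have hm : Measurable fun p : (Fin d → ℝ) × ℝ => Function.update p.1 i p.2 := measurable_update'
  rw [volume_restrict_cube]
  refine (Measure.pi_eq fun s hs => ?_).symm
  rw [Measure.map_apply hm (MeasurableSet.univ_pi hs)]
  -- The overwritten coordinate of the vector is unconstrained, hence the factor `univ` in slot `i`.
  have e : (fun p : (Fin d → ℝ) × ℝ => Function.update p.1 i p.2) ⁻¹' Set.univ.pi s =
      (Set.univ.pi (Function.update s i Set.univ)) ×ˢ s i := by
    ext p
    simp only [Set.mem_preimage, Set.mem_pi, Set.mem_univ, forall_true_left, Set.mem_prod]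
    constructor
    · intro h
      refine ⟨fun j => ?_, by simpa using h i⟩
      by_cases hj : j = i
      · subst hj
        simp
      · simpa [hj] using h j
    · rintro ⟨h1, h2⟩ j
      by_cases hj : j = i
      · subst hj
        simpa using h2
      · simpa [hj] using h1 j
  rw [e, Measure.prod_prod, Measure.pi_pi, ← Finset.prod_erase_mul _ _ (Finset.mem_univ i),
    ← Finset.prod_erase_mul Finset.univ _ (Finset.mem_univ i)]
  simp only [Function.update_self, measure_univ, mul_one]
  congr 1
  refine Finset.prod_congr rfl fun j hj => ?_
  rw [Function.update_of_ne (Finset.ne_of_mem_erase hj)]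

end Product

/-! ### Uniform margins of a copula density. -/

section Margins

variable {d : ℕ} {C c : (Fin d → ℝ) → ℝ}

lemma IsCopulaDensity.integral_eq_one (hd : 1 ≤ d) (hC : IsCopula C) (h : IsCopulaDensity C c) :
    ∫ u in cube d, c u = 1 := by
  have h1 := h.eq_integral 1 (mem_cube.2 fun j => by simp)
  have h2 := hC.margin ⟨0, hd⟩ 1 (by simp)
  have h3 : Function.update (1 : Fin d → ℝ) ⟨0, hd⟩ 1 = 1 := Function.update_eq_self _ _
  rw [h3] at h2
  rw [cube, ← h1, h2]

/-- The univariate margins of a Lipschitz copula density are uniform. -/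
lemma IsCopulaDensity.integral_update_eq_one {K : ℝ≥0} (hC : IsCopula C) (h : IsCopulaDensity C c)
    (hL : LipschitzOnWith K c (cube d)) (i : Fin d) {t : ℝ} (ht : t ∈ Set.Ioo (0 : ℝ) 1) :
    ∫ v in cube d, c (Function.update v i t) = 1 := by
  set m : ℝ → ℝ := fun t => ∫ v in cube d, c (Function.update v i t) with hm
  have hupd : ∀ t ∈ Set.Icc (0 : ℝ) 1,
      ContinuousOn (fun v => c (Function.update v i t)) (cube d) := fun t ht =>
    hL.continuousOn.comp (continuous_id.update i continuous_const).continuousOn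
      fun v hv => update_mem_cube hv i ht
  have hmc : ContinuousOn m (Set.Icc 0 1) := by
    refine (LipschitzOnWith.of_dist_le_mul (K := K) fun s hs t ht => ?_).continuousOn
    rw [hm, Real.dist_eq]
    simp only
    rw [← integral_sub (integrableOn_cube_of_continuousOn (hupd s hs))
      (integrableOn_cube_of_continuousOn (hupd t ht))]
    have hb : ∀ᵐ v ∂(volume.restrict (cube d)),
        ‖c (Function.update v i s) - c (Function.update v i t)‖ ≤ K * dist s t := by
      filter_upwards [ae_restrict_mem measurableSet_cube] with v hv
      refine (hL.abs_sub_le (update_mem_cube hv i hs) (update_mem_cube hv i ht)).trans ?_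
      refine mul_le_mul_of_nonneg_left ?_ K.2
      rw [pi_norm_le_iff_of_nonneg dist_nonneg]
      intro j
      by_cases hj : j = i
      · subst hj
        simp [Real.dist_eq]
      · simp [hj]
    have := norm_integral_le_of_norm_le_const hb
    simpa using this
  -- The copula evaluated at `t` in slot `i` and `1` elsewhere equals `t` and is the integral of `m`
  -- up to `t`. Since `m` is continuous, differentiation gives `m = 1` at every interior point, not
  -- just almost everywhere.
  have hint : ∀ t ∈ Set.Icc (0 : ℝ) 1, ∫ s in (0 : ℝ)..t, m s = t := by
    intro t ht
    set A : Set (Fin d → ℝ) := {v | v i ≤ t} with hA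
    have hAm : MeasurableSet A := measurableSet_le (measurable_pi_apply i) measurable_const
    have e1 : Set.Icc 0 (Function.update (1 : Fin d → ℝ) i t) = cube d ∩ A := by
      ext v
      simp only [Set.mem_Icc, Pi.le_def, Set.mem_inter_iff, mem_cube, hA, Set.mem_ofPred_eq]
      constructor
      · rintro ⟨h0, h1⟩
        have hi := h1 i
        simp only [Function.update_self] at hi
        refine ⟨fun j => ⟨h0 j, ?_⟩, hi⟩
        by_cases hj : j = i
        · subst hj
          exact hi.trans ht.2
        · simpa [hj] using h1 j
      · rintro ⟨h0, h1⟩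
        refine ⟨fun j => (h0 j).1, fun j => ?_⟩
        by_cases hj : j = i
        · subst hj
          simpa using h1
        · simpa [hj] using (h0 j).2
    have h1 : (1 : Fin d → ℝ) ∈ cube d := mem_cube.2 fun j => by simp
    have e2 := h.eq_integral _ (update_mem_cube h1 i ht)
    rw [hC.margin i t ht, e1, Set.inter_comm, ← Measure.restrict_restrict hAm,
      ← integral_indicator hAm] at e2
    have hmeas : Measurable fun p : (Fin d → ℝ) × ℝ => Function.update p.1 i p.2 :=
      measurable_update'
    have hci : IntegrableOn (A.indicator c) (cube d) := h.integrable.indicator hAm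
    rw [← map_update_cube i, integral_map hmeas.aemeasurable
      (by rw [map_update_cube i]; exact hci.aestronglyMeasurable),
      integral_prod_symm _ (by
        rw [IntegrableOn, ← map_update_cube i] at hci
        exact (integrable_map_measure hci.aestronglyMeasurable hmeas.aemeasurable).1 hci)] at e2
    rw [intervalIntegral.integral_of_le ht.1, ← integral_Icc_eq_integral_Ioc]
    conv_rhs => rw [e2]
    have e3 : ∀ s, ∫ v in cube d, A.indicator c (Function.update v i s) =
        (Set.Iic t).indicator m s := by
      intro s
      by_cases hs : s ≤ t
      · simp [Set.indicator, hs, hA, hm]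
      · simp [Set.indicator, hs, hA]
    simp only [e3]
    rw [setIntegral_indicator measurableSet_Iic]
    congr 2
    ext s
    simp only [Set.mem_Icc, Set.mem_inter_iff, Set.mem_Iic]
    constructor
    · rintro ⟨a, b⟩
      exact ⟨⟨a, b.trans ht.2⟩, b⟩
    · rintro ⟨⟨a, _⟩, b⟩
      exact ⟨a, b⟩
  have hat : ContinuousAt m t := hmc.continuousAt (Icc_mem_nhds ht.1 ht.2)
  have hder := intervalIntegral.integral_hasDerivAt_right (a := 0) (b := t) (f := m)
    ((hmc.mono (by rw [Set.uIcc_of_le ht.1.le]; exact Set.Icc_subset_Icc le_rfl ht.2.le)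
      ).intervalIntegrable)
    ((hmc.mono Set.Ioo_subset_Icc_self).stronglyMeasurableAtFilter isOpen_Ioo _ ht) hat
  have hder' : HasDerivAt (fun t => ∫ s in (0 : ℝ)..t, m s) 1 t := by
    refine (hasDerivAt_id t).congr_of_eventuallyEq ?_
    filter_upwards [Icc_mem_nhds ht.1 ht.2] with s hs
    exact hint s hs
  exact hder.unique hder'

end Margins

/-! ### The class-conditional law of the population ranks. -/

noncomputable section Population

variable {d K : ℕ} {P : Measure (Obs d K)}

lemma measurableSet_label (y : Fin K) :
    MeasurableSet (Prod.snd ⁻¹' {y} : Set (Obs d K)) := measurable_snd (measurableSet_singleton y)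

lemma isProbabilityMeasure_classLaw [IsProbabilityMeasure P] {y : Fin K} (h : 0 < prior P y) :
    IsProbabilityMeasure (classLaw P y) := by
  have : P (Prod.snd ⁻¹' {y}) ≠ 0 := fun h0 => by simp [prior, measureReal_def, h0] at h
  have := cond_isProbabilityMeasure this
  exact Measure.isProbabilityMeasure_map measurable_fst.aemeasurable

/-- Multiplication by the prior undoes the normalization in the conditional law, so integrals over a
class become restricted integrals under `P`. -/
lemma prior_smul_classLaw [IsProbabilityMeasure P] {y : Fin K} (h : 0 < prior P y) :
    ENNReal.ofReal (prior P y) • classLaw P y =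
      (P.restrict (Prod.snd ⁻¹' {y})).map Prod.fst := by
  have h0 : P (Prod.snd ⁻¹' {y}) ≠ 0 := fun h0 => by simp [prior, measureReal_def, h0] at h
  rw [prior, ofReal_measureReal, classLaw, ProbabilityTheory.cond, Measure.map_smul, smul_smul,
    ENNReal.mul_inv_cancel h0 (measure_ne_top _ _), one_smul]

lemma setIntegral_label [IsProbabilityMeasure P] {y : Fin K} (h : 0 < prior P y) {f : (Fin d → ℝ) → ℝ}
    (hf : Measurable f) :
    ∫ z in Prod.snd ⁻¹' {y}, f z.1 ∂P = prior P y * ∫ x, f x ∂classLaw P y := by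
  rw [← integral_map (φ := Prod.fst) (f := f) measurable_fst.aemeasurable
    hf.aestronglyMeasurable, ← prior_smul_classLaw h, integral_smul_measure,
    ENNReal.toReal_ofReal h.le, smul_eq_mul]

lemma measure_prod_label [IsProbabilityMeasure P] {y : Fin K} (h : 0 < prior P y) {B : Set (Fin d → ℝ)}
    (hB : MeasurableSet B) : P (B ×ˢ {y}) = ENNReal.ofReal (prior P y) * classLaw P y B := by
  have := congrArg (fun μ => μ B) (prior_smul_classLaw (P := P) h)
  simp only [Measure.smul_apply, smul_eq_mul] at this
  rw [this, Measure.map_apply measurable_fst hB, Measure.restrict_apply (measurable_fst hB)]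
  rfl

/-- The law of a single feature given the class. -/
lemma margCDF_eq (j : Fin d) (y : Fin K) (t : ℝ) :
    margCDF P j y t = ((classLaw P y).map fun x => x j).real (Set.Iic t) := by
  rw [margCDF, measureReal_def, measureReal_def,
    Measure.map_apply (measurable_pi_apply j) measurableSet_Iic]
  rfl

variable {r : ℝ} {p C c : Fin K → (Fin d → ℝ) → ℝ} {Lc : ℝ≥0}

namespace Regular

lemma measurable_margCDF (hP : Regular P r p C c Lc) (j : Fin d) (y : Fin K) :
    Measurable (margCDF P j y) := (hP.cdf_differentiable j y).continuous.measurable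

/-- The vector of marginal distribution functions. -/
def _root_.DCC.cdfVec (P : Measure (Obs d K)) (y : Fin K) (x : Fin d → ℝ) : Fin d → ℝ :=
  fun j => margCDF P j y (x j)

lemma measurable_cdfVec (hP : Regular P r p C c Lc) (y : Fin K) : Measurable (cdfVec P y) :=
  measurable_pi_iff.2 fun j => (hP.measurable_margCDF j y).comp (measurable_pi_apply j)

variable [IsProbabilityMeasure P]

lemma isProb (hP : Regular P r p C c Lc) (y : Fin K) : IsProbabilityMeasure (classLaw P y) :=
  isProbabilityMeasure_classLaw (hP.prior_pos y)

lemma isProb_map (hP : Regular P r p C c Lc) (j : Fin d) (y : Fin K) :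
    IsProbabilityMeasure ((classLaw P y).map fun x => x j) :=
  have := hP.isProb y
  Measure.isProbabilityMeasure_map (measurable_pi_apply j).aemeasurable

lemma map_eval (hP : Regular P r p C c Lc) (j : Fin d) (y : Fin K) :
    ((classLaw P y).map fun x => x j) =
      volume.withDensity fun t => ENNReal.ofReal (margPDF P j y t) :=
  have := hP.isProb_map j y
  eq_withDensity_deriv (margCDF_eq j y) (hP.cdf_differentiable j y)

lemma margCDF_mono (hP : Regular P r p C c Lc) (j : Fin d) (y : Fin K) :
    Monotone (margCDF P j y) := fun a b hab => by
  have := hP.isProb_map j y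
  rw [margCDF_eq, margCDF_eq]
  exact measureReal_mono (Set.Iic_subset_Iic.2 hab)

lemma margPDF_nonneg (hP : Regular P r p C c Lc) (j : Fin d) (y : Fin K) (t : ℝ) :
    0 ≤ margPDF P j y t := (hP.margCDF_mono j y).deriv_nonneg

lemma integrable_margPDF (hP : Regular P r p C c Lc) (j : Fin d) (y : Fin K) :
    Integrable (margPDF P j y) := by
  have := hP.isProb_map j y
  refine ⟨(measurable_deriv _).aestronglyMeasurable, ?_⟩
  rw [hasFiniteIntegral_iff_ofReal (ae_of_all _ (hP.margPDF_nonneg j y))]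
  have := measure_lt_top ((classLaw P y).map fun x => x j) Set.univ
  rwa [hP.map_eval j y, withDensity_apply _ MeasurableSet.univ, Measure.restrict_univ] at this

lemma cdfVec_mem_cube (hP : Regular P r p C c Lc) (y : Fin K) (x : Fin d → ℝ) :
    cdfVec P y x ∈ cube d := by
  have := hP.isProb y
  exact mem_cube.2 fun j => ⟨measureReal_nonneg, measureReal_le_one⟩

/-- The law of the vector of marginal ranks is the copula density. -/
lemma map_cdfVec (hP : Regular P r p C c Lc) (y : Fin K) :
    (classLaw P y).map (cdfVec P y) = (volume.restrict (cube d)).withDensity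
      fun u => ENNReal.ofReal ((cube d).indicator (c y) u) := by
  have hcm := measurable_indicator_cube (hP.copula_lipschitz y).continuousOn
  have : ∀ j, IsProbabilityMeasure
      (volume.withDensity fun t => ENNReal.ofReal (margPDF P j y t)) := fun j => by
    rw [← hP.map_eval j y]
    exact hP.isProb_map j y
  have hprod : Measurable fun x : Fin d → ℝ => ENNReal.ofReal (∏ j, margPDF P j y (x j)) :=
    (Finset.measurable_prod _ fun j _ =>
      (measurable_deriv (margCDF P j y)).comp (measurable_pi_apply j)).ennreal_ofReal
  have hcm' : Measurable fun x : Fin d → ℝ =>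
      ENNReal.ofReal ((cube d).indicator (c y) (cdfVec P y x)) :=
    (hcm.comp (hP.measurable_cdfVec y)).ennreal_ofReal
  -- By the factorization, the class law has density `c y ∘ cdfVec P y` with respect to the product
  -- of its margins. The transform maps that product to the uniform law on the cube, leaving the
  -- density `c y`.
  have hden : classLaw P y = (Measure.pi fun j =>
      volume.withDensity fun t => ENNReal.ofReal (margPDF P j y t)).withDensity
        fun x => ENNReal.ofReal ((cube d).indicator (c y) (cdfVec P y x)) := by
    rw [pi_withDensity_ofReal (fun j => hP.integrable_margPDF j y)
      (fun j => hP.margPDF_nonneg j y),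
      ← withDensity_mul _ hprod hcm',
      hP.density y]
    congr 1
    ext x
    rw [hP.factorization y x, Pi.mul_apply, Set.indicator_of_mem (hP.cdfVec_mem_cube y x),
      mul_comm, ENNReal.ofReal_mul (Finset.prod_nonneg fun j _ => hP.margPDF_nonneg j y _)]
    rfl
  have hpit : (Measure.pi fun j =>
      volume.withDensity fun t => ENNReal.ofReal (margPDF P j y t)).map (cdfVec P y) =
      volume.restrict (cube d) := by
    have hm : ∀ j, (volume.withDensity fun t => ENNReal.ofReal (margPDF P j y t)).map
        (margCDF P j y) = volume.restrict (Set.Icc 0 1) := fun j => by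
      rw [← hP.map_eval j y]
      have := hP.isProb_map j y
      exact map_cdf_eq_uniform (margCDF_eq j y) (hP.cdf_differentiable j y)
        (hP.cdf_strictMono j y)
    have : ∀ j, SigmaFinite ((volume.withDensity fun t =>
        ENNReal.ofReal (margPDF P j y t)).map (margCDF P j y)) := fun j => by
      rw [hm j]; infer_instance
    have := Measure.pi_map_pi (μ := fun j =>
      volume.withDensity fun t => ENNReal.ofReal (margPDF P j y t))
      (f := fun j => margCDF P j y) fun j => (hP.measurable_margCDF j y).aemeasurable
    rw [volume_restrict_cube]
    simp only [hm] at this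
    exact this
  ext A hA
  rw [Measure.map_apply (hP.measurable_cdfVec y) hA, withDensity_apply _ hA, ← hpit,
    setLIntegral_map hA hcm.ennreal_ofReal (hP.measurable_cdfVec y)]
  conv_lhs => rw [hden]
  rw [withDensity_apply _ (hP.measurable_cdfVec y hA)]

lemma integral_map_cdfVec (hP : Regular P r p C c Lc) (y : Fin K) (φ : (Fin d → ℝ) → ℝ) :
    ∫ u, φ u ∂((classLaw P y).map (cdfVec P y)) = ∫ u in cube d, c y u * φ u := by
  have hcm := measurable_indicator_cube (hP.copula_lipschitz y).continuousOn
  rw [hP.map_cdfVec y, integral_withDensity_eq_integral_toReal_smul hcm.ennreal_ofReal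
    (ae_of_all _ fun _ => ENNReal.ofReal_lt_top)]
  refine setIntegral_congr_fun measurableSet_cube fun u hu => ?_
  simp only [Set.indicator_of_mem hu, smul_eq_mul]
  rw [ENNReal.toReal_ofReal ((hP.copula_density y).nonneg u hu)]

end Regular

end Population

end DCC

namespace DCC

/-! ### Uniform convergence of monotone functions from quantiles. -/

section Polya

/-- Points at which a continuous distribution function takes the values `i / N`. -/
lemma exists_quantiles {F : ℝ → ℝ} (hF : Continuous F) (h0 : Tendsto F atBot (𝓝 0))
    (h1 : Tendsto F atTop (𝓝 1)) :
    ∃ T : ℕ → ℕ → ℝ, ∀ N i, 0 < i → i < N → F (T N i) = (i : ℝ) / N := by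
  have : ∀ N i : ℕ, ∃ t, 0 < i → i < N → F t = (i : ℝ) / N := by
    intro N i
    by_cases h : 0 < i ∧ i < N
    · have hi : (0 : ℝ) < i := by exact_mod_cast h.1
      have hiN : (i : ℝ) < N := by exact_mod_cast h.2
      have e0 := ((h0.eventually (gt_mem_nhds (div_pos hi (hi.trans hiN)))).exists).imp
        fun t h => h.le
      have e1 := ((h1.eventually (lt_mem_nhds ((div_lt_one (hi.trans hiN)).2 hiN))).exists).imp
        fun t h => h.le
      obtain ⟨t, ht⟩ := mem_range_of_exists_le_of_exists_ge hF e0 e1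
      exact ⟨t, fun _ _ => ht⟩
    · exact ⟨0, fun h1 h2 => absurd ⟨h1, h2⟩ h⟩
  choose T hT using this
  exact ⟨T, hT⟩

/-- Pólya's theorem: monotone functions converging at the quantiles of a continuous distribution
function converge uniformly. -/
lemma tendstoUniformly_of_quantiles {l : Filter ℕ} {F : ℝ → ℝ} (hFm : Monotone F)
    (hF0 : ∀ t, 0 ≤ F t) (hF1 : ∀ t, F t ≤ 1) {T : ℕ → ℕ → ℝ}
    (hT : ∀ N i, 0 < i → i < N → F (T N i) = (i : ℝ) / N) {G : ℕ → ℝ → ℝ}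
    (hG : ∀ n, Monotone (G n)) (hG0 : ∀ n t, 0 ≤ G n t) (hG1 : ∀ n t, G n t ≤ 1)
    (h : ∀ N i, Tendsto (fun n => G n (T N i)) l (𝓝 (F (T N i)))) :
    TendstoUniformly G F l := by
  rw [Metric.tendstoUniformly_iff]
  intro ε hε
  -- With `1 / N < ε / 4`, the bracketing loss of at most `2 / N` and the error `ε / 2` at the
  -- quantiles stay below `ε`.
  obtain ⟨N, hN⟩ := exists_nat_gt (4 / ε)
  have hN0 : (0 : ℝ) < N := (by positivity : 0 < 4 / ε).trans hN
  have hNε : 4 / (N : ℝ) < ε := by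
    rw [div_lt_iff₀ hε] at hN
    rw [div_lt_iff₀ hN0]
    linarith
  have hev : ∀ᶠ n in l, ∀ i ∈ Finset.range N, dist (G n (T N i)) (F (T N i)) < ε / 2 :=
    (Finset.eventually_all _).2 fun i _ => Metric.tendsto_nhds.1 (h N i) _ (half_pos hε)
  filter_upwards [hev] with n hn t
  have hfl := Nat.floor_le (mul_nonneg hN0.le (hF0 t))
  have hfl' := Nat.lt_floor_add_one (N * F t)
  set i := ⌊N * F t⌋₊ with hi
  have hNinv : (N : ℝ)⁻¹ * 4 < ε := by rwa [inv_mul_eq_div]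
  have hinv : 0 < (N : ℝ)⁻¹ := inv_pos.2 hN0
  have hlo : (i : ℝ) * (N : ℝ)⁻¹ ≤ F t := by
    rw [← div_eq_mul_inv, div_le_iff₀ hN0]; linarith
  have hhi : F t < (i + 1) * (N : ℝ)⁻¹ := by
    rw [← div_eq_mul_inv, lt_div_iff₀ hN0]; linarith
  have hiN : i ≤ N := by
    have : (i : ℝ) ≤ N := hfl.trans (mul_le_of_le_one_right hN0.le (hF1 t))
    exact_mod_cast this
  rw [Real.dist_eq, abs_lt]
  constructor
  · by_cases h' : i + 1 < N
    · have e := hT N (i + 1) (by omega) h'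
      rw [Nat.cast_add, Nat.cast_one, div_eq_mul_inv] at e
      have hlt : t < T N (i + 1) := by
        by_contra hcon
        have := hFm (not_lt.1 hcon)
        rw [e] at this
        linarith
      have h1 := hG n hlt.le
      have h2 := hn (i + 1) (Finset.mem_range.2 h')
      rw [Real.dist_eq, abs_lt, e] at h2
      linarith
    · have : (N : ℝ) ≤ i + 1 := by exact_mod_cast not_lt.1 h'
      have h2 : (1 : ℝ) ≤ (i + 1) * (N : ℝ)⁻¹ := by
        rw [← div_eq_mul_inv, le_div_iff₀ hN0]; linarith
      have := hG1 n t
      linarith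
  -- Index `i - 1` is used because its level is strictly below `F t`, which places the quantile to
  -- the left of `t`; at level `i` equality on a flat piece could fail to order them.
  · by_cases h' : 1 < i
    · have e := hT N (i - 1) (by omega) (by omega)
      rw [Nat.cast_sub h'.le, Nat.cast_one, div_eq_mul_inv] at e
      have hlt : T N (i - 1) < t := by
        by_contra hcon
        have := hFm (not_lt.1 hcon)
        rw [e] at this
        linarith
      have h1 := hG n hlt.le
      have h2 := hn (i - 1) (Finset.mem_range.2 (by omega))
      rw [Real.dist_eq, abs_lt, e] at h2
      linarith
    · have : (i : ℝ) ≤ 1 := by exact_mod_cast not_lt.1 h'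
      have h2 : (i + 1) * (N : ℝ)⁻¹ ≤ 2 * (N : ℝ)⁻¹ := by gcongr; linarith
      have := hG0 n t
      linarith

end Polya

/-! ### Strong laws within a class and convergence of empirical ranks. -/

section StrongLaws

variable {d K : ℕ} {P : Measure (Obs d K)}
  {Ω : Type*} [MeasurableSpace Ω] {μ : Measure Ω} [IsProbabilityMeasure μ]
  {D : ℕ → Ω → Obs d K}

lemma sum_classIdx (D : ℕ → Obs d K) (n : ℕ) (y : Fin K) (f : ℕ → ℝ) :
    ∑ i ∈ classIdx D n y, f i = ∑ i ∈ Finset.range n, if (D i).2 = y then f i else 0 := by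
  rw [classIdx, Finset.sum_filter]

lemma classCount_eq_sum (D : ℕ → Obs d K) (n : ℕ) (y : Fin K) :
    (classCount D n y : ℝ) = ∑ i ∈ Finset.range n, if (D i).2 = y then 1 else 0 := by
  rw [← sum_classIdx, classCount]
  simp

lemma ae_tendsto_average (hDm : ∀ i, Measurable (D i)) (hDlaw : ∀ i, μ.map (D i) = P)
    (hDind : iIndepFun D μ) {g : Obs d K → ℝ} (hg : Measurable g) (hb : ∃ R, ∀ z, |g z| ≤ R) :
    ∀ᵐ ω ∂μ, Tendsto (fun n : ℕ => (∑ i ∈ Finset.range n, g (D i ω)) / n) atTop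
      (𝓝 (∫ z, g z ∂P)) := by
  obtain ⟨R, hR⟩ := hb
  have := strong_law_ae_real (μ := μ) (fun i ω => g (D i ω))
    (Integrable.of_bound (hg.comp (hDm 0)).aestronglyMeasurable R (ae_of_all _ fun ω => hR _))
    (fun i j hij => (hDind.indepFun hij).comp hg hg)
    (fun i => (IdentDistrib.mk (hDm i).aemeasurable (hDm 0).aemeasurable
      (by rw [hDlaw, hDlaw])).comp hg)
  have e : ∫ ω, g (D 0 ω) ∂μ = ∫ z, g z ∂P := by
    rw [← hDlaw 0, integral_map (hDm 0).aemeasurable hg.aestronglyMeasurable]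
  rwa [e] at this

variable [IsProbabilityMeasure P]

lemma measurable_label_ite {y : Fin K} {g : Obs d K → ℝ} (hg : Measurable g) :
    Measurable fun z : Obs d K => if z.2 = y then g z else 0 :=
  Measurable.ite (measurableSet_label y) hg measurable_const

lemma integral_label_ite {y : Fin K} (hy : 0 < prior P y) {φ : (Fin d → ℝ) → ℝ}
    (hφ : Measurable φ) :
    ∫ z : Obs d K, (if z.2 = y then φ z.1 else 0) ∂P = prior P y * ∫ x, φ x ∂classLaw P y := by
  rw [← setIntegral_label hy hφ, ← integral_indicator (measurableSet_label y)]
  simp [Set.indicator]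

lemma ae_tendsto_empPrior (hDm : ∀ i, Measurable (D i)) (hDlaw : ∀ i, μ.map (D i) = P)
    (hDind : iIndepFun D μ) {y : Fin K} (hy : 0 < prior P y) :
    ∀ᵐ ω ∂μ, Tendsto (fun n => empPrior (fun i => D i ω) n y) atTop (𝓝 (prior P y)) := by
  have := isProbabilityMeasure_classLaw hy
  have h := ae_tendsto_average hDm hDlaw hDind
    (measurable_label_ite (y := y) (measurable_const (a := (1 : ℝ))))
    ⟨1, fun z => by split_ifs <;> simp⟩
  rw [integral_label_ite hy measurable_const] at h
  filter_upwards [h] with ω hω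
  simpa [empPrior, classCount_eq_sum] using hω

/-- The strong law of large numbers within a class. -/
lemma ae_tendsto_finAvg_class (hDm : ∀ i, Measurable (D i)) (hDlaw : ∀ i, μ.map (D i) = P)
    (hDind : iIndepFun D μ) {y : Fin K} (hy : 0 < prior P y) {φ : (Fin d → ℝ) → ℝ}
    (hφ : Measurable φ) (hb : ∃ R, ∀ x, |φ x| ≤ R) :
    ∀ᵐ ω ∂μ, Tendsto (fun n => finAvg (classIdx (fun i => D i ω) n y) fun i => φ (D i ω).1) atTop
      (𝓝 (∫ x, φ x ∂classLaw P y)) := by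
  obtain ⟨R, hR⟩ := hb
  have h := ae_tendsto_average hDm hDlaw hDind
    (measurable_label_ite (y := y) (hφ.comp measurable_fst))
    ⟨R, fun z => by
      have := (abs_nonneg _).trans (hR z.1)
      split_ifs
      · exact hR z.1
      · simpa using this⟩
  simp only [Function.comp_apply] at h
  rw [integral_label_ite hy hφ] at h
  filter_upwards [h, ae_tendsto_empPrior hDm hDlaw hDind hy] with ω h1 h2
  -- A class average is the ratio of two averages over the full sample; the common factor `1 / n`
  -- cancels.
  have h3 := h1.div h2 hy.ne'
  rw [mul_div_cancel_left₀ _ hy.ne'] at h3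
  refine h3.congr' ?_
  filter_upwards [eventually_gt_atTop 0] with n hn
  rw [finAvg, sum_classIdx]
  simp only [Pi.div_apply]
  rw [empPrior, div_div_div_cancel_right₀ (by exact_mod_cast hn.ne'), classCount]

lemma ecdf_eq_finAvg (D : ℕ → Obs d K) (n : ℕ) (j : Fin d) (y : Fin K) (t : ℝ) :
    ecdf D n j y t = finAvg (classIdx D n y) fun i => if (D i).1 j ≤ t then 1 else 0 := by
  rw [ecdf, finAvg, classCount, ← Finset.sum_filter]
  simp

lemma ecdf_mono (D : ℕ → Obs d K) (n : ℕ) (j : Fin d) (y : Fin K) : Monotone (ecdf D n j y) := by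
  intro s t hst
  rw [ecdf_eq_finAvg, ecdf_eq_finAvg]
  refine finAvg_mono fun i _ => ?_
  by_cases h : (D i).1 j ≤ s
  · simp [h, h.trans hst]
  · simp only [h, if_false]
    split_ifs <;> norm_num

lemma ecdf_nonneg (D : ℕ → Obs d K) (n : ℕ) (j : Fin d) (y : Fin K) (t : ℝ) :
    0 ≤ ecdf D n j y t := by
  unfold ecdf
  positivity

lemma ecdf_le_one (D : ℕ → Obs d K) (n : ℕ) (j : Fin d) (y : Fin K) (t : ℝ) :
    ecdf D n j y t ≤ 1 :=
  div_le_one_of_le₀ (by exact_mod_cast Finset.card_filter_le _ _) (Nat.cast_nonneg _)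

lemma pit_mem_cube (D : ℕ → Obs d K) (n : ℕ) (y : Fin K) (x : Fin d → ℝ) : pit D n y x ∈ cube d :=
  mem_cube.2 fun _ => ⟨ecdf_nonneg _ _ _ _ _, ecdf_le_one _ _ _ _ _⟩

variable {r : ℝ} {p C c : Fin K → (Fin d → ℝ) → ℝ} {Lc : ℝ≥0}

lemma Regular.margCDF_eq_cdf (hP : Regular P r p C c Lc) (j : Fin d) (y : Fin K) :
    margCDF P j y = cdf ((classLaw P y).map fun x => x j) := by
  have := hP.isProb_map j y
  ext t
  rw [margCDF_eq, cdf_eq_real]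

/-- The Glivenko-Cantelli theorem for the empirical distribution function of a feature. -/
lemma Regular.ae_tendstoUniformly_ecdf (hP : Regular P r p C c Lc) (hDm : ∀ i, Measurable (D i))
    (hDlaw : ∀ i, μ.map (D i) = P) (hDind : iIndepFun D μ) (j : Fin d) (y : Fin K) :
    ∀ᵐ ω ∂μ, TendstoUniformly (fun n => ecdf (fun i => D i ω) n j y) (margCDF P j y) atTop := by
  have hcdf := hP.margCDF_eq_cdf j y
  obtain ⟨T, hT⟩ := exists_quantiles (hP.cdf_differentiable j y).continuous
    (by rw [hcdf]; exact tendsto_cdf_atBot _) (by rw [hcdf]; exact tendsto_cdf_atTop _)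
  have h : ∀ N i, ∀ᵐ ω ∂μ, Tendsto (fun n => ecdf (fun i => D i ω) n j y (T N i)) atTop
      (𝓝 (margCDF P j y (T N i))) := by
    intro N i
    have hms : MeasurableSet {x : Fin d → ℝ | x j ≤ T N i} :=
      measurableSet_le (measurable_pi_apply j) measurable_const
    have := ae_tendsto_finAvg_class hDm hDlaw hDind (hP.prior_pos y)
      (φ := fun x => if x j ≤ T N i then 1 else 0)
      (Measurable.ite hms measurable_const measurable_const)
      ⟨1, fun x => by split_ifs <;> simp⟩
    filter_upwards [this] with ω hω
    have e : ∫ x, (if x j ≤ T N i then (1 : ℝ) else 0) ∂classLaw P y = margCDF P j y (T N i) := by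
      rw [margCDF, ← integral_indicator_one hms]
      rfl
    rw [e] at hω
    simpa only [ecdf_eq_finAvg] using hω
  filter_upwards [ae_all_iff.2 fun N => ae_all_iff.2 (h N)] with ω hω
  exact tendstoUniformly_of_quantiles (hP.margCDF_mono j y)
    (fun t => by rw [hcdf]; exact cdf_nonneg _ t) (fun t => by rw [hcdf]; exact cdf_le_one _ t) hT
    (fun n => ecdf_mono _ _ _ _) (fun n => ecdf_nonneg _ _ _ _) (fun n => ecdf_le_one _ _ _ _) hω

/-- Averages of continuous functions of the population ranks converge almost surely. -/
lemma Regular.ae_tendsto_finAvg_cdfVec (hP : Regular P r p C c Lc) (hDm : ∀ i, Measurable (D i))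
    (hDlaw : ∀ i, μ.map (D i) = P) (hDind : iIndepFun D μ) (y : Fin K) :
    ∀ᵐ ω ∂μ, ∀ φ, ContinuousOn φ (cube d) →
      Tendsto (fun n => finAvg (classIdx (fun i => D i ω) n y) fun i =>
        φ (cdfVec P y (D i ω).1)) atTop (𝓝 (∫ u in cube d, c y u * φ u)) := by
  have := hP.isProb y
  have hm := hP.measurable_cdfVec y
  have : IsProbabilityMeasure ((classLaw P y).map (cdfVec P y)) :=
    Measure.isProbabilityMeasure_map hm.aemeasurable
  -- A countable dense family allows a single null set for all continuous test functions, which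
  -- later may depend on the sample point.
  obtain ⟨G, hGm, hGb, hGd⟩ := exists_dense_seq_cube d
  have h : ∀ k, ∀ᵐ ω ∂μ, Tendsto (fun n => finAvg (classIdx (fun i => D i ω) n y) fun i =>
      G k (cdfVec P y (D i ω).1)) atTop (𝓝 (∫ u, G k u ∂((classLaw P y).map (cdfVec P y)))) := by
    intro k
    rw [integral_map hm.aemeasurable (hGm k).aestronglyMeasurable]
    exact ae_tendsto_finAvg_class hDm hDlaw hDind (hP.prior_pos y) ((hGm k).comp hm)
      ((hGb k).imp fun R hR x => hR _)
  filter_upwards [ae_all_iff.2 h] with ω hω φ hφ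
  rw [← hP.integral_map_cdfVec y φ]
  refine tendsto_finAvg_of_dense ?_ hGm hGb hGd (fun n i _ => hP.cdfVec_mem_cube y _) hω hφ
  exact (ae_map_iff hm.aemeasurable measurableSet_cube).2
    (ae_of_all _ fun x => hP.cdfVec_mem_cube y x)

end StrongLaws

/-! ### Almost sure control of Monte-Carlo averages along fast subsequences. -/

section MonteCarlo

/-- A nonnegative series with finite expectation converges almost surely, so its terms vanish. No
independence between different `j` is involved, which suits draws renewed at each sample size. -/
lemma ae_tendsto_zero_of_tsum_lintegral {Ω : Type*} [MeasurableSpace Ω] {μ : Measure Ω}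
    {X : ℕ → Ω → ℝ≥0∞} (hX : ∀ j, Measurable (X j))
    (h : ∑' j, ∫⁻ ω, X j ω ∂μ ≠ ∞) : ∀ᵐ ω ∂μ, Tendsto (fun j => X j ω) atTop (𝓝 0) := by
  rw [← lintegral_tsum fun j => (hX j).aemeasurable] at h
  filter_upwards [ae_lt_top (Measurable.tsum hX) h] with ω hω
  exact ENNReal.tendsto_atTop_zero_of_tsum_ne_top hω.ne

variable {d : ℕ} {Ω : Type*} [MeasurableSpace Ω] {μ : Measure Ω} [IsProbabilityMeasure μ]

/-- The mean squared error of a Monte-Carlo average. -/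
lemma lintegral_finAvg_sq_le {V : ℕ → Ω → Fin d → ℝ} (hVm : ∀ m, Measurable (V m))
    (hVlaw : ∀ m, μ.map (V m) = volume.restrict (cube d)) (hVind : iIndepFun V μ)
    {g : (Fin d → ℝ) → ℝ} (hg : Measurable g) {R : ℝ} (hR : ∀ u, |g u| ≤ R) {M : ℕ}
    (hM : 0 < M) :
    ∫⁻ ω, ENNReal.ofReal ((finAvg (Finset.range M) (fun m => g (V m ω)) -
      ∫ u in cube d, g u) ^ 2) ∂μ ≤ ENNReal.ofReal (R ^ 2 / M) := by
  have hMr : (0 : ℝ) < M := by exact_mod_cast hM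
  have hR0 : 0 ≤ R := (abs_nonneg _).trans (hR 0)
  have hmem : ∀ m, MemLp (fun ω => g (V m ω)) 2 μ := fun m =>
    MemLp.of_bound (hg.comp (hVm m)).aestronglyMeasurable R (ae_of_all _ fun ω => hR _)
  have hmean : ∀ m, ∫ ω, g (V m ω) ∂μ = ∫ u in cube d, g u := fun m => by
    rw [← hVlaw m, integral_map (hVm m).aemeasurable hg.aestronglyMeasurable]
  have hvar : ∀ m, variance (fun ω => g (V m ω)) μ ≤ R ^ 2 := fun m => by
    refine (variance_le_expectation_sq (hmem m).aestronglyMeasurable).trans ?_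
    have : ∫ ω, ((fun ω => g (V m ω)) ^ 2) ω ∂μ ≤ ∫ _, R ^ 2 ∂μ :=
      integral_mono (hmem m).integrable_sq (integrable_const _) fun ω => by
        simp only [Pi.pow_apply]
        rw [← sq_abs]
        exact pow_le_pow_left₀ (abs_nonneg _) (hR _) 2
    simpa using this
  set A : Ω → ℝ := fun ω => finAvg (Finset.range M) fun m => g (V m ω) with hA
  have hAeq : A = fun ω => (M : ℝ)⁻¹ * (∑ m ∈ Finset.range M, fun ω => g (V m ω)) ω := by
    ext ω
    simp [hA, finAvg, div_eq_inv_mul]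
  have hS : MemLp (∑ m ∈ Finset.range M, fun ω => g (V m ω)) 2 μ :=
    memLp_finsetSum' _ fun m _ => hmem m
  have hAmem : MemLp A 2 μ := by
    rw [hAeq]
    exact hS.const_mul _
  have hAmean : ∫ ω, A ω ∂μ = ∫ u in cube d, g u := by
    rw [hAeq, integral_const_mul]
    simp only [Finset.sum_apply]
    rw [integral_finsetSum _ fun m _ => (hmem m).integrable one_le_two]
    simp only [hmean, Finset.sum_const, Finset.card_range, nsmul_eq_mul]
    field_simp
  have hAvar : variance A μ ≤ R ^ 2 / M := by
    rw [hAeq, variance_const_mul, IndepFun.variance_sum (fun m _ => hmem m)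
      (fun i _ j _ hij => (hVind.indepFun hij).comp hg hg)]
    have : ∑ m ∈ Finset.range M, variance (fun ω => g (V m ω)) μ ≤ M * R ^ 2 := by
      refine (Finset.sum_le_card_nsmul _ _ _ fun m _ => hvar m).trans_eq ?_
      simp
    calc ((M : ℝ)⁻¹) ^ 2 * ∑ m ∈ Finset.range M, variance (fun ω => g (V m ω)) μ
        ≤ ((M : ℝ)⁻¹) ^ 2 * (M * R ^ 2) := by gcongr
      _ = R ^ 2 / M := by field_simp
  rw [← hAmean, ← evariance_eq_lintegral_ofReal, ← hAmem.ofReal_variance_eq]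
  exact ENNReal.ofReal_le_ofReal hAvar

/-- Along fast subsequences Monte-Carlo errors vanish almost surely, even when weighted. -/
lemma ae_tendsto_weighted_sq {V : ℕ → ℕ → Ω → Fin d → ℝ} (hVm : ∀ j m, Measurable (V j m))
    (hVlaw : ∀ j m, μ.map (V j m) = volume.restrict (cube d)) (hVind : ∀ j, iIndepFun (V j) μ)
    {g : ℕ → (Fin d → ℝ) → ℝ} (hg : ∀ j, Measurable (g j)) {R : ℝ} (hR : ∀ j u, |g j u| ≤ R)
    {M : ℕ → ℕ} (hM : ∀ j, 0 < M j) {a : ℕ → ℝ} (ha0 : ∀ j, 0 ≤ a j)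
    (ha : ∀ j, a j / M j ≤ (1 / 2 : ℝ) ^ j) :
    ∀ᵐ ω ∂μ, Tendsto (fun j => a j * (finAvg (Finset.range (M j)) (fun m => g j (V j m ω)) -
      ∫ u in cube d, g j u) ^ 2) atTop (𝓝 0) := by
  have hm : ∀ j, Measurable fun ω => (finAvg (Finset.range (M j)) (fun m => g j (V j m ω)) -
      ∫ u in cube d, g j u) ^ 2 := fun j => by
    unfold finAvg
    exact (((Finset.measurable_sum _ fun m _ => (hg j).comp (hVm j m)).div_const _).sub_const
      _).pow_const 2
  -- Each weighted mean squared error is at most `R ^ 2 * a j / M j`, geometrically small by the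
  -- choice of the subsequence.
  have hsum : ∑' j, ∫⁻ ω, ENNReal.ofReal (a j * (finAvg (Finset.range (M j))
      (fun m => g j (V j m ω)) - ∫ u in cube d, g j u) ^ 2) ∂μ ≠ ∞ := by
    refine ne_top_of_le_ne_top ?_ (ENNReal.tsum_le_tsum
      (g := fun j => ENNReal.ofReal (R ^ 2 * (1 / 2 : ℝ) ^ j)) fun j => ?_)
    · exact (summable_geometric_two.mul_left (R ^ 2)).tsum_ofReal_ne_top
    · simp only [ENNReal.ofReal_mul (ha0 j)]
      rw [lintegral_const_mul _ (hm j).ennreal_ofReal]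
      refine (mul_le_mul_right (lintegral_finAvg_sq_le (hVm j) (hVlaw j) (hVind j) (hg j) (hR j)
        (hM j)) _).trans ?_
      rw [← ENNReal.ofReal_mul (ha0 j)]
      refine ENNReal.ofReal_le_ofReal ?_
      calc a j * (R ^ 2 / M j) = R ^ 2 * (a j / M j) := by ring
        _ ≤ R ^ 2 * (1 / 2 : ℝ) ^ j := by gcongr; exact ha j
  filter_upwards [ae_tendsto_zero_of_tsum_lintegral
    (fun j => ((hm j).const_mul (a j)).ennreal_ofReal) hsum] with ω hω
  have := (ENNReal.tendsto_toReal ENNReal.zero_ne_top).comp hω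
  refine this.congr fun j => ?_
  simp only [Function.comp_apply]
  rw [ENNReal.toReal_ofReal (mul_nonneg (ha0 j) (sq_nonneg _))]

/-- Along fast subsequences Monte-Carlo averages of all continuous functions converge. -/
lemma ae_tendsto_finAvg_monteCarlo {V : ℕ → ℕ → Ω → Fin d → ℝ} (hVm : ∀ j m, Measurable (V j m))
    (hVlaw : ∀ j m, μ.map (V j m) = volume.restrict (cube d)) (hVind : ∀ j, iIndepFun (V j) μ)
    {M : ℕ → ℕ} (hM : ∀ j, 0 < M j) (hM2 : ∀ j, 1 / (M j : ℝ) ≤ (1 / 2 : ℝ) ^ j) :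
    ∀ᵐ ω ∂μ, (∀ j m, V j m ω ∈ cube d) ∧ ∀ φ, ContinuousOn φ (cube d) →
      Tendsto (fun j => finAvg (Finset.range (M j)) fun m => φ (V j m ω)) atTop
        (𝓝 (∫ u in cube d, φ u)) := by
  obtain ⟨G, hGm, hGb, hGd⟩ := exists_dense_seq_cube d
  have hV : ∀ᵐ ω ∂μ, ∀ j m, V j m ω ∈ cube d := by
    refine ae_all_iff.2 fun j => ae_all_iff.2 fun m => ?_
    have : ∀ᵐ u ∂(μ.map (V j m)), u ∈ cube d := by
      rw [hVlaw]
      exact ae_restrict_mem measurableSet_cube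
    exact ae_of_ae_map (hVm j m).aemeasurable this
  have h : ∀ k, ∀ᵐ ω ∂μ, Tendsto (fun j => finAvg (Finset.range (M j)) fun m => G k (V j m ω))
      atTop (𝓝 (∫ u in cube d, G k u)) := by
    intro k
    obtain ⟨R, hR⟩ := hGb k
    filter_upwards [ae_tendsto_weighted_sq hVm hVlaw hVind (fun _ => hGm k) (fun _ => hR) hM
      (a := fun _ => 1) (fun _ => zero_le_one) hM2] with ω hω
    simp only [one_mul] at hω
    have h1 := hω.sqrt
    simp only [Real.sqrt_sq_eq_abs, Real.sqrt_zero] at h1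
    have h2 := (tendsto_zero_iff_abs_tendsto_zero _).2 h1
    simpa using h2.add_const (∫ u in cube d, G k u)
  filter_upwards [hV, ae_all_iff.2 h] with ω h1 h2
  exact ⟨h1, fun φ hφ => tendsto_finAvg_of_dense (ae_restrict_mem measurableSet_cube) hGm hGb hGd
    (fun j m _ => h1 j m) h2 hφ⟩

end MonteCarlo

end DCC

namespace DCC

/-! ### Moments of class sums on events fixing the class count. -/

section ClassSums

variable {d K : ℕ} {P : Measure (Obs d K)}
  {Ω : Type*} [MeasurableSpace Ω] {μ : Measure Ω}
  {D : ℕ → Ω → Obs d K}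

lemma measurableSet_label_comp (hDm : ∀ i, Measurable (D i)) (i : ℕ) (y : Fin K) :
    MeasurableSet {ω | (D i ω).2 = y} := hDm i (measurableSet_label y)

lemma classCount_eq_sum_nat (D : ℕ → Obs d K) (n : ℕ) (y : Fin K) :
    classCount D n y = ∑ i ∈ Finset.range n, if (D i).2 = y then 1 else 0 := by
  rw [classCount, classIdx, Finset.card_filter]

lemma measurable_classCount (hDm : ∀ i, Measurable (D i)) (n : ℕ) (y : Fin K) :
    Measurable fun ω => classCount (fun i => D i ω) n y := by
  simp only [classCount_eq_sum_nat]
  exact Finset.measurable_sum _ fun i _ =>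
    Measurable.ite (measurableSet_label_comp hDm i y) measurable_const measurable_const

lemma measurableSet_classCount_eq (hDm : ∀ i, Measurable (D i)) (n : ℕ) (y : Fin K) (m : ℕ) :
    MeasurableSet {ω | classCount (fun i => D i ω) n y = m} :=
  measurable_classCount hDm n y (measurableSet_singleton m)

variable [IsProbabilityMeasure P]

/-- Given the class count, the value of a function at a member of the class may be replaced by its
class-conditional mean. -/
lemma integral_class_mul (hDm : ∀ i, Measurable (D i)) (hDlaw : ∀ i, μ.map (D i) = P)
    (hDind : iIndepFun D μ) {y : Fin K} (hy : 0 < prior P y) {n m i : ℕ} (hi : i < n)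
    {ψ : (Fin d → ℝ) → ℝ} (hψ : Measurable ψ)
    {H : ((Finset.range n).erase i → Obs d K) → ℝ} (hH : Measurable H) :
    ∫ ω, (if (D i ω).2 = y then ψ (D i ω).1 else 0) *
        ((if classCount (fun i => D i ω) n y = m then 1 else 0) * H fun k => D k ω) ∂μ =
      (∫ x, ψ x ∂classLaw P y) * ∫ ω, (if (D i ω).2 = y then 1 else 0) *
        ((if classCount (fun i => D i ω) n y = m then 1 else 0) * H fun k => D k ω) ∂μ := by
  classical
  have := isProbabilityMeasure_classLaw hy
  -- The count of class members other than `i`. Once observation `i` is in class `y`, the total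
  -- count is `cnt + 1`, so the event depends only on the other observations and is independent of
  -- the features of `i`.
  let cnt : ((Finset.range n).erase i → Obs d K) → ℕ := fun τ => ∑ k : (Finset.range n).erase i, if (τ k).2 = y then 1 else 0
  have hcnt : Measurable cnt := Finset.measurable_sum _ fun k _ =>
    Measurable.ite ((measurable_snd.comp (measurable_pi_apply k)) (measurableSet_singleton y))
      measurable_const measurable_const
  let Q : ((Finset.range n).erase i → Obs d K) → ℝ := fun τ => (if cnt τ + 1 = m then 1 else 0) * H τ
  have hQ : Measurable Q := (Measurable.ite ((hcnt.add_const 1) (measurableSet_singleton m))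
    measurable_const measurable_const).mul hH
  have hkey : ∀ (χ : (Fin d → ℝ) → ℝ), Measurable χ →
      ∫ ω, (if (D i ω).2 = y then χ (D i ω).1 else 0) *
        ((if classCount (fun i => D i ω) n y = m then 1 else 0) * H fun k => D k ω) ∂μ =
      prior P y * (∫ x, χ x ∂classLaw P y) * ∫ ω, Q (fun k => D k ω) ∂μ := by
    intro χ hχ
    have hg : Measurable fun z : Obs d K => if z.2 = y then χ z.1 else 0 :=
      measurable_label_ite (hχ.comp measurable_fst)
    have hpt : ∀ ω, (if (D i ω).2 = y then χ (D i ω).1 else 0) *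
        ((if classCount (fun i => D i ω) n y = m then 1 else 0) * H fun k => D k ω) =
        (if (D i ω).2 = y then χ (D i ω).1 else 0) * Q (fun k => D k ω) := by
      intro ω
      by_cases hyi : (D i ω).2 = y
      · have hc : classCount (fun i => D i ω) n y = cnt (fun k => D k ω) + 1 := by
          rw [classCount_eq_sum_nat, ← Finset.add_sum_erase _ _ (Finset.mem_range.2 hi), if_pos hyi,
            add_comm]
          congr 1
          exact (Finset.sum_coe_sort ((Finset.range n).erase i) fun k => if (D k ω).2 = y then 1 else 0).symm
        simp only [Q, hc]
      · simp [hyi]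
    have hind : IndepFun (fun ω => if (D i ω).2 = y then χ (D i ω).1 else 0)
        (fun ω => Q fun k => D k ω) μ := by
      have h := hDind.indepFun_finset {i} ((Finset.range n).erase i) (by simp) hDm
      exact h.comp (φ := fun τ : (({i} : Finset ℕ) → Obs d K) =>
        if (τ ⟨i, by simp⟩).2 = y then χ (τ ⟨i, by simp⟩).1 else 0)
        (hg.comp (measurable_pi_apply _)) hQ
    rw [integral_congr_ae (ae_of_all _ hpt), hind.integral_fun_mul_eq_mul_integral
      (hg.comp (hDm i)).aestronglyMeasurable
      (hQ.comp (measurable_pi_iff.2 fun k => hDm k)).aestronglyMeasurable]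
    congr 1
    rw [← integral_label_ite hy hχ, ← hDlaw i,
      integral_map (hDm i).aemeasurable hg.aestronglyMeasurable]
  have h1 := hkey ψ hψ
  -- The constant function identifies the common factor, which therefore never has to be computed.
  have h2 := hkey (fun _ => 1) measurable_const
  simp only [integral_const, probReal_univ, smul_eq_mul, mul_one] at h2
  rw [h1, h2]
  ring

variable [IsProbabilityMeasure μ]

/-- The membership indicators add up to the class count, which is the constant `m` on the event. -/
lemma sum_integral_class_count (hDm : ∀ i, Measurable (D i)) (n m : ℕ) (y : Fin K) :
    ∑ i ∈ Finset.range n, ∫ ω, (if (D i ω).2 = y then (1 : ℝ) else 0) *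
        (if classCount (fun i => D i ω) n y = m then 1 else 0) ∂μ =
      m * μ.real {ω | classCount (fun i => D i ω) n y = m} := by
  have hms := measurableSet_classCount_eq hDm n y m
  have hmeas : ∀ i, Measurable fun ω => (if (D i ω).2 = y then (1 : ℝ) else 0) *
      (if classCount (fun i => D i ω) n y = m then 1 else 0) := fun i =>
    (Measurable.ite (measurableSet_label_comp hDm i y) measurable_const measurable_const).mul
      (Measurable.ite hms measurable_const measurable_const)
  rw [← integral_finsetSum _ fun i _ => Integrable.of_bound (hmeas i).aestronglyMeasurable 1
    (ae_of_all _ fun ω => by split_ifs <;> simp)]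
  simp only [← Finset.sum_mul, ← classCount_eq_sum]
  have : ∀ ω, (classCount (fun i => D i ω) n y : ℝ) *
      (if classCount (fun i => D i ω) n y = m then 1 else 0) =
      {ω | classCount (fun i => D i ω) n y = m}.indicator (fun _ => (m : ℝ)) ω := by
    intro ω
    by_cases h : classCount (fun i => D i ω) n y = m <;> simp [h]
  simp only [this]
  rw [integral_indicator hms, setIntegral_const, smul_eq_mul, mul_comm]

/-- First absolute moment of a class sum, on an event fixing the class count. -/
lemma integral_abs_class_sum_le (hDm : ∀ i, Measurable (D i)) (hDlaw : ∀ i, μ.map (D i) = P)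
    (hDind : iIndepFun D μ) {y : Fin K} (hy : 0 < prior P y) (n m : ℕ)
    {χ : (Fin d → ℝ) → ℝ} (hχ : Measurable χ) (hχi : Integrable χ (classLaw P y)) :
    Integrable (fun ω => ∑ i ∈ Finset.range n, if (D i ω).2 = y then χ (D i ω).1 else 0) μ ∧
    ∫ ω, |∑ i ∈ Finset.range n, if (D i ω).2 = y then χ (D i ω).1 else 0| *
        (if classCount (fun i => D i ω) n y = m then 1 else 0) ∂μ ≤
      m * μ.real {ω | classCount (fun i => D i ω) n y = m} * ∫ x, |χ x| ∂classLaw P y := by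
  have hms := measurableSet_classCount_eq hDm n y m
  have hterm : ∀ i, Integrable (fun ω => if (D i ω).2 = y then χ (D i ω).1 else 0) μ := by
    intro i
    have hg : Measurable fun z : Obs d K => if z.2 = y then χ z.1 else 0 :=
      measurable_label_ite (hχ.comp measurable_fst)
    have h1 : Integrable (fun z : Obs d K => if z.2 = y then χ z.1 else 0) P := by
      have h2 : Integrable χ ((P.restrict (Prod.snd ⁻¹' {y})).map Prod.fst) := by
        rw [← prior_smul_classLaw hy]
        exact hχi.smul_measure ENNReal.ofReal_ne_top
      have h3 := (integrable_map_measure hχ.aestronglyMeasurable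
        measurable_fst.aemeasurable).1 h2
      have h4 := (integrable_indicator_iff (measurableSet_label y)).2 h3
      refine h4.congr (ae_of_all _ fun z => ?_)
      simp [Set.indicator]
    rw [← hDlaw i] at h1
    exact (integrable_map_measure hg.aestronglyMeasurable (hDm i).aemeasurable).1 h1
  have hi : Integrable (fun ω => ∑ i ∈ Finset.range n,
      if (D i ω).2 = y then χ (D i ω).1 else 0) μ := integrable_finsetSum _ fun i _ => hterm i
  have hindm : Measurable fun ω =>
      if classCount (fun i => D i ω) n y = m then (1 : ℝ) else 0 :=
    Measurable.ite hms measurable_const measurable_const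
  have hmul : ∀ {F : Ω → ℝ}, Integrable F μ → Integrable (fun ω => F ω *
      (if classCount (fun i => D i ω) n y = m then (1 : ℝ) else 0)) μ := fun {F} hF =>
    hF.mul_bdd (c := 1) hindm.aestronglyMeasurable (ae_of_all _ fun ω => by split_ifs <;> simp)
  refine ⟨hi, ?_⟩
  have hle : ∫ ω, |∑ i ∈ Finset.range n, if (D i ω).2 = y then χ (D i ω).1 else 0| *
        (if classCount (fun i => D i ω) n y = m then 1 else 0) ∂μ ≤
      ∫ ω, ∑ i ∈ Finset.range n, (if (D i ω).2 = y then |χ (D i ω).1| else 0) *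
        (if classCount (fun i => D i ω) n y = m then 1 else 0) ∂μ := by
    have habs : ∀ i ω, |if (D i ω).2 = y then χ (D i ω).1 else 0| =
        if (D i ω).2 = y then |χ (D i ω).1| else 0 := fun i ω => by split_ifs <;> simp
    refine integral_mono (hmul hi.abs) (integrable_finsetSum _ fun i _ => hmul ?_) fun ω => ?_
    · simpa only [habs] using (hterm i).abs
    · simp only [← Finset.sum_mul, ← habs]
      refine mul_le_mul_of_nonneg_right (Finset.abs_sum_le_sum_abs _ _) ?_
      split_ifs <;> norm_num
  refine hle.trans_eq ?_
  rw [integral_finsetSum _ fun i _ => hmul (by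
    have := (hterm i).abs
    refine this.congr (ae_of_all _ fun ω => ?_)
    simp only
    split_ifs <;> simp)]
  have hterm' : ∀ i ∈ Finset.range n, ∫ ω, (if (D i ω).2 = y then |χ (D i ω).1| else 0) *
        (if classCount (fun i => D i ω) n y = m then 1 else 0) ∂μ =
      (∫ x, |χ x| ∂classLaw P y) * ∫ ω, (if (D i ω).2 = y then (1 : ℝ) else 0) *
        (if classCount (fun i => D i ω) n y = m then 1 else 0) ∂μ := fun i hi => by
    have := integral_class_mul hDm hDlaw hDind hy (m := m) (Finset.mem_range.1 hi)
      (continuous_abs.measurable.comp hχ) (H := fun _ => 1) measurable_const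
    simpa only [Function.comp_apply, mul_one] using this
  rw [Finset.sum_congr rfl hterm', ← Finset.mul_sum, sum_integral_class_count hDm]
  ring

/-- Second moment of a centered class sum, on an event fixing the class count. -/
lemma integral_sq_class_sum_eq (hDm : ∀ i, Measurable (D i)) (hDlaw : ∀ i, μ.map (D i) = P)
    (hDind : iIndepFun D μ) {y : Fin K} (hy : 0 < prior P y) (n m : ℕ)
    {ψ : (Fin d → ℝ) → ℝ} (hψ : Measurable ψ) {R : ℝ} (hR : ∀ x, |ψ x| ≤ R)
    (h0 : ∫ x, ψ x ∂classLaw P y = 0) :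
    ∫ ω, (∑ i ∈ Finset.range n, if (D i ω).2 = y then ψ (D i ω).1 else 0) ^ 2 *
        (if classCount (fun i => D i ω) n y = m then 1 else 0) ∂μ =
      m * μ.real {ω | classCount (fun i => D i ω) n y = m} * ∫ x, ψ x ^ 2 ∂classLaw P y := by
  have hms := measurableSet_classCount_eq hDm n y m
  have hR0 : 0 ≤ R := (abs_nonneg _).trans (hR 0)
  have hgm : ∀ i, Measurable fun ω => if (D i ω).2 = y then ψ (D i ω).1 else 0 := fun i =>
    (measurable_label_ite (y := y) (hψ.comp measurable_fst)).comp (hDm i)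
  have hgb : ∀ i ω, |if (D i ω).2 = y then ψ (D i ω).1 else 0| ≤ R := fun i ω => by
    split_ifs
    · exact hR _
    · simpa using hR0
  have hindm : Measurable fun ω =>
      if classCount (fun i => D i ω) n y = m then (1 : ℝ) else 0 :=
    Measurable.ite hms measurable_const measurable_const
  have hint : ∀ i j, Integrable (fun ω => (if (D i ω).2 = y then ψ (D i ω).1 else 0) *
      ((if classCount (fun i => D i ω) n y = m then 1 else 0) *
        (if (D j ω).2 = y then ψ (D j ω).1 else 0))) μ := fun i j => by
    refine Integrable.of_bound ((hgm i).mul (hindm.mul (hgm j))).aestronglyMeasurable (R * R)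
      (ae_of_all _ fun ω => ?_)
    rw [Real.norm_eq_abs, abs_mul, abs_mul]
    refine mul_le_mul (hgb i ω) ?_ (by positivity) hR0
    refine (mul_le_of_le_one_left (abs_nonneg _) ?_).trans (hgb j ω)
    split_ifs <;> simp
  have hexp : ∀ ω, (∑ i ∈ Finset.range n, if (D i ω).2 = y then ψ (D i ω).1 else 0) ^ 2 *
        (if classCount (fun i => D i ω) n y = m then 1 else 0) =
      ∑ i ∈ Finset.range n, ∑ j ∈ Finset.range n, (if (D i ω).2 = y then ψ (D i ω).1 else 0) *
        ((if classCount (fun i => D i ω) n y = m then 1 else 0) *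
          (if (D j ω).2 = y then ψ (D j ω).1 else 0)) := fun ω => by
    rw [sq, Finset.sum_mul_sum, Finset.sum_mul]
    refine Finset.sum_congr rfl fun i _ => ?_
    rw [Finset.sum_mul]
    exact Finset.sum_congr rfl fun j _ => by ring
  have hterm : ∀ i ∈ Finset.range n, ∑ j ∈ Finset.range n,
      ∫ ω, (if (D i ω).2 = y then ψ (D i ω).1 else 0) *
        ((if classCount (fun i => D i ω) n y = m then 1 else 0) *
          (if (D j ω).2 = y then ψ (D j ω).1 else 0)) ∂μ =
      (∫ x, ψ x ^ 2 ∂classLaw P y) * ∫ ω, (if (D i ω).2 = y then (1 : ℝ) else 0) *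
        (if classCount (fun i => D i ω) n y = m then 1 else 0) ∂μ := by
    intro i hi
    -- Off the diagonal, the centered factor of `i` is averaged with the other summand in the role
    -- of `H`, which gives zero; the diagonal leaves the second moment.
    rw [Finset.sum_eq_single i]
    · have := integral_class_mul hDm hDlaw hDind hy (m := m) (Finset.mem_range.1 hi)
        (hψ.pow_const 2) (H := fun _ => 1) measurable_const
      simp only [mul_one] at this
      rw [← this]
      refine integral_congr_ae (ae_of_all _ fun ω => ?_)
      simp only
      split_ifs <;> ring
    · intro j hj hji
      have hmem : j ∈ (Finset.range n).erase i := Finset.mem_erase.2 ⟨hji, hj⟩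
      have := integral_class_mul hDm hDlaw hDind hy (m := m) (Finset.mem_range.1 hi) hψ
        (H := fun τ => if (τ ⟨j, hmem⟩).2 = y then ψ (τ ⟨j, hmem⟩).1 else 0)
        ((measurable_label_ite (y := y) (hψ.comp measurable_fst)).comp (measurable_pi_apply _))
      rw [h0, zero_mul] at this
      exact this
    · exact fun h => absurd hi h
  rw [integral_congr_ae (ae_of_all _ hexp), integral_finsetSum _ fun i _ =>
    integrable_finsetSum _ fun j _ => hint i j]
  have hsw : ∀ i ∈ Finset.range n, ∫ ω, ∑ j ∈ Finset.range n,
      (if (D i ω).2 = y then ψ (D i ω).1 else 0) *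
        ((if classCount (fun i => D i ω) n y = m then 1 else 0) *
          (if (D j ω).2 = y then ψ (D j ω).1 else 0)) ∂μ = _ := fun i hi =>
    (integral_finsetSum _ fun j _ => hint i j).trans (hterm i hi)
  rw [Finset.sum_congr rfl hsw, ← Finset.mul_sum, sum_integral_class_count hDm]
  ring

lemma finAvg_sub_eq {D : ℕ → Obs d K} {n m : ℕ} {y : Fin K} (hm : 0 < m)
    (h : classCount D n y = m) (φ : (Fin d → ℝ) → ℝ) (e : ℝ) :
    finAvg (classIdx D n y) (fun i => φ (D i).1) - e =
      (∑ i ∈ Finset.range n, if (D i).2 = y then φ (D i).1 - e else 0) / m := by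
  have hm' : (m : ℝ) ≠ 0 := by exact_mod_cast hm.ne'
  rw [finAvg, ← sum_classIdx, Finset.sum_sub_distrib, Finset.sum_const, nsmul_eq_mul]
  rw [classCount] at h
  rw [h, sub_div, mul_div_cancel_left₀ _ hm']

/-- Mean absolute deviation of a class average from the class mean, on an event fixing the class
count, for a function with a bounded part `φ₁` and a small part `φ₂`. -/
lemma integral_abs_finAvg_sub_le (hDm : ∀ i, Measurable (D i)) (hDlaw : ∀ i, μ.map (D i) = P)
    (hDind : iIndepFun D μ) {y : Fin K} (hy : 0 < prior P y) (n : ℕ) {m : ℕ} (hm : 0 < m)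
    {φ₁ φ₂ : (Fin d → ℝ) → ℝ} (h₁ : Measurable φ₁) {R : ℝ} (hR : ∀ x, |φ₁ x| ≤ R)
    (h₂ : Measurable φ₂) (h₂i : Integrable φ₂ (classLaw P y)) {δ : ℝ} (hδ : 0 < δ) :
    Integrable (fun ω => |finAvg (classIdx (fun i => D i ω) n y)
        (fun i => φ₁ (D i ω).1 + φ₂ (D i ω).1) - ∫ x, (φ₁ x + φ₂ x) ∂classLaw P y| *
        (if classCount (fun i => D i ω) n y = m then 1 else 0)) μ ∧
    ∫ ω, |finAvg (classIdx (fun i => D i ω) n y) (fun i => φ₁ (D i ω).1 + φ₂ (D i ω).1) -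
        ∫ x, (φ₁ x + φ₂ x) ∂classLaw P y| *
        (if classCount (fun i => D i ω) n y = m then 1 else 0) ∂μ ≤
      μ.real {ω | classCount (fun i => D i ω) n y = m} *
        (2 * ∫ x, |φ₂ x| ∂classLaw P y + δ + (∫ x, φ₁ x ^ 2 ∂classLaw P y) / (m * δ)) := by
  have := isProbabilityMeasure_classLaw hy
  have hms := measurableSet_classCount_eq hDm n y m
  have hmr : (0 : ℝ) < m := by exact_mod_cast hm
  have hR0 : 0 ≤ R := (abs_nonneg _).trans (hR 0)
  have h₁i : Integrable φ₁ (classLaw P y) :=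
    Integrable.of_bound h₁.aestronglyMeasurable R (ae_of_all _ hR)
  set e₁ := ∫ x, φ₁ x ∂classLaw P y with he₁
  set e₂ := ∫ x, φ₂ x ∂classLaw P y with he₂
  set ind : Ω → ℝ := fun ω => if classCount (fun i => D i ω) n y = m then 1 else 0 with hind
  have hind0 : ∀ ω, 0 ≤ ind ω := fun ω => by simp only [hind]; split_ifs <;> norm_num
  have hindm : Measurable ind := Measurable.ite hms measurable_const measurable_const
  have hindi : Integrable ind μ := Integrable.of_bound hindm.aestronglyMeasurable 1
    (ae_of_all _ fun ω => by simp only [hind]; split_ifs <;> simp)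
  have hindI : ∫ ω, ind ω ∂μ = μ.real {ω | classCount (fun i => D i ω) n y = m} := by
    rw [← integral_indicator_one hms]
    exact integral_congr_ae (ae_of_all _ fun ω => by simp [hind, Set.indicator])
  have hmul : ∀ {F : Ω → ℝ}, Integrable F μ → Integrable (fun ω => F ω * ind ω) μ :=
    fun {F} hF => hF.mul_bdd (c := 1) hindm.aestronglyMeasurable
      (ae_of_all _ fun ω => by simp only [hind]; split_ifs <;> simp)
  set T₁ : Ω → ℝ := fun ω => ∑ i ∈ Finset.range n,
    if (D i ω).2 = y then φ₁ (D i ω).1 - e₁ else 0 with hT₁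
  set T₂ : Ω → ℝ := fun ω => ∑ i ∈ Finset.range n,
    if (D i ω).2 = y then φ₂ (D i ω).1 - e₂ else 0 with hT₂
  have hsplit : ∀ ω, |finAvg (classIdx (fun i => D i ω) n y)
      (fun i => φ₁ (D i ω).1 + φ₂ (D i ω).1) - ∫ x, (φ₁ x + φ₂ x) ∂classLaw P y| * ind ω =
      |(T₁ ω + T₂ ω) / m| * ind ω := by
    intro ω
    by_cases h : classCount (fun i => D i ω) n y = m
    · have := finAvg_sub_eq hm h (fun x => φ₁ x + φ₂ x) (e₁ + e₂)
      rw [integral_add h₁i h₂i, this]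
      congr 3
      rw [hT₁, hT₂]
      simp only
      rw [← Finset.sum_add_distrib]
      refine Finset.sum_congr rfl fun i _ => ?_
      split_ifs <;> ring
    · simp [hind, h]
  have hψb : ∀ x, |φ₁ x - e₁| ≤ R + |e₁| := fun x =>
    (abs_sub _ _).trans (by linarith [hR x])
  have hψm : Measurable fun x => φ₁ x - e₁ := h₁.sub_const _
  have hψ0 : ∫ x, (φ₁ x - e₁) ∂classLaw P y = 0 := by
    rw [integral_sub h₁i (integrable_const _)]
    simp [he₁]
  have hsq := integral_sq_class_sum_eq hDm hDlaw hDind hy n m hψm hψb hψ0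
  have hψsq : ∫ x, (φ₁ x - e₁) ^ 2 ∂classLaw P y ≤ ∫ x, φ₁ x ^ 2 ∂classLaw P y := by
    have hm2 : MemLp φ₁ 2 (classLaw P y) :=
      MemLp.of_bound h₁.aestronglyMeasurable R (ae_of_all _ hR)
    rw [he₁, ← variance_eq_integral h₁.aemeasurable]
    exact variance_le_expectation_sq h₁.aestronglyMeasurable
  obtain ⟨hT₁i, -⟩ := integral_abs_class_sum_le hDm hDlaw hDind hy n m hψm
    (h₁i.sub (integrable_const e₁))
  obtain ⟨hT₂i, hT₂b⟩ := integral_abs_class_sum_le hDm hDlaw hDind hy n m (h₂.sub_const e₂)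
    (h₂i.sub (integrable_const e₂))
  have hχ : ∫ x, |φ₂ x - e₂| ∂classLaw P y ≤ 2 * ∫ x, |φ₂ x| ∂classLaw P y := by
    have hle : ∫ x, |φ₂ x - e₂| ∂classLaw P y ≤ ∫ x, (|φ₂ x| + |e₂|) ∂classLaw P y :=
      integral_mono (h₂i.sub (integrable_const e₂)).abs (h₂i.abs.add (integrable_const _))
        fun x => abs_sub _ _
    rw [integral_add h₂i.abs (integrable_const _)] at hle
    simp only [integral_const, probReal_univ, smul_eq_mul, one_mul] at hle
    have : |e₂| ≤ ∫ x, |φ₂ x| ∂classLaw P y := abs_integral_le_integral_abs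
    linarith
  have hT₁m : Measurable T₁ := Finset.measurable_sum _ fun i _ =>
    (measurable_label_ite (y := y) (hψm.comp measurable_fst)).comp (hDm i)
  have hT₁b : ∀ ω, |T₁ ω| ≤ n * (R + |e₁|) := fun ω => by
    refine (Finset.abs_sum_le_sum_abs _ _).trans ?_
    have := Finset.sum_le_card_nsmul (Finset.range n)
      (fun i => |if (D i ω).2 = y then φ₁ (D i ω).1 - e₁ else 0|) (R + |e₁|) fun i _ => by
        split_ifs
        · exact hψb _
        · simpa using add_nonneg hR0 (abs_nonneg _)
    rwa [Finset.card_range, nsmul_eq_mul] at this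
  have hT₁sq : Integrable (fun ω => T₁ ω ^ 2) μ := by
    refine Integrable.of_bound (hT₁m.pow_const 2).aestronglyMeasurable ((n * (R + |e₁|)) ^ 2)
      (ae_of_all _ fun ω => ?_)
    rw [Real.norm_eq_abs, abs_pow]
    exact pow_le_pow_left₀ (abs_nonneg _) (hT₁b ω) 2
  have hInt : Integrable (fun ω => |(T₁ ω + T₂ ω) / m| * ind ω) μ :=
    hmul ((hT₁i.add hT₂i).div_const _).abs
  refine ⟨hInt.congr (ae_of_all _ fun ω => (hsplit ω).symm), ?_⟩
  rw [integral_congr_ae (ae_of_all _ hsplit)]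
  have hpt : ∀ ω, |(T₁ ω + T₂ ω) / m| * ind ω ≤
      δ * ind ω + (m ^ 2 * δ : ℝ)⁻¹ * (T₁ ω ^ 2 * ind ω) + (m : ℝ)⁻¹ * (|T₂ ω| * ind ω) := by
    intro ω
    have e1 : |(T₁ ω + T₂ ω) / m| ≤ |T₁ ω| / m + |T₂ ω| / m := by
      rw [abs_div, abs_of_pos hmr, ← add_div]
      gcongr
      exact abs_add_le _ _
    -- The inequality `a ≤ δ + a ^ 2 / δ` trades the first moment for the second without square
    -- roots, so both terms stay proportional to the probability of the event.
    have e2 : |T₁ ω| / m ≤ δ + (m ^ 2 * δ : ℝ)⁻¹ * T₁ ω ^ 2 := by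
      have e3 : (m ^ 2 * δ : ℝ)⁻¹ * T₁ ω ^ 2 = (|T₁ ω| / m) ^ 2 / δ := by
        rw [div_pow, sq_abs]
        field_simp
      rw [e3]
      have e4 : 0 ≤ (|T₁ ω| / m - δ / 2) ^ 2 / δ := by positivity
      have e5 : (|T₁ ω| / m - δ / 2) ^ 2 / δ = (|T₁ ω| / m) ^ 2 / δ - |T₁ ω| / m + δ / 4 := by
        field_simp
        ring
      linarith
    calc |(T₁ ω + T₂ ω) / m| * ind ω
        ≤ (δ + (m ^ 2 * δ : ℝ)⁻¹ * T₁ ω ^ 2 + |T₂ ω| / m) * ind ω :=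
          mul_le_mul_of_nonneg_right (by linarith) (hind0 ω)
      _ = _ := by ring
  have hI1 : Integrable (fun ω => δ * ind ω) μ := hindi.const_mul δ
  have hI2 : Integrable (fun ω => (m ^ 2 * δ : ℝ)⁻¹ * (T₁ ω ^ 2 * ind ω)) μ :=
    (hmul hT₁sq).const_mul _
  have hI3 : Integrable (fun ω => (m : ℝ)⁻¹ * (|T₂ ω| * ind ω)) μ := (hmul hT₂i.abs).const_mul _
  have hI12 : Integrable (fun ω => δ * ind ω + (m ^ 2 * δ : ℝ)⁻¹ * (T₁ ω ^ 2 * ind ω)) μ :=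
    hI1.add hI2
  have hI123 : Integrable (fun ω => δ * ind ω + (m ^ 2 * δ : ℝ)⁻¹ * (T₁ ω ^ 2 * ind ω) +
      (m : ℝ)⁻¹ * (|T₂ ω| * ind ω)) μ := hI12.add hI3
  refine (integral_mono hInt hI123 hpt).trans ?_
  rw [integral_add hI12 hI3, integral_add hI1 hI2, integral_const_mul, integral_const_mul,
    integral_const_mul, hindI, hsq]
  set pm := μ.real {ω | classCount (fun i => D i ω) n y = m} with hpm
  have hpm0 : 0 ≤ pm := measureReal_nonneg
  have b1 : (m ^ 2 * δ : ℝ)⁻¹ * (m * pm * ∫ x, (φ₁ x - e₁) ^ 2 ∂classLaw P y) ≤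
      pm * ((∫ x, φ₁ x ^ 2 ∂classLaw P y) / (m * δ)) := by
    calc _ = pm * ((∫ x, (φ₁ x - e₁) ^ 2 ∂classLaw P y) / (m * δ)) := by field_simp
      _ ≤ _ := by gcongr
  have b2 : (m : ℝ)⁻¹ * ∫ ω, |T₂ ω| * ind ω ∂μ ≤ pm * (2 * ∫ x, |φ₂ x| ∂classLaw P y) := by
    calc _ ≤ (m : ℝ)⁻¹ * (m * pm * ∫ x, |φ₂ x - e₂| ∂classLaw P y) := by gcongr
      _ = pm * ∫ x, |φ₂ x - e₂| ∂classLaw P y := by field_simp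
      _ ≤ _ := by gcongr
  calc _ ≤ δ * pm + pm * ((∫ x, φ₁ x ^ 2 ∂classLaw P y) / (m * δ)) +
        pm * (2 * ∫ x, |φ₂ x| ∂classLaw P y) := by gcongr
    _ = _ := by ring

end ClassSums

end DCC

namespace DCC

/-! ### Moments of the kernel under a marginal density. -/

section KernelMoments

variable {d K : ℕ} {P : Measure (Obs d K)} [IsProbabilityMeasure P]
  {r : ℝ} {p C c : Fin K → (Fin d → ℝ) → ℝ} {Lc : ℝ≥0}

lemma integral_comp_sub_div (g : ℝ → ℝ) (t : ℝ) {b : ℝ} (hb : 0 < b) :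
    ∫ s, g ((t - s) / b) = b * ∫ s, g s := by
  rw [integral_sub_left_eq_self (fun s => g (s / b)) volume t, Measure.integral_comp_div,
    abs_of_pos hb, smul_eq_mul]

lemma integrable_comp_sub_div {g : ℝ → ℝ} (hg : Integrable g) (t : ℝ) {b : ℝ} (hb : 0 < b) :
    Integrable fun s => g ((t - s) / b) :=
  (hg.comp_div hb.ne').comp_sub_left t

namespace Regular

lemma integral_feature (hP : Regular P r p C c Lc) (j : Fin d) (y : Fin K) {g : ℝ → ℝ}
    (hg : Measurable g) :
    ∫ x, g (x j) ∂classLaw P y = ∫ s, margPDF P j y s * g s := by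
  rw [← integral_map (φ := fun x : Fin d → ℝ => x j) (f := g)
    (measurable_pi_apply j).aemeasurable hg.aestronglyMeasurable, hP.map_eval j y,
    integral_withDensity_eq_integral_toReal_smul (f := fun t => ENNReal.ofReal (margPDF P j y t))
      (measurable_deriv (margCDF P j y)).ennreal_ofReal
      (ae_of_all _ fun _ => ENNReal.ofReal_lt_top)]
  simp only [ENNReal.toReal_ofReal (hP.margPDF_nonneg j y _), smul_eq_mul]

lemma integrable_feature (hP : Regular P r p C c Lc) (j : Fin d) (y : Fin K) {g : ℝ → ℝ}
    (hg : Measurable g) (hgi : Integrable g) :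
    Integrable (fun x : Fin d → ℝ => g (x j)) (classLaw P y) := by
  obtain ⟨B, hB⟩ := hP.pdf_bounded j y
  have h1 : Integrable g ((classLaw P y).map fun x => x j) := by
    rw [hP.map_eval j y, integrable_withDensity_iff_integrable_smul'
      (f := fun t => ENNReal.ofReal (margPDF P j y t)) (measurable_deriv (margCDF P j y)).ennreal_ofReal (ae_of_all _ fun _ => ENNReal.ofReal_lt_top)]
    simp only [ENNReal.toReal_ofReal (hP.margPDF_nonneg j y _), smul_eq_mul]
    refine hgi.bdd_mul (c := B) (measurable_deriv _).aestronglyMeasurable (ae_of_all _ fun t => ?_)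
    rw [Real.norm_eq_abs, abs_of_nonneg (hP.margPDF_nonneg j y t)]
    exact hB t
  exact (integrable_map_measure hg.aestronglyMeasurable
    (measurable_pi_apply j).aemeasurable).1 h1

lemma integral_feature_le (hP : Regular P r p C c Lc) (j : Fin d) (y : Fin K) {g : ℝ → ℝ}
    (hg : Measurable g) (hgi : Integrable g) (hg0 : ∀ t, 0 ≤ g t) {B : ℝ}
    (hB : ∀ t, margPDF P j y t ≤ B) :
    ∫ x, g (x j) ∂classLaw P y ≤ B * ∫ s, g s := by
  rw [hP.integral_feature j y hg, ← integral_const_mul]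
  refine integral_mono_of_nonneg (ae_of_all _ fun s => mul_nonneg (hP.margPDF_nonneg j y s)
    (hg0 s)) (hgi.const_mul B) (ae_of_all _ fun s => mul_le_mul_of_nonneg_right (hB s) (hg0 s))

/-- The smoothed density converges to the density at continuity points. -/
lemma tendsto_integral_kernel (hP : Regular P r p C c Lc) (j : Fin d) (y : Fin K) {κ : ℝ → ℝ}
    (hκ : IsSecondOrderKernel κ) {t : ℝ} (ht : ContinuousAt (margPDF P j y) t) {b : ℕ → ℝ}
    (hb : ∀ m, 1 ≤ m → 0 < b m) (hb0 : Tendsto b atTop (𝓝 0)) :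
    Tendsto (fun m => ∫ x, κ ((t - x j) / b m) / b m ∂classLaw P y) atTop
      (𝓝 (margPDF P j y t)) := by
  obtain ⟨B, hB⟩ := hP.pdf_bounded j y
  have hfm : Measurable (margPDF P j y) := measurable_deriv _
  have hlim : Tendsto (fun m => ∫ s, κ s * margPDF P j y (t - b m * s)) atTop
      (𝓝 (∫ s, κ s * margPDF P j y t)) := by
    refine tendsto_integral_of_dominated_convergence (fun s => |κ s| * B) (fun m => ?_)
      (hκ.integrable.abs.mul_const B) (fun m => ae_of_all _ fun s => ?_)
      (ae_of_all _ fun s => ?_)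
    · exact (hκ.measurable.mul (hfm.comp (by fun_prop))).aestronglyMeasurable
    · rw [Real.norm_eq_abs, abs_mul, abs_of_nonneg (hP.margPDF_nonneg j y _)]
      exact mul_le_mul_of_nonneg_left (hB _) (abs_nonneg _)
    · have h1 : Tendsto (fun m => t - b m * s) atTop (𝓝 t) := by
        simpa using (hb0.mul_const s).const_sub t
      exact (ht.tendsto.comp h1).const_mul (κ s)
  rw [integral_mul_const, hκ.integral_eq_one, one_mul] at hlim
  refine hlim.congr' ?_
  filter_upwards [eventually_ge_atTop 1] with m hm
  have hbm := hb m hm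
  have hgm : Measurable fun s => κ ((t - s) / b m) / b m :=
    (hκ.measurable.comp (by fun_prop)).div_const _
  rw [hP.integral_feature j y hgm]
  have := integral_comp_sub_div (fun s => κ s * margPDF P j y (t - b m * s)) t hbm
  rw [← mul_right_inj' hbm.ne', ← this, ← integral_const_mul]
  refine integral_congr_ae (ae_of_all _ fun s => ?_)
  simp only
  rw [mul_div_cancel₀ _ hbm.ne', sub_sub_cancel]
  field_simp

end Regular

/-- The kernel is integrable but need not be square integrable, so a variance bound applies only to
its truncation; the remainder is small in `L^1` by dominated convergence. -/
lemma tendsto_integral_abs_truncation {κ : ℝ → ℝ} (hm : Measurable κ) (hi : Integrable κ) :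
    Tendsto (fun R : ℕ => ∫ t, |if |κ t| ≤ R then 0 else κ t|) atTop (𝓝 0) := by
  have : Tendsto (fun R : ℕ => ∫ t, |if |κ t| ≤ R then 0 else κ t|) atTop
      (𝓝 (∫ _ : ℝ, (0 : ℝ))) := by
    refine tendsto_integral_of_dominated_convergence (fun t => |κ t|) (fun R => ?_) hi.abs
      (fun R => ae_of_all _ fun t => ?_) (ae_of_all _ fun t => ?_)
    · have : Measurable fun t => if |κ t| ≤ R then 0 else κ t :=
        Measurable.ite (measurableSet_le hm.abs measurable_const) measurable_const hm
      exact this.abs.aestronglyMeasurable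
    · split_ifs <;> simp
    · refine tendsto_const_nhds.congr' ?_
      obtain ⟨N, hN⟩ := exists_nat_ge |κ t|
      filter_upwards [eventually_ge_atTop N] with R hR
      have : |κ t| ≤ R := hN.trans (by exact_mod_cast hR)
      simp [this]
  simpa using this

end KernelMoments

/-! ### Consistency of the kernel density estimator with random bandwidth. -/

section KernelDensity

variable {d K : ℕ} {P : Measure (Obs d K)} [IsProbabilityMeasure P]
  {r : ℝ} {p C c : Fin K → (Fin d → ℝ) → ℝ} {Lc : ℝ≥0}
  {Ω : Type*} [MeasurableSpace Ω] {μ : Measure Ω} [IsProbabilityMeasure μ]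
  {D : ℕ → Ω → Obs d K}

lemma IsBandwidth.pos {h : ℕ → ℝ} (hh : IsBandwidth h) {m : ℕ} (hm : 1 ≤ m) : 0 < h m := by
  obtain ⟨a, A, ha, hb⟩ := hh
  have : (0 : ℝ) < m := by exact_mod_cast hm
  exact (mul_pos ha (Real.rpow_pos_of_pos this _)).trans_le (hb m hm).1

lemma IsBandwidth.tendsto {h : ℕ → ℝ} (hh : IsBandwidth h) : Tendsto h atTop (𝓝 0) := by
  have hh' := hh
  obtain ⟨a, A, ha, hb⟩ := hh
  have h1 : Tendsto (fun m : ℕ => A * (m : ℝ) ^ (-(1 / 5) : ℝ)) atTop (𝓝 (A * 0)) :=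
    ((tendsto_rpow_neg_atTop (by norm_num)).comp tendsto_natCast_atTop_atTop).const_mul A
  rw [mul_zero] at h1
  refine squeeze_zero' ?_ ?_ h1
  · filter_upwards [eventually_ge_atTop 1] with m hm
    exact (hh'.pos hm).le
  · filter_upwards [eventually_ge_atTop 1] with m hm
    exact (hb m hm).2

/-- Here `m * h m` is at least of order `m ^ (4 / 5)`; its inverse is the order of the variance of
the estimator. -/
lemma IsBandwidth.tendsto_inv_mul {h : ℕ → ℝ} (hh : IsBandwidth h) :
    Tendsto (fun m : ℕ => ((m : ℝ) * h m)⁻¹) atTop (𝓝 0) := by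
  have hh' := hh
  obtain ⟨a, A, ha, hb⟩ := hh
  have h1 : Tendsto (fun m : ℕ => a⁻¹ * (m : ℝ) ^ (-(4 / 5) : ℝ)) atTop (𝓝 (a⁻¹ * 0)) :=
    ((tendsto_rpow_neg_atTop (by norm_num)).comp tendsto_natCast_atTop_atTop).const_mul a⁻¹
  rw [mul_zero] at h1
  refine squeeze_zero' ?_ ?_ h1
  · filter_upwards [eventually_ge_atTop 1] with m hm
    have := (hh'.pos hm).le
    positivity
  · filter_upwards [eventually_ge_atTop 1] with m hm
    have hmr : (0 : ℝ) < m := by exact_mod_cast hm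
    rw [Real.rpow_neg hmr.le, ← mul_inv]
    refine inv_anti₀ (by positivity) ?_
    have e : (m : ℝ) ^ (4 / 5 : ℝ) = m * (m : ℝ) ^ (-(1 / 5) : ℝ) := by
      rw [← Real.rpow_one_add' hmr.le (by norm_num)]
      norm_num
    rw [e]
    have := mul_le_mul_of_nonneg_left (hb m hm).1 hmr.le
    linarith

/-- Fixing the class count makes the bandwidth deterministic, and the estimator becomes a class
average of a fixed function. -/
lemma kde_eq_finAvg {κ : ℝ → ℝ} {h : ℕ → ℝ} {D : ℕ → Obs d K} {n m : ℕ} {y : Fin K}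
    (hm : classCount D n y = m) (j : Fin d) (t : ℝ) :
    kde κ h D n j y t = finAvg (classIdx D n y) fun i => κ ((t - (D i).1 j) / h m) / h m := by
  rw [kde, finAvg, hm, ← Finset.sum_div, div_div, mul_comm, ← hm, classCount]

/-- Uniform control of the deviation of the kernel density estimator from the smoothed density,
conditionally on the class count. -/
lemma Regular.exists_integral_abs_kde_sub_le (hP : Regular P r p C c Lc)
    (hDm : ∀ i, Measurable (D i)) (hDlaw : ∀ i, μ.map (D i) = P) (hDind : iIndepFun D μ)
    (j : Fin d) (y : Fin K) {κ : ℝ → ℝ} (hκ : IsSecondOrderKernel κ) {h : ℕ → ℝ}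
    (hh : IsBandwidth h) (t : ℝ) {ε : ℝ} (hε : 0 < ε) :
    ∃ m₀ ≥ 1, ∀ m ≥ m₀, ∀ n,
      Integrable (fun ω => |finAvg (classIdx (fun i => D i ω) n y)
          (fun i => κ ((t - (D i ω).1 j) / h m) / h m) -
          ∫ x, κ ((t - x j) / h m) / h m ∂classLaw P y| *
          (if classCount (fun i => D i ω) n y = m then 1 else 0)) μ ∧
      ∫ ω, |finAvg (classIdx (fun i => D i ω) n y)
          (fun i => κ ((t - (D i ω).1 j) / h m) / h m) -
          ∫ x, κ ((t - x j) / h m) / h m ∂classLaw P y| *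
          (if classCount (fun i => D i ω) n y = m then 1 else 0) ∂μ ≤
        μ.real {ω | classCount (fun i => D i ω) n y = m} * ε := by
  obtain ⟨B, hB⟩ := hP.pdf_bounded j y
  have hB0 : 0 ≤ B := (hP.margPDF_nonneg j y 0).trans (hB 0)
  have htr := (tendsto_integral_abs_truncation hκ.measurable hκ.integrable).const_mul (2 * B)
  rw [mul_zero] at htr
  -- The truncation level depends on `ε` only, never on `m`: substitution cancels the bandwidth in
  -- the `L^1` norm of the remainder. The variance of the bounded part is then made small by `m`
  -- alone.
  obtain ⟨R, hR⟩ := (htr.eventually (gt_mem_nhds (show 0 < ε / 3 by positivity))).exists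
  set κ₁ : ℝ → ℝ := fun t => if |κ t| ≤ R then κ t else 0 with hκ₁
  set κ₂ : ℝ → ℝ := fun t => if |κ t| ≤ R then 0 else κ t with hκ₂
  have hset : MeasurableSet {t | |κ t| ≤ R} := measurableSet_le hκ.measurable.abs measurable_const
  have hκ₁m : Measurable κ₁ := Measurable.ite hset hκ.measurable measurable_const
  have hκ₂m : Measurable κ₂ := Measurable.ite hset measurable_const hκ.measurable
  have hκ₁b : ∀ t, |κ₁ t| ≤ R := fun t => by
    simp only [hκ₁]
    split_ifs with h
    · exact h
    · simp
  have hκ₁i : Integrable κ₁ := hκ.integrable.mono hκ₁m.aestronglyMeasurable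
    (ae_of_all _ fun t => by simp only [hκ₁]; split_ifs <;> simp)
  have hκ₂i : Integrable κ₂ := hκ.integrable.mono hκ₂m.aestronglyMeasurable
    (ae_of_all _ fun t => by simp only [hκ₂]; split_ifs <;> simp)
  have hsum : ∀ t, κ₁ t + κ₂ t = κ t := fun t => by simp only [hκ₁, hκ₂]; split_ifs <;> simp
  have hsqi : Integrable fun t => κ₁ t ^ 2 := by
    simp only [sq]
    exact hκ₁i.bdd_mul (c := R) hκ₁m.aestronglyMeasurable (ae_of_all _ hκ₁b)
  have hvar := hh.tendsto_inv_mul.mul_const (B * (∫ t, κ₁ t ^ 2) / (ε / 3))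
  rw [zero_mul] at hvar
  obtain ⟨m₁, hm₁⟩ := eventually_atTop.1
    (hvar.eventually (gt_mem_nhds (show 0 < ε / 3 by positivity)))
  refine ⟨max m₁ 1, le_max_right _ _, fun m hm n => ?_⟩
  have hm1 : 1 ≤ m := (le_max_right _ _).trans hm
  have hmr : (0 : ℝ) < m := by exact_mod_cast hm1
  have hb := hh.pos hm1
  have hmeas : Measurable fun x : Fin d → ℝ => (t - x j) / h m := by fun_prop
  have hmeas' : Measurable fun s : ℝ => (t - s) / h m := by fun_prop
  have hint : ∀ {g : ℝ → ℝ}, Measurable g → Integrable g →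
      Integrable (fun x : Fin d → ℝ => g ((t - x j) / h m)) (classLaw P y) := fun {g} hg hgi =>
    hP.integrable_feature j y (hg.comp hmeas') (integrable_comp_sub_div hgi t hb)
  have hbound : ∀ {g : ℝ → ℝ}, Measurable g → Integrable g → (∀ t, 0 ≤ g t) →
      ∫ x, g ((t - x j) / h m) ∂classLaw P y ≤ B * (h m * ∫ s, g s) := fun {g} hg hgi hg0 => by
    rw [← integral_comp_sub_div g t hb]
    exact hP.integral_feature_le j y (hg.comp hmeas') (integrable_comp_sub_div hgi t hb)
      (fun s => hg0 _) hB
  have key := integral_abs_finAvg_sub_le hDm hDlaw hDind (hP.prior_pos y) n hm1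
    (φ₁ := fun x => κ₁ ((t - x j) / h m) / h m) (φ₂ := fun x => κ₂ ((t - x j) / h m) / h m)
    ((hκ₁m.comp hmeas).div_const _) (R := R / h m) (fun x => by
      rw [abs_div, abs_of_pos hb]
      exact div_le_div_of_nonneg_right (hκ₁b _) hb.le)
    ((hκ₂m.comp hmeas).div_const _) ((hint hκ₂m hκ₂i).div_const _)
    (show 0 < ε / 3 by positivity)
  simp only [← add_div, hsum] at key
  refine ⟨key.1, key.2.trans (mul_le_mul_of_nonneg_left ?_ measureReal_nonneg)⟩
  have b2 : ∫ x, |κ₂ ((t - x j) / h m) / h m| ∂classLaw P y ≤ B * ∫ s, |κ₂ s| := by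
    simp only [abs_div, abs_of_pos hb]
    rw [integral_div, div_le_iff₀ hb]
    refine (hbound hκ₂m.abs hκ₂i.abs fun _ => abs_nonneg _).trans_eq (by ring)
  have b1 : (∫ x, (κ₁ ((t - x j) / h m) / h m) ^ 2 ∂classLaw P y) / (m * (ε / 3)) ≤
      ((m : ℝ) * h m)⁻¹ * (B * (∫ t, κ₁ t ^ 2) / (ε / 3)) := by
    simp only [div_pow]
    rw [integral_div]
    have := hbound (hκ₁m.pow_const 2) hsqi fun _ => sq_nonneg _
    calc _ ≤ B * (h m * ∫ s, κ₁ s ^ 2) / h m ^ 2 / (m * (ε / 3)) := by gcongr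
      _ = _ := by field_simp
  have b3 := hm₁ m ((le_max_left _ _).trans hm)
  linarith

/-- Consistency of the kernel density estimator at continuity points of the density. -/
lemma Regular.tendsto_measure_kde (hP : Regular P r p C c Lc)
    (hDm : ∀ i, Measurable (D i)) (hDlaw : ∀ i, μ.map (D i) = P) (hDind : iIndepFun D μ)
    (j : Fin d) (y : Fin K) {κ : ℝ → ℝ} (hκ : IsSecondOrderKernel κ) {h : ℕ → ℝ}
    (hh : IsBandwidth h) {t : ℝ} (ht : ContinuousAt (margPDF P j y) t) {ε : ℝ} (hε : 0 < ε) :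
    Tendsto (fun n => μ.real {ω | ε ≤ |kde κ h (fun i => D i ω) n j y t - margPDF P j y t|})
      atTop (𝓝 0) := by
  set cnt : ℕ → Ω → ℕ := fun n ω => classCount (fun i => D i ω) n y with hcnt
  have hcount : ∀ m, Tendsto (fun n => μ.real {ω | cnt n ω < m}) atTop (𝓝 0) := by
    intro m
    have hms : ∀ n, MeasurableSet {ω | cnt n ω < m} := fun n =>
      measurableSet_lt (measurable_classCount hDm n y) measurable_const
    have h1 : Tendsto (fun n => ∫ ω, {ω | cnt n ω < m}.indicator (1 : Ω → ℝ) ω ∂μ) atTop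
        (𝓝 (∫ _, (0 : ℝ) ∂μ)) := by
      refine tendsto_integral_of_dominated_convergence (fun _ => 1)
        (fun n => (measurable_one.indicator (hms n)).aestronglyMeasurable) (integrable_const _)
        (fun n => ae_of_all _ fun ω => ?_) ?_
      · by_cases h : cnt n ω < m <;> simp [h]
      · filter_upwards [ae_tendsto_empPrior hDm hDlaw hDind (hP.prior_pos y)] with ω hω
        refine tendsto_const_nhds.congr' ?_
        have h2 := hω.pos_mul_atTop (hP.prior_pos y) tendsto_natCast_atTop_atTop
        filter_upwards [h2.eventually_ge_atTop (m : ℝ), eventually_gt_atTop 0] with n hn hn0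
        have hn0' : (n : ℝ) ≠ 0 := by exact_mod_cast hn0.ne'
        rw [empPrior, div_mul_cancel₀ _ hn0'] at hn
        have : ¬ cnt n ω < m := not_lt.2 (by exact_mod_cast hn)
        simp [this]
    simp only [integral_zero] at h1
    refine h1.congr fun n => ?_
    rw [integral_indicator_one (hms n)]
  rw [Metric.tendsto_atTop]
  intro η hη
  obtain ⟨m₀, hm₀, hkey⟩ := hP.exists_integral_abs_kde_sub_le hDm hDlaw hDind j y hκ hh t
    (show 0 < η / 2 * (ε / 2) by positivity)
  obtain ⟨m₁, hm₁⟩ := eventually_atTop.1 (Metric.tendsto_nhds.1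
    (hP.tendsto_integral_kernel j y hκ ht (fun m hm => hh.pos hm) hh.tendsto) (ε / 2)
    (half_pos hε))
  obtain ⟨n₀, hn₀⟩ := eventually_atTop.1
    ((hcount (max m₀ m₁)).eventually (gt_mem_nhds (half_pos hη)))
  refine ⟨n₀, fun n hn => ?_⟩
  rw [Real.dist_eq, sub_zero, abs_of_nonneg measureReal_nonneg]
  set M := max m₀ m₁ with hM
  set E : Set Ω := {ω | ε ≤ |kde κ h (fun i => D i ω) n j y t - margPDF P j y t|} with hE
  -- Small counts are improbable. The remaining event splits by the exact count, and Markov's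
  -- inequality bounds each piece by a fraction of the probability of that count.
  have hcover : E ⊆ {ω | cnt n ω < M} ∪
      ⋃ m ∈ Finset.range (n + 1), (E ∩ {ω | M ≤ m ∧ cnt n ω = m}) := by
    intro ω hω
    by_cases hlt : cnt n ω < M
    · exact Or.inl hlt
    · refine Or.inr (Set.mem_biUnion (x := cnt n ω) ?_ ⟨hω, not_lt.1 hlt, rfl⟩)
      have : cnt n ω ≤ n :=
        (Finset.card_filter_le (Finset.range n) fun i => (D i ω).2 = y).trans_eq
          (Finset.card_range n)
      simpa [Nat.lt_succ_iff] using this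
  have hpiece : ∀ m ∈ Finset.range (n + 1), μ.real (E ∩ {ω | M ≤ m ∧ cnt n ω = m}) ≤
      μ.real {ω | cnt n ω = m} * (η / 2) := by
    intro m _
    by_cases hMm : M ≤ m
    · obtain ⟨hki, hkb⟩ := hkey m ((le_max_left _ _).trans hMm) n
      have hcen := hm₁ m ((le_max_right _ _).trans hMm)
      rw [Real.dist_eq] at hcen
      have hmarkov := mul_meas_ge_le_integral_of_nonneg (ae_of_all _ fun ω => mul_nonneg
        (abs_nonneg (finAvg (classIdx (fun i => D i ω) n y)
          (fun i => κ ((t - (D i ω).1 j) / h m) / h m) -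
          ∫ x, κ ((t - x j) / h m) / h m ∂classLaw P y)) (by split_ifs <;> norm_num)) hki (ε / 2)
      have hsub : μ.real (E ∩ {ω | M ≤ m ∧ cnt n ω = m}) ≤ μ.real {ω | ε / 2 ≤
          |finAvg (classIdx (fun i => D i ω) n y)
            (fun i => κ ((t - (D i ω).1 j) / h m) / h m) -
            ∫ x, κ ((t - x j) / h m) / h m ∂classLaw P y| *
          (if classCount (fun i => D i ω) n y = m then 1 else 0)} := by
        refine measureReal_mono ?_
        rintro ω ⟨hω, -, hc⟩
        have hc' : classCount (fun i => D i ω) n y = m := hc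
        simp only [hE, Set.mem_ofPred_eq, kde_eq_finAvg hc'] at hω
        simp only [Set.mem_ofPred_eq, hc', if_true, mul_one]
        rw [abs_lt] at hcen
        rcases le_abs.1 hω with h1 | h1
        · exact le_abs.2 (Or.inl (by linarith))
        · exact le_abs.2 (Or.inr (by linarith))
      have h3 := hmarkov.trans hkb
      have h4 : ε / 2 * μ.real (E ∩ {ω | M ≤ m ∧ cnt n ω = m}) ≤
          ε / 2 * (μ.real {ω | cnt n ω = m} * (η / 2)) := by
        calc _ ≤ _ := mul_le_mul_of_nonneg_left hsub (half_pos hε).le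
          _ ≤ _ := h3
          _ = _ := by ring
      exact le_of_mul_le_mul_left h4 (half_pos hε)
    · simp only [hMm, false_and, Set.ofPred_false, Set.inter_empty, measureReal_empty]
      positivity
  -- The events are disjoint, so summing over all counts costs no factor `n`.
  have htotal : ∑ m ∈ Finset.range (n + 1), μ.real {ω | cnt n ω = m} ≤ 1 := by
    rw [← measureReal_biUnion_finset (fun m _ m' _ hmm' => Set.disjoint_left.2
      fun ω h1 h2 => hmm' (h1.symm.trans h2)) fun m _ => measurableSet_classCount_eq hDm n y m]
    exact measureReal_le_one
  calc μ.real E ≤ μ.real ({ω | cnt n ω < M} ∪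
        ⋃ m ∈ Finset.range (n + 1), (E ∩ {ω | M ≤ m ∧ cnt n ω = m})) := measureReal_mono hcover
    _ ≤ μ.real {ω | cnt n ω < M} +
        μ.real (⋃ m ∈ Finset.range (n + 1), (E ∩ {ω | M ≤ m ∧ cnt n ω = m})) :=
      measureReal_union_le _ _
    _ ≤ μ.real {ω | cnt n ω < M} +
        ∑ m ∈ Finset.range (n + 1), μ.real (E ∩ {ω | M ≤ m ∧ cnt n ω = m}) := by
      gcongr
      exact measureReal_biUnion_finset_le _ _
    _ ≤ μ.real {ω | cnt n ω < M} +
        ∑ m ∈ Finset.range (n + 1), μ.real {ω | cnt n ω = m} * (η / 2) := by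
      gcongr with m hm
      exact hpiece m hm
    _ ≤ μ.real {ω | cnt n ω < M} + 1 * (η / 2) := by
      rw [← Finset.sum_mul]
      gcongr
    _ < η := by linarith [hn₀ n hn]

end KernelDensity

end DCC

namespace DCC

/-! ### The margin penalty. -/

section Penalty

variable {d : ℕ}

/-- Nonnegativity is all that is needed of the penalty of the fitted network: dropping it can only
raise the objective. -/
lemma marginDefect_nonneg (g : (Fin d → ℝ) → ℝ) : 0 ≤ marginDefect g :=
  Finset.sum_nonneg fun _ _ =>
    intervalIntegral.integral_nonneg zero_le_one fun _ _ => sq_nonneg _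

lemma continuousOn_comp_update {f : (Fin d → ℝ) → ℝ} (hf : ContinuousOn f (cube d)) (i : Fin d)
    {t : ℝ} (ht : t ∈ Set.Icc (0 : ℝ) 1) :
    ContinuousOn (fun v => f (Function.update v i t)) (cube d) :=
  hf.comp (continuous_id.update i continuous_const).continuousOn
    fun _ hv => update_mem_cube hv i ht

/-- The margin penalty of a function close to a multiple of a density with uniform margins. -/
lemma marginDefect_div_le {q c : (Fin d → ℝ) → ℝ} (hq : ContinuousOn q (cube d))
    (hc : ContinuousOn c (cube d))
    (hm : ∀ i, ∀ t ∈ Set.Ioo (0 : ℝ) 1, ∫ v in cube d, c (Function.update v i t) = 1)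
    {ε : ℝ} (hε : ∀ u ∈ cube d, |q u - c u| ≤ ε) {ρ : ℝ} (hρ : 1 / 2 ≤ ρ) :
    marginDefect (fun u => q u / ρ) ≤ d * (8 * (ε ^ 2 + (ρ - 1) ^ 2)) := by
  have hρ0 : 0 < ρ := by linarith
  have hterm : ∀ i : Fin d,
      ∫ t in (0 : ℝ)..1, ((∫ v in cube d, q (Function.update v i t) / ρ) - 1) ^ 2 ≤
        8 * (ε ^ 2 + (ρ - 1) ^ 2) := by
    intro i
    refine (le_abs_self _).trans ?_
    -- The margins are known to be uniform at interior points only; the right endpoint is removed as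
    -- a null set.
    have h1 : ∀ᵐ t : ℝ, t ≠ 1 := by simp [ae_iff]
    refine (intervalIntegral.norm_integral_le_of_norm_le_const_ae (E := ℝ)
      (C := 8 * (ε ^ 2 + (ρ - 1) ^ 2)) ?_).trans_eq
      (by rw [sub_zero, abs_one, mul_one])
    filter_upwards [h1] with t ht1 ht
    rw [Set.uIoc_of_le zero_le_one] at ht
    have htc : t ∈ Set.Icc (0 : ℝ) 1 := ⟨ht.1.le, ht.2⟩
    have hqi := integrableOn_cube_of_continuousOn (continuousOn_comp_update hq i htc)
    have hci := integrableOn_cube_of_continuousOn (continuousOn_comp_update hc i htc)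
    have hd : |(∫ v in cube d, q (Function.update v i t)) - 1| ≤ ε := by
      rw [← hm i t ⟨ht.1, lt_of_le_of_ne ht.2 ht1⟩, ← integral_sub hqi hci, ← Real.norm_eq_abs]
      refine (norm_setIntegral_le_of_norm_le_const (by simp [volume_cube]) fun v hv =>
        hε _ (update_mem_cube hv i htc)).trans_eq ?_
      simp [Measure.real, volume_cube]
    rw [integral_div, Real.norm_eq_abs, abs_pow, sq_abs]
    have e : (∫ v in cube d, q (Function.update v i t)) / ρ - 1 =
        (((∫ v in cube d, q (Function.update v i t)) - 1) - (ρ - 1)) / ρ := by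
      field_simp
      ring
    rw [e, div_pow, div_le_iff₀ (by positivity)]
    generalize (∫ v in cube d, q (Function.update v i t)) - 1 = a at hd ⊢
    -- The constant `8` is `2` from squaring a difference times `4` from `ρ ≥ 1 / 2`.
    have ha : a ^ 2 ≤ ε ^ 2 := sq_le_sq' (neg_le_of_abs_le hd) (le_of_abs_le hd)
    have hρ2 : 1 / 4 ≤ ρ ^ 2 := by nlinarith
    nlinarith [sq_nonneg (a + (ρ - 1)), sq_nonneg ε, sq_nonneg (ρ - 1)]
  refine (Finset.sum_le_sum fun i _ => hterm i).trans_eq ?_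
  simp

end Penalty

/-! ### Networks as probability densities. -/

section NeuralCopula

variable {d L W : ℕ}

lemma integral_nn_pos (θ : NetParam d L W) : 0 < ∫ v in cube d, nn θ v := by
  rw [integral_pos_iff_support_of_nonneg (fun v => (nn_pos θ v).le)
    (integrableOn_cube_of_continuousOn (continuous_nn θ).continuousOn)]
  have : Function.support (nn θ) = Set.univ :=
    Set.eq_univ_of_forall fun v => (nn_pos θ v).ne'
  simp [this]

lemma nnDensity_pos (θ : NetParam d L W) (u : Fin d → ℝ) : 0 < nnDensity θ u :=
  div_pos (nn_pos θ u) (integral_nn_pos θ)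

lemma integral_nnDensity (θ : NetParam d L W) : ∫ u in cube d, nnDensity θ u = 1 := by
  simp only [nnDensity]
  rw [integral_div, div_self (integral_nn_pos θ).ne']

/-- The scale `∫ NN` cancels between network and Monte-Carlo normalizer. What remains involves only
the normalized density, which the sieve controls, and an average whose limit is one. -/
lemma neuralCopula_eq (M : ℕ) (v : ℕ → Fin d → ℝ) (θ : NetParam d L W) (u : Fin d → ℝ) :
    neuralCopula M v θ u =
      nnDensity θ u / finAvg (Finset.range M) fun m => nnDensity θ (v m) := by
  have hI := (integral_nn_pos θ).ne'
  simp only [neuralCopula, mcNormalizer, nnDensity, finAvg, Finset.card_range, ← Finset.sum_div]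
  rw [div_right_comm _ _ (M : ℝ), div_div_div_cancel_right₀ hI]

end NeuralCopula

/-! ### Mixtures with the uniform density. -/

section Mixture

variable {d : ℕ} {c : (Fin d → ℝ) → ℝ} {K : ℝ≥0} {η : ℝ}

lemma lipschitzOnWith_mixture (hL : LipschitzOnWith K c (cube d)) (h0 : 0 ≤ η) (h1 : η ≤ 1) :
    LipschitzOnWith K (fun u => (1 - η) * c u + η) (cube d) := by
  refine LipschitzOnWith.of_dist_le_mul fun u hu v hv => ?_
  have h := hL.dist_le_mul u hu v hv
  rw [Real.dist_eq] at h ⊢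
  rw [add_sub_add_right_eq_sub, ← mul_sub, abs_mul, abs_of_nonneg (by linarith)]
  exact (mul_le_of_le_one_left (abs_nonneg _) (by linarith)).trans h

lemma integral_mixture {f : (Fin d → ℝ) → ℝ} (hf : IntegrableOn f (cube d))
    (h : ∫ u in cube d, f u = 1) (η : ℝ) : ∫ u in cube d, ((1 - η) * f u + η) = 1 := by
  rw [integral_add (hf.const_mul _) (integrable_const _), integral_const_mul, h,
    integral_cube_const]
  ring

end Mixture

end DCC

namespace DCC

/-! ### Comparators in the sieve and consistency of the fitted copula density. -/

section CopulaConsistency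

variable {d K : ℕ} {P : Measure (Obs d K)} [IsProbabilityMeasure P]
  {r : ℝ} {p C c : Fin K → (Fin d → ℝ) → ℝ} {Lc : ℝ≥0}
  {Ω : Type*} [MeasurableSpace Ω] {μ : Measure Ω} [IsProbabilityMeasure μ]
  {D : ℕ → Ω → Obs d K}

lemma Regular.ae_tendstoUniformly_pit (hP : Regular P r p C c Lc) (hDm : ∀ i, Measurable (D i))
    (hDlaw : ∀ i, μ.map (D i) = P) (hDind : iIndepFun D μ) (y : Fin K) :
    ∀ᵐ ω ∂μ, TendstoUniformly (fun n => pit (fun i => D i ω) n y) (cdfVec P y) atTop := by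
  have h := ae_all_iff.2 fun j => hP.ae_tendstoUniformly_ecdf hDm hDlaw hDind j y
  filter_upwards [h] with ω hω
  rw [Metric.tendstoUniformly_iff]
  intro ε hε
  filter_upwards [eventually_all.2 fun j => Metric.tendstoUniformly_iff.1 (hω j) ε hε] with n hn x
  exact (dist_pi_lt_iff hε).2 fun j => hn j (x j)

variable {V : ℕ → ℕ → Ω → Fin d → ℝ} {N L W S M s : ℕ → ℕ} {lam : ℕ → ℝ}

/-- Networks in the sieve whose penalized likelihood converges to the likelihood of a mixture of
the copula density with the uniform density. -/
lemma Regular.exists_comparator (hd : 1 ≤ d) (hP : Regular P r p C c Lc)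
    (hDm : ∀ i, Measurable (D i)) (hDlaw : ∀ i, μ.map (D i) = P) (hDind : iIndepFun D μ)
    (y : Fin K) (hVm : ∀ j m, Measurable (V j m))
    (hVlaw : ∀ j m, μ.map (V j m) = volume.restrict (cube d)) (hVind : ∀ j, iIndepFun (V j) μ)
    (hN : Tendsto N atTop atTop) (hM : ∀ j, 0 < M j) (hlam : ∀ j, 0 ≤ lam j)
    (hlM : ∀ j, (lam j + 1) / M j ≤ (1 / 2 : ℝ) ^ j)
    (hs : Tendsto s atTop atTop) (hls : Tendsto (fun j => lam j * ((2 : ℝ) ^ s j)⁻¹ ^ 2) atTop (𝓝 0))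
    (hL : ∀ j, 2 * d + s j * d ≤ L j) (hW : ∀ j, 2 ^ (s j * d + 2 * d) ≤ W j)
    (hS : ∀ j, ∀ w, w = 2 ^ (s j * d + 2 * d) →
      w * d + w + L j * (w * w) + L j * w + w + 1 ≤ S j)
    {Λ : ℝ≥0} (hΛ : Lc ≤ Λ) {η : ℝ} (hη : η ∈ Set.Ioo 0 1) :
    ∃ ϑ : (j : ℕ) → NetParam d (L j) (W j), (∀ j, ϑ j ∈ sieve (S j) Λ) ∧
      ∀ᵐ ω ∂μ, Tendsto (fun j => objective (fun i => D i ω) (N j) (M j) (fun m => V j m ω) (lam j) y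
        (ϑ j)) atTop (𝓝 (∫ u in cube d, c y u * Real.log ((1 - η) * c y u + η))) := by
  have hc := (hP.copula_lipschitz y).continuousOn
  have hc0 := (hP.copula_density y).nonneg
  have hcI := (hP.copula_density y).integral_eq_one hd (hP.copula y)
  -- Mixing keeps the Lipschitz constant, the total mass and the uniform margins, and bounds the
  -- density below by `η`, so its logarithm is continuous.
  set cη : (Fin d → ℝ) → ℝ := fun u => (1 - η) * c y u + η with hcη
  have hcη1 : ∀ u ∈ cube d, η ≤ cη u := fun u hu => by
    have := mul_nonneg (by linarith [hη.2] : 0 ≤ 1 - η) (hc0 u hu)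
    simp only [hcη]
    linarith
  have hLη : LipschitzOnWith Lc cη (cube d) :=
    lipschitzOnWith_mixture (hP.copula_lipschitz y) hη.1.le hη.2.le
  have hmargin : ∀ i, ∀ t ∈ Set.Ioo (0 : ℝ) 1,
      ∫ v in cube d, cη (Function.update v i t) = 1 := fun i t ht =>
    integral_mixture (integrableOn_cube_of_continuousOn
      (continuousOn_comp_update hc i ⟨ht.1.le, ht.2.le⟩))
      ((hP.copula_density y).integral_update_eq_one (hP.copula y) (hP.copula_lipschitz y) i ht) η
  choose ϑ hϑ hϑc using fun j => exists_sieve_approx hd (fun u hu => hη.1.le.trans (hcη1 u hu)) hLη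
    (integral_mixture (integrableOn_cube_of_continuousOn hc) hcI η) (s j) rfl (hL j) (hW j)
    (hS j _ rfl)
  set q : ℕ → (Fin d → ℝ) → ℝ := fun j => nnDensity (ϑ j) with hq
  set A : ℝ := (1 + Lc) * (2 * Lc + 1) with hA
  have hA0 : 0 ≤ A := by positivity
  have hqL : ∀ j, LipschitzOnWith Lc (q j) (cube d) := fun j => (hϑ j).2
  have hinv : Tendsto (fun j => ((2 : ℝ) ^ s j)⁻¹) atTop (𝓝 0) :=
    tendsto_inv_atTop_zero.comp ((tendsto_pow_atTop_atTop_of_one_lt one_lt_two).comp hs)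
  have hunif : TendstoUniformlyOn q cη atTop (cube d) := by
    rw [Metric.tendstoUniformlyOn_iff]
    intro ε hε
    have h0 : Tendsto (fun j => A * ((2 : ℝ) ^ s j)⁻¹) atTop (𝓝 0) := by
      simpa using hinv.const_mul A
    filter_upwards [h0.eventually (gt_mem_nhds hε)] with j hj u hu
    rw [dist_comm, Real.dist_eq]
    exact (hϑc j u hu).trans_lt hj
  -- A bound uniform in `j`: the comparators are deterministic, and their Monte-Carlo errors have
  -- comparable variances.
  have hgR : ∀ j u, |(cube d).indicator (q j) u| ≤ 1 + Lc := by
    intro j u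
    by_cases hu : u ∈ cube d
    · rw [Set.indicator_of_mem hu, abs_of_pos (nnDensity_pos _ _)]
      exact le_one_add_of_integral_eq_one (hqL j) (integral_nnDensity _) hu
    · rw [Set.indicator_of_notMem hu, abs_zero]
      positivity
  refine ⟨ϑ, fun j => ⟨(hϑ j).1, (hϑ j).2.weaken hΛ⟩, ?_⟩
  have hMC1 := ae_tendsto_finAvg_monteCarlo hVm hVlaw hVind hM fun j =>
    (div_le_div_of_nonneg_right (by linarith [hlam j]) (Nat.cast_nonneg _)).trans (hlM j)
  have hMC2 := ae_tendsto_weighted_sq hVm hVlaw hVind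
    (fun j => measurable_indicator_cube (hqL j).continuousOn) hgR hM
    (fun j => by linarith [hlam j]) hlM
  filter_upwards [hMC1, hMC2, hP.ae_tendstoUniformly_pit hDm hDlaw hDind y,
    hP.ae_tendsto_finAvg_cdfVec hDm hDlaw hDind y] with ω hω1 hω2 hpit havg
  set ρ : ℕ → ℝ := fun j => finAvg (Finset.range (M j)) fun m => q j (V j m ω) with hρ
  -- The weight `lam j + 1` serves twice: it controls the normalizer error inside the penalty, and
  -- it is at least one, so the normalizer itself converges.
  have hweight : Tendsto (fun j => (lam j + 1) * (ρ j - 1) ^ 2) atTop (𝓝 0) := by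
    refine hω2.congr fun j => ?_
    rw [setIntegral_indicator measurableSet_cube, Set.inter_self, integral_nnDensity]
    simp only [hρ, Set.indicator_of_mem (hω1.1 _ _)]
  have hρ1 : Tendsto ρ atTop (𝓝 1) := by
    have h1 : Tendsto (fun j => (ρ j - 1) ^ 2) atTop (𝓝 0) :=
      squeeze_zero (fun j => sq_nonneg _)
        (fun j => le_mul_of_one_le_left (sq_nonneg _) (by linarith [hlam j])) hweight
    have h2 := h1.sqrt
    simp only [Real.sqrt_sq_eq_abs, Real.sqrt_zero] at h2
    have h3 := (tendsto_zero_iff_abs_tendsto_zero _).2 h2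
    simpa using h3.add_const 1
  have hρhalf : ∀ᶠ j in atTop, 1 / 2 ≤ ρ j := hρ1.eventually (le_mem_nhds (by norm_num))
  have hlik : Tendsto (fun j => finAvg (classIdx (fun i => D i ω) (N j) y) fun i =>
      Real.log (q j (pit (fun i => D i ω) (N j) y (D i ω).1) / ρ j)) atTop
      (𝓝 (∫ u in cube d, c y u * Real.log (cη u))) := by
    have hlu : TendstoUniformlyOn (fun j u => Real.log (q j u) - Real.log (ρ j))
        (fun u => Real.log (cη u) - Real.log 1) atTop (cube d) :=
      (TendstoUniformlyOn.log_of_le hη.1 hunif hcη1).sub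
        ((hρ1.log one_ne_zero).tendstoUniformlyOn_const _)
    have hlc : ContinuousOn (fun u => Real.log (cη u) - Real.log 1) (cube d) :=
      (hLη.continuousOn.log fun u hu => (hη.1.trans_le (hcη1 u hu)).ne').sub continuousOn_const
    have ht := tendsto_finAvg_of_tendstoUniformlyOn (l := atTop)
      (ℓ := fun φ => ∫ u in cube d, c y u * φ u)
      (I := fun j => classIdx (fun i => D i ω) (N j) y)
      (x := fun _ i => cdfVec P y (D i ω).1)
      (x' := fun j i => pit (fun i => D i ω) (N j) y (D i ω).1)
      (fun j i _ => hP.cdfVec_mem_cube y _) (fun j i _ => pit_mem_cube _ _ _ _)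
      (fun ε hε => (hN.eventually (Metric.tendstoUniformly_iff.1 hpit ε hε)).mono fun j hj i _ => by
        rw [dist_comm]
        exact hj _)
      (fun φ hφ => (havg φ hφ).comp hN) hlc hlu
    simp only [Real.log_one, sub_zero] at ht
    refine ht.congr' ?_
    filter_upwards [hρhalf] with j hj
    congr 1
    ext i
    rw [Real.log_div (nnDensity_pos _ _).ne' (by linarith)]
  have hpen : Tendsto (fun j => lam j * marginDefect fun u => q j u / ρ j) atTop (𝓝 0) := by
    have hup : Tendsto (fun j => (d * 8 : ℝ) * (A ^ 2 * (lam j * ((2 : ℝ) ^ s j)⁻¹ ^ 2) +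
        (lam j + 1) * (ρ j - 1) ^ 2)) atTop (𝓝 0) := by
      simpa using ((hls.const_mul (A ^ 2)).add hweight).const_mul (d * 8 : ℝ)
    refine squeeze_zero' (Eventually.of_forall fun j => mul_nonneg (hlam j) (marginDefect_nonneg _))
      ?_ hup
    filter_upwards [hρhalf] with j hj
    have h1 := mul_le_mul_of_nonneg_left (marginDefect_div_le (hqL j).continuousOn hLη.continuousOn
      hmargin (hϑc j) hj) (hlam j)
    refine h1.trans ?_
    have h2 : lam j * (ρ j - 1) ^ 2 ≤ (lam j + 1) * (ρ j - 1) ^ 2 := by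
      gcongr
      linarith
    calc lam j * (d * (8 * ((A * ((2 : ℝ) ^ s j)⁻¹) ^ 2 + (ρ j - 1) ^ 2)))
        = (d * 8 : ℝ) * (A ^ 2 * (lam j * ((2 : ℝ) ^ s j)⁻¹ ^ 2) + lam j * (ρ j - 1) ^ 2) := by ring
      _ ≤ _ := by gcongr
  have hfin := hlik.sub hpen
  rw [sub_zero] at hfin
  refine hfin.congr fun j => ?_
  have hnc : neuralCopula (M j) (fun m => V j m ω) (ϑ j) = fun u => q j u / ρ j :=
    funext fun u => neuralCopula_eq _ _ _ _
  rw [objective, hnc]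
  rfl

/-- Uniform consistency of penalized maximum likelihood for the copula density, along sample sizes
with summable Monte-Carlo errors. -/
theorem Regular.ae_tendstoUniformlyOn_nnDensity (hd : 1 ≤ d) (hP : Regular P r p C c Lc)
    (hDm : ∀ i, Measurable (D i)) (hDlaw : ∀ i, μ.map (D i) = P) (hDind : iIndepFun D μ)
    (y : Fin K) (hVm : ∀ j m, Measurable (V j m))
    (hVlaw : ∀ j m, μ.map (V j m) = volume.restrict (cube d)) (hVind : ∀ j, iIndepFun (V j) μ)
    (hN : Tendsto N atTop atTop) (hM : ∀ j, 0 < M j) (hlam : ∀ j, 0 ≤ lam j)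
    (hlM : ∀ j, (lam j + 1) / M j ≤ (1 / 2 : ℝ) ^ j)
    (hs : Tendsto s atTop atTop) (hls : Tendsto (fun j => lam j * ((2 : ℝ) ^ s j)⁻¹ ^ 2) atTop (𝓝 0))
    (hL : ∀ j, 2 * d + s j * d ≤ L j) (hW : ∀ j, 2 ^ (s j * d + 2 * d) ≤ W j)
    (hS : ∀ j, ∀ w, w = 2 ^ (s j * d + 2 * d) →
      w * d + w + L j * (w * w) + L j * w + w + 1 ≤ S j)
    {Λ : ℝ≥0} (hΛ : Lc ≤ Λ) {θ : (j : ℕ) → Ω → NetParam d (L j) (W j)} {tol : ℕ → ℝ}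
    (htol : Tendsto tol atTop (𝓝 0))
    (hθ : ∀ᵐ ω ∂μ, ∀ᶠ j in atTop, θ j ω ∈ sieve (S j) Λ ∧
        ∀ ϑ ∈ (sieve (S j) Λ : Set (NetParam d (L j) (W j))),
          objective (fun i => D i ω) (N j) (M j) (fun m => V j m ω) (lam j) y ϑ ≤
            objective (fun i => D i ω) (N j) (M j) (fun m => V j m ω) (lam j) y (θ j ω) + tol j) :
    ∀ᵐ ω ∂μ, TendstoUniformlyOn (fun j => nnDensity (θ j ω)) (c y) atTop (cube d) ∧
      Tendsto (fun j => finAvg (Finset.range (M j)) fun m => nnDensity (θ j ω) (V j m ω)) atTop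
        (𝓝 1) := by
  classical
  -- A sequence of mixing weights keeps the comparator statements countable, hence valid outside one
  -- null set.
  have he : ∀ k : ℕ, 1 / ((k : ℝ) + 1 + 1) ∈ Set.Ioo (0 : ℝ) 1 := fun k => by
    refine ⟨by positivity, ?_⟩
    rw [div_lt_one (by positivity)]
    linarith [(Nat.cast_nonneg k : (0 : ℝ) ≤ k)]
  have he0 : Tendsto (fun k : ℕ => 1 / ((k : ℝ) + 1 + 1)) atTop (𝓝 0) := by
    have := (tendsto_add_atTop_iff_nat 1).2 (tendsto_one_div_add_atTop_nhds_zero_nat (𝕜 := ℝ))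
    simpa using this
  choose ϑ hϑ hobj using fun k => hP.exists_comparator hd hDm hDlaw hDind y hVm hVlaw hVind hN hM
    hlam hlM hs hls hL hW hS hΛ (he k)
  have hMC1 := ae_tendsto_finAvg_monteCarlo hVm hVlaw hVind hM fun j =>
    (div_le_div_of_nonneg_right (by linarith [hlam j]) (Nat.cast_nonneg _)).trans (hlM j)
  filter_upwards [hMC1, hP.ae_tendstoUniformly_pit hDm hDlaw hDind y,
    hP.ae_tendsto_finAvg_cdfVec hDm hDlaw hDind y, hθ, ae_all_iff.2 hobj] with
    ω hω1 hpit havg hθω hobjω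
  -- Before the fitted parameter enters the sieve, the uniform density stands in for it, so that the
  -- Lipschitz bound holds for every `j`.
  set q : ℕ → (Fin d → ℝ) → ℝ := fun j =>
    if θ j ω ∈ sieve (S j) Λ then nnDensity (θ j ω) else fun _ => 1 with hq
  have hqeq : ∀ᶠ j in atTop, q j = nnDensity (θ j ω) := hθω.mono fun j hj => if_pos hj.1
  have key := tendstoUniformlyOn_of_logLikelihood (hP.copula_lipschitz y).continuousOn
    (hP.copula_density y).nonneg ((hP.copula_density y).integral_eq_one hd (hP.copula y))
    (I := fun j => classIdx (fun i => D i ω) (N j) y)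
    (x := fun _ i => cdfVec P y (D i ω).1)
    (x' := fun j i => pit (fun i => D i ω) (N j) y (D i ω).1)
    (fun j i _ => hP.cdfVec_mem_cube y _) (fun j i _ => pit_mem_cube _ _ _ _)
    (fun ε hε => (hN.eventually (Metric.tendstoUniformly_iff.1 hpit ε hε)).mono fun j hj i _ => by
      rw [dist_comm]
      exact hj _)
    (fun φ hφ => (havg φ hφ).comp hN) (J := fun j => Finset.range (M j))
    (v := fun j m => V j m ω) (fun j m _ => hω1.1 j m) hω1.2 (K := Λ) (q := q)
    (fun j u _ => by
      simp only [hq]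
      split_ifs
      · exact nnDensity_pos _ _
      · exact one_pos)
    (fun j => by
      simp only [hq]
      split_ifs with h
      · exact h.2
      · exact (LipschitzWith.const' 1).lipschitzOnWith)
    (fun j => by
      simp only [hq]
      split_ifs
      · exact integral_nnDensity _
      · exact integral_cube_const 1)
    he he0 fun k => by
      refine ⟨fun j => objective (fun i => D i ω) (N j) (M j) (fun m => V j m ω) (lam j) y (ϑ k j) -
        tol j, by simpa using (hobjω k).sub htol, ?_⟩
      filter_upwards [hθω, hqeq] with j hj hqj
      have h1 := hj.2 _ (hϑ k j)
      -- Dropping the nonnegative penalty bounds the objective of the fit by its plain likelihood,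
      -- while the comparator keeps its full objective, whose penalty vanishes in the limit.
      have h2 : objective (fun i => D i ω) (N j) (M j) (fun m => V j m ω) (lam j) y (θ j ω) ≤
          finAvg (classIdx (fun i => D i ω) (N j) y) fun i =>
            Real.log (neuralCopula (M j) (fun m => V j m ω) (θ j ω)
              (pit (fun i => D i ω) (N j) y (D i ω).1)) :=
        sub_le_self _ (mul_nonneg (hlam j) (marginDefect_nonneg _))
      simp only [neuralCopula_eq] at h2
      rw [hqj]
      linarith
  refine ⟨key.1.congr (hqeq.mono fun j hj u _ => by rw [hj]), key.2.congr' ?_⟩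
  filter_upwards [hqeq] with j hj
  rw [hj]

end CopulaConsistency

end DCC

namespace DCC

/-! ### Compatibility of the approximation scale with the growth conditions. -/

section GrowthRates

lemma eventually_pow_mul_exp_sqrt_le (B a : ℝ) (k : ℕ) {β : ℝ} (hβ : 0 < β) :
    ∀ᶠ x : ℝ in atTop, B * x ^ k * Real.exp (a * √x) ≤ Real.exp (β * x) := by
  have h1 := (isLittleO_pow_exp_pos_mul_atTop k (half_pos hβ)).bound
    (show 0 < 1 / (|B| + 1) by positivity)
  have h2 : ∀ᶠ x : ℝ in atTop, a * √x ≤ β / 2 * x := by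
    filter_upwards [eventually_ge_atTop ((2 * |a| / β) ^ 2), eventually_ge_atTop 0] with x hx hx0
    have h3 : 2 * |a| / β ≤ √x := Real.le_sqrt_of_sq_le hx
    rw [div_le_iff₀ hβ] at h3
    nlinarith [Real.sq_sqrt hx0, Real.sqrt_nonneg x, le_abs_self a]
  filter_upwards [h1, h2, eventually_ge_atTop 0] with x hx hx2 hx0
  rw [Real.norm_of_nonneg (by positivity), Real.norm_of_nonneg (by positivity), div_mul_eq_mul_div,
    one_mul, le_div_iff₀ (by positivity)] at hx
  have h4 : B * x ^ k ≤ Real.exp (β / 2 * x) := by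
    have : (0 : ℝ) ≤ x ^ k := by positivity
    nlinarith [le_abs_self B]
  calc B * x ^ k * Real.exp (a * √x) ≤ Real.exp (β / 2 * x) * Real.exp (β / 2 * x) := by
        gcongr
    _ = Real.exp (β * x) := by rw [← Real.exp_add]; ring_nf

lemma tendsto_log_natCast_atTop : Tendsto (fun n : ℕ => Real.log n) atTop atTop :=
  Real.tendsto_log_atTop.comp tendsto_natCast_atTop_atTop

/-- With `x = log n`, a positive power of `n` is `exp (β * x)`. It dominates polynomials in `x`
times `exp (b * √x)`, even after division by the logarithmic factors allowed in the growth
condition. -/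
lemma EqUpToLogs.eventually_le {a : ℕ → ℕ} {β : ℝ}
    (h : EqUpToLogs (fun n => (a n : ℝ)) fun n => (n : ℝ) ^ β) (hβ : 0 < β) (B b : ℝ) (k : ℕ) :
    ∀ᶠ n : ℕ in atTop, B * Real.log n ^ k * Real.exp (b * √(Real.log n)) ≤ a n := by
  obtain ⟨A, hA, m, hm⟩ := h
  filter_upwards [hm, tendsto_log_natCast_atTop.eventually
    (eventually_pow_mul_exp_sqrt_le (A * B) b (m + k) hβ), eventually_gt_atTop 0,
    tendsto_log_natCast_atTop.eventually_gt_atTop 0] with n hn hx hn0 hl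
  have h1 := hn.2
  rw [Real.rpow_def_of_pos (by exact_mod_cast hn0), mul_comm (Real.log n) β] at h1
  have h2 := hx.trans h1
  have h3 : 0 < A * Real.log n ^ m := by positivity
  refine le_of_mul_le_mul_left ?_ h3
  refine le_trans (le_of_eq ?_) h2
  ring

namespace Growth

variable {d : ℕ} {r : ℝ} {L W S M : ℕ → ℕ} {lam : ℕ → ℝ}

/-- The choice is `s = ⌊√(log n)⌋`. The required depth is then of smaller order than `log n`, and
the width and dense size are at most a power of `log n` times `exp (O(√(log n)))`, below every
positive power of `n`. Yet `4 ^ (-s)` still beats any power of `log n`, hence the penalty weight. -/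
lemma exists_scale (h : Growth d r L W S M lam) (hd : 1 ≤ d) (hr : (d : ℝ) / 2 < r) :
    ∃ s : ℕ → ℕ, Tendsto s atTop atTop ∧
      Tendsto (fun n => lam n * ((2 : ℝ) ^ s n)⁻¹ ^ 2) atTop (𝓝 0) ∧
      ∀ᶠ n in atTop, 2 * d + s n * d ≤ L n ∧ 2 ^ (s n * d + 2 * d) ≤ W n ∧
        ∀ w, w = 2 ^ (s n * d + 2 * d) →
          w * d + w + L n * (w * w) + L n * w + w + 1 ≤ S n := by
  have hd0 : (0 : ℝ) < d := by exact_mod_cast hd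
  have hβ : 0 < (d : ℝ) / (2 * r + d) := by
    have : 0 < r := by linarith
    positivity
  have hsq : Tendsto (fun n : ℕ => √(Real.log n)) atTop atTop :=
    Real.tendsto_sqrt_atTop.comp tendsto_log_natCast_atTop
  refine ⟨fun n => ⌊√(Real.log n)⌋₊, tendsto_nat_floor_atTop.comp hsq, ?_, ?_⟩
  · obtain ⟨k, hk⟩ := h.penalty_slow
    obtain ⟨A, hA, hkA⟩ := hk.exists_pos
    have hlim : Tendsto (fun n : ℕ => A * Real.exp 1 *
        (√(Real.log n) ^ (2 * k) * Real.exp (-√(Real.log n)))) atTop (𝓝 0) := by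
      simpa using ((Real.tendsto_pow_mul_exp_neg_atTop_nhds_zero (2 * k)).comp hsq).const_mul
        (A * Real.exp 1)
    refine squeeze_zero_norm' ?_ hlim
    filter_upwards [hkA.bound, tendsto_log_natCast_atTop.eventually_ge_atTop 0] with n hn hl
    -- From `e ≤ 4`; the factor `exp 1` pays for the floor.
    have h1 : (((2 : ℝ) ^ ⌊√(Real.log n)⌋₊)⁻¹) ^ 2 ≤ Real.exp 1 * Real.exp (-√(Real.log n)) := by
      have h2 : Real.exp 1 ≤ 4 := by linarith [Real.exp_one_lt_d9]
      have h3 : Real.exp ⌊√(Real.log n)⌋₊ ≤ (4 : ℝ) ^ ⌊√(Real.log n)⌋₊ := by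
        rw [← mul_one ((⌊√(Real.log n)⌋₊ : ℕ) : ℝ), Real.exp_nat_mul]
        gcongr
      have h4 : Real.exp (√(Real.log n) - 1) ≤ (4 : ℝ) ^ ⌊√(Real.log n)⌋₊ :=
        (Real.exp_le_exp.2 (by linarith [Nat.lt_floor_add_one √(Real.log n)])).trans h3
      rw [← Real.exp_add, inv_pow, ← pow_mul, mul_comm, pow_mul]
      norm_num only
      rw [show (1 : ℝ) + -√(Real.log n) = -(√(Real.log n) - 1) by ring, Real.exp_neg]
      gcongr
    rw [norm_mul, Real.norm_of_nonneg (by positivity : 0 ≤ (((2 : ℝ) ^ ⌊√(Real.log n)⌋₊)⁻¹) ^ 2)]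
    rw [Real.norm_of_nonneg (by positivity : 0 ≤ Real.log n ^ k)] at hn
    calc _ ≤ A * Real.log n ^ k * (Real.exp 1 * Real.exp (-√(Real.log n))) := by gcongr
      _ = _ := by rw [pow_mul, Real.sq_sqrt hl]; ring
  · obtain ⟨A, hA, hLA⟩ := h.depth.1.exists_pos
    obtain ⟨B, hB, hLB⟩ := h.depth.2.exists_pos
    have hW := h.width.eventually_le hβ (Real.exp (2 * d)) d 0
    have hS := h.size.eventually_le hβ ((d + 4 + 2 * A) * Real.exp (2 * d) ^ 2) (2 * d) 1
    have hlin : ∀ᶠ x : ℝ in atTop, B * (2 * d + √x * d) ≤ x := by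
      filter_upwards [eventually_ge_atTop ((3 * B * d) ^ 2), eventually_ge_atTop 1] with x hx hx1
      have h3 : 3 * B * d ≤ √x := Real.le_sqrt_of_sq_le hx
      have h4 : 1 ≤ √x := Real.one_le_sqrt.2 hx1
      have h5 := Real.sq_sqrt (zero_le_one.trans hx1)
      have h6 : 0 ≤ B * d := by positivity
      nlinarith
    filter_upwards [hLA.bound, hLB.bound, hW, hS, tendsto_log_natCast_atTop.eventually hlin,
      tendsto_log_natCast_atTop.eventually_ge_atTop 1] with n hnA hnB hnW hnS hnl hl1
    have hl0 : 0 ≤ Real.log n := by linarith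
    rw [Real.norm_of_nonneg hl0, Real.norm_of_nonneg (Nat.cast_nonneg _)] at hnA hnB
    have hfl : (⌊√(Real.log n)⌋₊ : ℝ) ≤ √(Real.log n) := Nat.floor_le (Real.sqrt_nonneg _)
    have hw : (2 : ℝ) ^ (⌊√(Real.log n)⌋₊ * d + 2 * d) ≤
        Real.exp (2 * d) * Real.exp (d * √(Real.log n)) := by
      have h2 : (2 : ℝ) ≤ Real.exp 1 := by linarith [Real.exp_one_gt_d9]
      calc (2 : ℝ) ^ (⌊√(Real.log n)⌋₊ * d + 2 * d)
          ≤ Real.exp 1 ^ (⌊√(Real.log n)⌋₊ * d + 2 * d) := by gcongr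
        _ = Real.exp (⌊√(Real.log n)⌋₊ * d + 2 * d) := by
          rw [← Real.exp_nat_mul]
          push_cast
          rw [mul_one]
        _ ≤ Real.exp (√(Real.log n) * d + 2 * d) := by gcongr
        _ = _ := by rw [← Real.exp_add]; ring_nf
    refine ⟨?_, ?_, ?_⟩
    · have h1 : B * (2 * d + ⌊√(Real.log n)⌋₊ * d) ≤ B * L n := by
        refine le_trans ?_ (hnl.trans hnB)
        gcongr
      exact_mod_cast le_of_mul_le_mul_left h1 hB
    · rw [pow_zero, mul_one] at hnW
      exact_mod_cast hw.trans hnW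
    · intro w hweq
      have hw1 : (1 : ℝ) ≤ w := by
        rw [hweq]
        push_cast
        exact one_le_pow₀ one_le_two
      have hwle : (w : ℝ) ≤ Real.exp (2 * d) * Real.exp (d * √(Real.log n)) := by
        rw [hweq]
        push_cast
        exact hw
      have hL0 : (0 : ℝ) ≤ L n := Nat.cast_nonneg _
      have key : ((w * d + w + L n * (w * w) + L n * w + w + 1 : ℕ) : ℝ) ≤ S n := by
        push_cast
        calc (w * d + w + L n * (w * w) + L n * w + w + 1 : ℝ)
            -- All terms of the dense size are absorbed into `w ^ 2`, as `w ≥ 1`.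
            ≤ (d + 4 + 2 * L n) * (w : ℝ) ^ 2 := by
              nlinarith [mul_nonneg hd0.le (by nlinarith : (0 : ℝ) ≤ w ^ 2 - w),
                mul_nonneg hL0 (by nlinarith : (0 : ℝ) ≤ w ^ 2 - w)]
          _ ≤ ((d + 4 + 2 * A) * Real.log n) *
              (Real.exp (2 * d) * Real.exp (d * √(Real.log n))) ^ 2 := by
              gcongr
              nlinarith
          _ = (d + 4 + 2 * A) * Real.exp (2 * d) ^ 2 * Real.log n ^ 1 *
              Real.exp (2 * d * √(Real.log n)) := by
              rw [mul_pow, ← Real.exp_nat_mul (d * √(Real.log n))]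
              push_cast
              ring_nf
          _ ≤ S n := hnS
      exact_mod_cast key

/-- Since `1 / M ≤ M ^ (-1/2)`, the inverse of `M` decays faster than a fixed negative power of `n`,
which defeats the logarithmic growth of the penalty weight. -/
lemma tendsto_penalty_div (h : Growth d r L W S M lam) (hd : 1 ≤ d) (hr : (d : ℝ) / 2 < r) :
    Tendsto (fun n => (lam n + 1) / M n) atTop (𝓝 0) := by
  have hd0 : (0 : ℝ) < d := by exact_mod_cast hd
  have hγ : 0 < r / (2 * r + d) := by
    have : 0 < r := by linarith
    positivity
  obtain ⟨k, hk⟩ := h.penalty_slow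
  have h1 : (fun n => lam n + 1) =O[atTop] fun n : ℕ => Real.log n ^ (k + 1) := by
    refine (hk.trans ?_).add ?_
    · refine IsBigO.of_bound 1 ?_
      filter_upwards [tendsto_log_natCast_atTop.eventually_ge_atTop 1] with n hn
      rw [Real.norm_of_nonneg (by positivity), Real.norm_of_nonneg (by positivity), one_mul]
      exact pow_le_pow_right₀ hn (Nat.le_succ k)
    · refine IsBigO.of_bound 1 ?_
      filter_upwards [tendsto_log_natCast_atTop.eventually_ge_atTop 1] with n hn
      rw [Real.norm_of_nonneg (by positivity), Real.norm_of_nonneg (by positivity), one_mul]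
      exact one_le_pow₀ hn
  have h2 := h1.mul_isLittleO h.mc_rate
  have h3 : Tendsto (fun n : ℕ => Real.log n ^ (k + 1) * (n : ℝ) ^ (-(r / (2 * r + d)))) atTop
      (𝓝 0) := by
    have h4 := (isLittleO_pow_exp_pos_mul_atTop (k + 1) hγ).tendsto_div_nhds_zero.comp
      tendsto_log_natCast_atTop
    refine h4.congr' ?_
    filter_upwards [eventually_gt_atTop 0] with n hn
    rw [Real.rpow_neg (Nat.cast_nonneg _), Real.rpow_def_of_pos (by exact_mod_cast hn),
      mul_comm (Real.log n) (r / _)]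
    rfl
  have h5 := h2.trans_tendsto h3
  refine squeeze_zero_norm' ?_ ((tendsto_zero_iff_norm_tendsto_zero).1 h5)
  filter_upwards [h.mc_tendsto.eventually_ge_atTop 1] with n hn
  have hM1 : (1 : ℝ) ≤ M n := by exact_mod_cast hn
  rw [norm_div, norm_mul, div_eq_mul_inv, ← norm_inv, ← Real.rpow_neg_one]
  gcongr ?_ * ?_
  rw [Real.norm_of_nonneg (by positivity), Real.norm_of_nonneg (by positivity)]
  exact Real.rpow_le_rpow_of_exponent_le hM1 (by norm_num)

end Growth

end GrowthRates

/-! ### The argmax with ties broken by the smallest index. -/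

section Argmax

variable {K : ℕ} [NeZero K]

lemma le_firstArgmax (s : Fin K → ℝ) (y : Fin K) : s y ≤ s (firstArgmax s) := by
  have h := Finset.min'_mem (Finset.univ.filter fun y => ∀ y', s y' ≤ s y) (by
    obtain ⟨y, hy⟩ := Finite.exists_max s
    exact ⟨y, by simpa using hy⟩)
  exact (Finset.mem_filter.1 h).2 y

/-- Comparisons of coordinates alone describe the rule, which reduces its measurability to finitely
many half-spaces. -/
lemma firstArgmax_eq_iff (s : Fin K → ℝ) (y : Fin K) :
    firstArgmax s = y ↔ (∀ y', s y' ≤ s y) ∧ ∀ y' < y, ∃ y'', s y' < s y'' := by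
  constructor
  · rintro rfl
    refine ⟨le_firstArgmax s, fun y' hy' => ?_⟩
    by_contra! hcon
    exact absurd hy' (not_lt.2 (Finset.min'_le _ _ (by simpa using hcon)))
  · rintro ⟨h1, h2⟩
    refine le_antisymm (Finset.min'_le _ _ (by simpa using h1)) (not_lt.1 fun hlt => ?_)
    obtain ⟨y'', hy''⟩ := h2 _ hlt
    exact absurd hy'' (not_lt.2 (le_firstArgmax s y''))

lemma measurable_firstArgmax : Measurable (firstArgmax : (Fin K → ℝ) → Fin K) := by
  refine measurable_to_countable' fun y => ?_
  have : firstArgmax ⁻¹' {y} = (⋂ y', {s : Fin K → ℝ | s y' ≤ s y}) ∩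
      ⋂ y' : Fin K, ⋂ _ : y' < y, ⋃ y'', {s : Fin K → ℝ | s y' < s y''} := by
    ext s
    simp [firstArgmax_eq_iff]
  rw [this]
  refine (MeasurableSet.iInter fun y' => ?_).inter (MeasurableSet.iInter fun y' =>
    MeasurableSet.iInter fun _ => MeasurableSet.iUnion fun y'' => ?_)
  · exact measurableSet_le (measurable_pi_apply _) (measurable_pi_apply _)
  · exact measurableSet_lt (measurable_pi_apply _) (measurable_pi_apply _)

/-- A maximizer of scores close to `s` nearly, hence eventually exactly, maximizes `s`. -/
lemma eventually_apply_firstArgmax_eq {s : Fin K → ℝ} {a : ℕ → Fin K → ℝ}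
    (h : ∀ y, Tendsto (fun j => a j y) atTop (𝓝 (s y))) :
    ∀ᶠ j in atTop, s (firstArgmax (a j)) = s (firstArgmax s) := by
  -- Each strictly inferior index eventually loses under the approximate scores. Ties in the limit
  -- may be resolved differently for each `j`, so only the attained value stabilizes, not the index.
  have h1 : ∀ y, ∀ᶠ j in atTop, s y < s (firstArgmax s) → a j y < a j (firstArgmax s) := by
    intro y
    by_cases hy : s y < s (firstArgmax s)
    · exact ((h y).eventually_lt (h _) hy).mono fun j hj _ => hj
    · exact Eventually.of_forall fun j hj => absurd hj hy
  filter_upwards [eventually_all.2 h1] with j hj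
  refine le_antisymm (le_firstArgmax s _) (not_lt.1 fun hlt => ?_)
  exact absurd (hj _ hlt) (not_lt.2 (le_firstArgmax (a j) _))

end Argmax

/-! ### Measurability of the trained classifier. -/

section Measurability

variable {d K : ℕ} {Ω : Type*} [MeasurableSpace Ω] {D : ℕ → Ω → Obs d K}

lemma measurable_finAvg_classIdx (hD : ∀ i, Measurable (D i)) (n : ℕ) (y : Fin K)
    {f : ℕ → Ω → ℝ} (hf : ∀ i, Measurable (f i)) :
    Measurable fun ω => finAvg (classIdx (fun i => D i ω) n y) fun i => f i ω := by
  simp only [finAvg, sum_classIdx]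
  exact (Finset.measurable_sum _ fun i _ => Measurable.ite (measurableSet_label_comp hD i y) (hf i)
    measurable_const).div ((measurable_from_nat (f := fun m : ℕ => (m : ℝ))).comp
      (measurable_classCount hD n y))

lemma measurable_pit (hD : ∀ i, Measurable (D i)) (n : ℕ) (y : Fin K) {X : Ω → Fin d → ℝ}
    (hX : Measurable X) : Measurable fun ω => pit (fun i => D i ω) n y (X ω) := by
  refine measurable_pi_iff.2 fun j => ?_
  simp only [pit, ecdf_eq_finAvg]
  refine measurable_finAvg_classIdx hD n y fun i => Measurable.ite (measurableSet_le ?_ ?_)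
    measurable_const measurable_const
  · exact (measurable_pi_apply j).comp (measurable_fst.comp (hD i))
  · exact (measurable_pi_apply j).comp hX

lemma measurable_kde {κ : ℝ → ℝ} (hκ : Measurable κ) (h : ℕ → ℝ) (hD : ∀ i, Measurable (D i))
    (n : ℕ) (j : Fin d) (y : Fin K) {X : Ω → ℝ} (hX : Measurable X) :
    Measurable fun ω => kde κ h (fun i => D i ω) n j y (X ω) := by
  have hh : Measurable fun ω => h (classCount (fun i => D i ω) n y) :=
    (measurable_from_nat (f := h)).comp (measurable_classCount hD n y)
  have hn : Measurable fun ω => (classCount (fun i => D i ω) n y : ℝ) :=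
    (measurable_from_nat (f := fun m : ℕ => (m : ℝ))).comp (measurable_classCount hD n y)
  simp only [kde, sum_classIdx]
  refine (Finset.measurable_sum _ fun i _ => Measurable.ite (measurableSet_label_comp hD i y)
    (hκ.comp ((hX.sub ?_).div hh)) measurable_const).div (hn.mul hh)
  exact (measurable_pi_apply j).comp (measurable_fst.comp (hD i))

lemma _root_.Measurable.comp_uncurried {α β γ : Type*} [MeasurableSpace α] [MeasurableSpace β]
    [MeasurableSpace γ] {f : α → β → γ} (hf : Measurable fun x : α × β => f x.1 x.2) {θ : Ω → α}
    (hθ : Measurable θ) {U : Ω → β} (hU : Measurable U) : Measurable fun ω => f (θ ω) (U ω) :=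
  hf.comp (hθ.prodMk hU)

lemma measurable_nn {L W : ℕ} {θ : Ω → NetParam d L W} (hθ : Measurable θ) {U : Ω → Fin d → ℝ}
    (hU : Measurable U) : Measurable fun ω => nn (θ ω) (U ω) :=
  Measurable.comp_uncurried (f := nn) continuous_nn_uncurry.measurable hθ hU

lemma measurable_classifier [NeZero K] {κ : ℝ → ℝ} (hκ : Measurable κ) (h : Fin d → Fin K → ℕ → ℝ)
    (hD : ∀ i, Measurable (D i)) (n M : ℕ) {v : Fin K → ℕ → Ω → Fin d → ℝ}
    (hv : ∀ y m, Measurable (v y m)) {L W : ℕ} {θ : Fin K → Ω → NetParam d L W}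
    (hθ : ∀ y, Measurable (θ y)) {X : Ω → Fin d → ℝ} (hX : Measurable X) :
    Measurable fun ω => classifier κ h (fun i => D i ω) n M (fun y m => v y m ω)
      (fun y => θ y ω) (X ω) := by
  refine measurable_firstArgmax.comp (measurable_pi_iff.2 fun y => Measurable.mul ?_ ?_)
  · exact ((measurable_from_nat (f := fun m : ℕ => (m : ℝ))).comp
      (measurable_classCount hD n y)).div_const _
  · refine Measurable.mul ?_ (Finset.measurable_prod _ fun j _ =>
      measurable_kde hκ _ hD n j y ((measurable_pi_apply j).comp hX))
    exact (measurable_nn (hθ y) (measurable_pit hD n y hX)).div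
      ((Finset.measurable_sum _ fun m _ => measurable_nn (hθ y) (hv y m)).div_const _)

end Measurability

end DCC

namespace DCC

/-! ### Error probabilities through posterior probabilities. -/

noncomputable section Posterior

variable {d K : ℕ} {P : Measure (Obs d K)}

/-- The posterior probability of class `y`. -/
def posterior (P : Measure (Obs d K)) (p : Fin K → (Fin d → ℝ) → ℝ) (y : Fin K) (x : Fin d → ℝ) :
    ℝ := prior P y * p y x / ∑ y', prior P y' * p y' x

variable {r : ℝ} {p C c : Fin K → (Fin d → ℝ) → ℝ} {Lc : ℝ≥0}

namespace Regular

lemma score_nonneg (hP : Regular P r p C c Lc) (y : Fin K) (x : Fin d → ℝ) :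
    0 ≤ prior P y * p y x := mul_nonneg (hP.prior_pos y).le (hP.density_nonneg y x)

lemma posterior_le_one (hP : Regular P r p C c Lc) (y : Fin K) (x : Fin d → ℝ) :
    posterior P p y x ≤ 1 :=
  div_le_one_of_le₀ (Finset.single_le_sum (f := fun y => prior P y * p y x)
    (fun y' _ => hP.score_nonneg y' x) (Finset.mem_univ y))
    (Finset.sum_nonneg fun _ _ => hP.score_nonneg _ x)

lemma measurable_score (hP : Regular P r p C c Lc) (y : Fin K) :
    Measurable fun x => prior P y * p y x :=
  (hP.density_continuous y).measurable.const_mul _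

/-- Measurability is joint in label and point because the label inserted later is itself random. -/
lemma measurable_posterior (hP : Regular P r p C c Lc) :
    Measurable fun w : Fin K × (Fin d → ℝ) => posterior P p w.1 w.2 :=
  measurable_from_prod_countable_right fun y => (hP.measurable_score y).div
    (Finset.measurable_sum _ fun y' _ => hP.measurable_score y')

lemma measurable_bayesRule [NeZero K] (hP : Regular P r p C c Lc) : Measurable (bayesRule P p) :=
  measurable_firstArgmax.comp (measurable_pi_iff.2 fun y => hP.measurable_score y)

variable [IsProbabilityMeasure P]

lemma measure_prod_label (hP : Regular P r p C c Lc) {B : Set (Fin d → ℝ)} (hB : MeasurableSet B)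
    (y : Fin K) : P (B ×ˢ {y}) = ∫⁻ x in B, ENNReal.ofReal (prior P y * p y x) := by
  rw [DCC.measure_prod_label (hP.prior_pos y) hB, hP.density y, withDensity_apply _ hB,
    ← lintegral_const_mul _ (hP.density_continuous y).measurable.ennreal_ofReal]
  simp only [ENNReal.ofReal_mul (hP.prior_pos y).le]

lemma measure_graph (hP : Regular P r p C c Lc) {g : (Fin d → ℝ) → Fin K} (hg : Measurable g) :
    P {z | g z.1 = z.2} = ∫⁻ x, ENNReal.ofReal (prior P (g x) * p (g x) x) := by
  have hgs : ∀ y, MeasurableSet (g ⁻¹' {y}) := fun y => hg (measurableSet_singleton y)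
  have hset : {z : Obs d K | g z.1 = z.2} = ⋃ y, (g ⁻¹' {y}) ×ˢ {y} := by
    ext z
    simp [eq_comm]
  have huniv : Set.univ = ⋃ y, g ⁻¹' {y} := by
    ext x
    simp
  rw [hset, measure_iUnion (fun y y' hyy' => Set.disjoint_left.2 fun z hz hz' =>
    hyy' (hz.2.symm.trans hz'.2)) fun y => (hgs y).prod (measurableSet_singleton y),
    ← setLIntegral_univ, huniv, lintegral_iUnion hgs fun y y' hyy' =>
      Set.disjoint_left.2 fun x hx hx' => hyy' (hx.symm.trans hx')]
  refine tsum_congr fun y => ?_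
  rw [hP.measure_prod_label (hgs y) y]
  refine setLIntegral_congr_fun (hgs y) fun x hx => ?_
  have : g x = y := hx
  simp only [this]

lemma map_fst (hP : Regular P r p C c Lc) : P.map Prod.fst =
    volume.withDensity fun x => ENNReal.ofReal (∑ y, prior P y * p y x) := by
  ext B hB
  rw [Measure.map_apply measurable_fst hB, withDensity_apply _ hB]
  simp only [ENNReal.ofReal_sum_of_nonneg fun y _ => hP.score_nonneg y _]
  rw [lintegral_finsetSum _ fun y _ => (hP.measurable_score y).ennreal_ofReal]
  simp only [← hP.measure_prod_label hB]
  rw [← tsum_fintype (L := .unconditional _), ← measure_iUnion (fun y y' hyy' =>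
    Set.disjoint_left.2 fun z hz hz' => hyy' (hz.2.symm.trans hz'.2)) fun y => hB.prod (measurableSet_singleton y)]
  congr 1
  ext z
  simp

/-- The probability of correct classification by a fixed rule. -/
lemma measure_correct (hP : Regular P r p C c Lc) {g : (Fin d → ℝ) → Fin K} (hg : Measurable g) :
    P {z | g z.1 = z.2} = ∫⁻ z, ENNReal.ofReal (posterior P p (g z.1) z.1) ∂P := by
  have hm : Measurable fun x => ENNReal.ofReal (posterior P p (g x) x) :=
    (hP.measurable_posterior.comp (hg.prodMk measurable_id)).ennreal_ofReal
  rw [hP.measure_graph hg, ← lintegral_map hm measurable_fst, hP.map_fst, lintegral_withDensity_eq_lintegral_mul _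
    (Finset.measurable_sum _ fun y _ => hP.measurable_score y).ennreal_ofReal hm]
  refine lintegral_congr fun x => ?_
  rw [Pi.mul_apply, ← ENNReal.ofReal_mul (Finset.sum_nonneg fun y _ => hP.score_nonneg y x),
    posterior]
  congr 1
  -- Where the total density vanishes every score does, so the convention `0 / 0 = 0` does no harm.
  by_cases h0 : ∑ y, prior P y * p y x = 0
  · rw [h0, zero_mul]
    exact (Finset.sum_eq_zero_iff_of_nonneg fun y _ => hP.score_nonneg y x).1 h0 _
      (Finset.mem_univ _)
  · rw [mul_div_cancel₀ _ h0]

variable {Ω T : Type*} [MeasurableSpace Ω] [MeasurableSpace T] {μ : Measure Ω}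
  [IsProbabilityMeasure μ] {Z : Ω → Obs d K} {τ : Ω → T}

/-- The probability of correct classification by a rule trained on independent data. -/
lemma measure_correct_of_indepFun (hP : Regular P r p C c Lc) (hZm : Measurable Z)
    (hZlaw : μ.map Z = P) (hτ : Measurable τ) (hind : IndepFun Z τ μ)
    {G : T × (Fin d → ℝ) → Fin K} (hG : Measurable G) :
    μ {ω | G (τ ω, (Z ω).1) = (Z ω).2} =
      ∫⁻ ω, ENNReal.ofReal (posterior P p (G (τ ω, (Z ω).1)) (Z ω).1) ∂μ := by
  have hmap : μ.map (fun ω => (Z ω, τ ω)) = P.prod (μ.map τ) := by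
    rw [← hZlaw]
    exact (indepFun_iff_map_prod_eq_prod_map_map hZm.aemeasurable hτ.aemeasurable).1 hind
  have : IsProbabilityMeasure (μ.map τ) := Measure.isProbabilityMeasure_map hτ.aemeasurable
  have hG' : Measurable fun w : Obs d K × T => G (w.2, w.1.1) :=
    hG.comp (measurable_snd.prodMk (measurable_fst.comp measurable_fst))
  have hE : MeasurableSet {w : Obs d K × T | G (w.2, w.1.1) = w.1.2} :=
    measurableSet_eq_fun hG' (measurable_snd.comp measurable_fst)
  have hF : Measurable fun w : Obs d K × T =>
      ENNReal.ofReal (posterior P p (G (w.2, w.1.1)) w.1.1) :=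
    (hP.measurable_posterior.comp
      (hG'.prodMk (measurable_fst.comp measurable_fst))).ennreal_ofReal
  have h1 : μ {ω | G (τ ω, (Z ω).1) = (Z ω).2} =
      (P.prod (μ.map τ)) {w : Obs d K × T | G (w.2, w.1.1) = w.1.2} := by
    rw [← hmap, Measure.map_apply (hZm.prodMk hτ) hE]
    rfl
  have h2 : ∫⁻ ω, ENNReal.ofReal (posterior P p (G (τ ω, (Z ω).1)) (Z ω).1) ∂μ =
      ∫⁻ w, ENNReal.ofReal (posterior P p (G (w.2, w.1.1)) w.1.1) ∂(P.prod (μ.map τ)) := by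
    rw [← hmap, lintegral_map hF (hZm.prodMk hτ)]
  rw [h1, h2, Measure.prod_apply_symm hE, lintegral_prod_symm' _ hF]
  exact lintegral_congr fun t =>
    hP.measure_correct (g := fun x => G (t, x)) (hG.comp (measurable_const.prodMk measurable_id))

/-- The error probability converges to the Bayes risk if the posterior probability of the chosen
class is eventually maximal. -/
lemma tendsto_error [NeZero K] (hP : Regular P r p C c Lc) (hZm : Measurable Z)
    (hZlaw : μ.map Z = P) (hτ : Measurable τ) (hind : IndepFun Z τ μ)
    {G : ℕ → T × (Fin d → ℝ) → Fin K} (hG : ∀ j, Measurable (G j))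
    (h : ∀ᵐ ω ∂μ, ∀ᶠ j in atTop, posterior P p (G j (τ ω, (Z ω).1)) (Z ω).1 =
      posterior P p (bayesRule P p (Z ω).1) (Z ω).1) :
    Tendsto (fun j => μ.real {ω | G j (τ ω, (Z ω).1) ≠ (Z ω).2}) atTop
      (𝓝 (μ.real {ω | bayesRule P p (Z ω).1 ≠ (Z ω).2})) := by
  -- Writing errors through posteriors makes them insensitive to ties: equal posterior values give
  -- equal risk even if the labels differ.
  have hcompl : ∀ g : T × (Fin d → ℝ) → Fin K, Measurable g →
      μ.real {ω | g (τ ω, (Z ω).1) ≠ (Z ω).2} =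
        1 - (∫⁻ ω, ENNReal.ofReal (posterior P p (g (τ ω, (Z ω).1)) (Z ω).1) ∂μ).toReal := by
    intro g hg
    have hs : MeasurableSet {ω | g (τ ω, (Z ω).1) = (Z ω).2} :=
      measurableSet_eq_fun (hg.comp (hτ.prodMk (measurable_fst.comp hZm)))
        (measurable_snd.comp hZm)
    rw [← hP.measure_correct_of_indepFun hZm hZlaw hτ hind hg]
    exact probReal_compl_eq_one_sub hs
  have hb : Measurable fun w : T × (Fin d → ℝ) => bayesRule P p w.2 :=
    hP.measurable_bayesRule.comp measurable_snd
  simp only [hcompl _ (hG _)]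
  rw [hcompl (fun w => bayesRule P p w.2) hb]
  have hm : ∀ g : T × (Fin d → ℝ) → Fin K, Measurable g →
      Measurable fun ω => ENNReal.ofReal (posterior P p (g (τ ω, (Z ω).1)) (Z ω).1) := fun g hg =>
    (hP.measurable_posterior.comp ((hg.comp (hτ.prodMk (measurable_fst.comp hZm))).prodMk
      (measurable_fst.comp hZm))).ennreal_ofReal
  have hle : ∀ y x, ENNReal.ofReal (posterior P p y x) ≤ 1 := fun y x =>
    ENNReal.ofReal_le_one.2 (hP.posterior_le_one y x)
  refine tendsto_const_nhds.sub ((ENNReal.tendsto_toReal ?_).comp ?_)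
  · refine ne_top_of_le_ne_top ENNReal.one_ne_top ((lintegral_mono fun ω => hle _ _).trans ?_)
    simp
  · refine tendsto_lintegral_of_dominated_convergence (fun _ => 1) (fun j => hm _ (hG j))
      (fun j => ae_of_all _ fun ω => hle _ _) (by simp) ?_
    filter_upwards [h] with ω hω
    exact tendsto_const_nhds.congr' (hω.mono fun j hj => by simp only [hj])

end Regular

end Posterior

/-! ### The kernel density estimator at an independent test point. -/

section TestPoint

variable {d K : ℕ} {P : Measure (Obs d K)} [IsProbabilityMeasure P]
  {r : ℝ} {p C c : Fin K → (Fin d → ℝ) → ℝ} {Lc : ℝ≥0}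

/-- The discontinuities of a marginal density form a null set, which a test feature vector avoids
even when it comes from another class, since the mixture law is absolutely continuous. -/
lemma Regular.ae_continuousAt_margPDF (hP : Regular P r p C c Lc) (j : Fin d) (y : Fin K) :
    ∀ᵐ z ∂P, ContinuousAt (margPDF P j y) (z.1 j) := by
  have := hP.isProb_map j y
  have h1 : ∀ᵐ t : ℝ, ContinuousAt (margPDF P j y) t := by
    refine ae_continuousAt_deriv (μ := (classLaw P y).map fun x => x j) (fun t => ?_)
      (hP.cdf_differentiable j y) (hP.pdf_contDiff j y).continuousOn
    rw [map_measureReal_apply (measurable_pi_apply j) measurableSet_Iic]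
    rfl
  have h2 : ∀ᵐ x : Fin d → ℝ, ContinuousAt (margPDF P j y) (x j) :=
    (Measure.quasiMeasurePreserving_eval (fun _ : Fin d => (volume : Measure ℝ)) j).ae h1
  have h3 : P.map Prod.fst ≪ volume := by
    rw [hP.map_fst]
    exact withDensity_absolutelyContinuous _ _
  exact ae_of_ae_map measurable_fst.aemeasurable (h3.ae_le h2)

variable {Ω : Type*} [MeasurableSpace Ω] {μ : Measure Ω} [IsProbabilityMeasure μ]
  {D : ℕ → Ω → Obs d K} {Z : Ω → Obs d K}

/-- Consistency of the kernel density estimator at an independent test point. -/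
lemma Regular.tendsto_measure_kde_test (hP : Regular P r p C c Lc)
    (hDm : ∀ i, Measurable (D i)) (hDlaw : ∀ i, μ.map (D i) = P) (hDind : iIndepFun D μ)
    (hZm : Measurable Z) (hZlaw : μ.map Z = P) (hind : IndepFun Z (fun ω i => D i ω) μ)
    (j : Fin d) (y : Fin K) {κ : ℝ → ℝ} (hκ : IsSecondOrderKernel κ) {h : ℕ → ℝ}
    (hh : IsBandwidth h) {ε : ℝ} (hε : 0 < ε) :
    Tendsto (fun n => μ {ω | ε ≤ |kde κ h (fun i => D i ω) n j y ((Z ω).1 j) -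
      margPDF P j y ((Z ω).1 j)|}) atTop (𝓝 0) := by
  have hDm' : Measurable fun ω i => D i ω := measurable_pi_iff.2 hDm
  have hmap : μ.map (fun ω => (Z ω, fun i => D i ω)) = P.prod (μ.map fun ω i => D i ω) := by
    rw [← hZlaw]
    exact (indepFun_iff_map_prod_eq_prod_map_map hZm.aemeasurable hDm'.aemeasurable).1 hind
  have : IsProbabilityMeasure (μ.map fun ω i => D i ω) :=
    Measure.isProbabilityMeasure_map hDm'.aemeasurable
  let E : ℕ → Set (Obs d K × (ℕ → Obs d K)) := fun n =>
    {w | ε ≤ |kde κ h w.2 n j y (w.1.1 j) - margPDF P j y (w.1.1 j)|}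
  have hx : Measurable fun w : Obs d K × (ℕ → Obs d K) => w.1.1 j :=
    (measurable_pi_apply j).comp (measurable_fst.comp measurable_fst)
  have hE : ∀ n, MeasurableSet (E n) := fun n => measurableSet_le measurable_const
    ((measurable_kde hκ.measurable h (D := fun i (w : Obs d K × (ℕ → Obs d K)) => w.2 i)
      (fun i => (measurable_pi_apply i).comp measurable_snd) n j y hx).sub
      ((measurable_deriv (margCDF P j y)).comp hx)).abs
  have h1 : ∀ n, μ {ω | ε ≤ |kde κ h (fun i => D i ω) n j y ((Z ω).1 j) -
      margPDF P j y ((Z ω).1 j)|} =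
      ∫⁻ z, (μ.map fun ω i => D i ω) (Prod.mk z ⁻¹' E n) ∂P := by
    intro n
    rw [← Measure.prod_apply (hE n), ← hmap, Measure.map_apply (hZm.prodMk hDm') (hE n)]
    rfl
  simp only [h1]
  rw [← lintegral_zero (μ := P)]
  -- By independence the test point can be frozen; consistency at almost every fixed point then
  -- integrates, probabilities being bounded by one.
  refine tendsto_lintegral_of_dominated_convergence (fun _ => 1)
    (fun n => measurable_measure_prodMk_left (hE n)) (fun n => ae_of_all _ fun z => prob_le_one)
    (by simp) ?_
  filter_upwards [hP.ae_continuousAt_margPDF j y] with z hz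
  have h2 := hP.tendsto_measure_kde hDm hDlaw hDind j y hκ hh hz hε
  have h3 := (ENNReal.tendsto_ofReal h2)
  rw [ENNReal.ofReal_zero] at h3
  refine h3.congr fun n => ?_
  rw [ofReal_measureReal, Measure.map_apply hDm' (measurable_prodMk_left (hE n))]
  rfl

end TestPoint

end DCC

/-! ### Assembly along almost surely convergent subsequences. -/

namespace DCC

/-- The Borel–Cantelli lemma for events of geometrically small probability. -/
lemma ae_eventually_notMem_of_measure_le {Ω : Type*} [MeasurableSpace Ω] {μ : Measure Ω}
    {B : ℕ → Set Ω} (h : ∀ k, μ (B k) ≤ (1 / 2 : ℝ≥0∞) ^ k) : ∀ᵐ ω ∂μ, ∀ᶠ k in atTop, ω ∉ B k := by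
  refine ae_eventually_notMem (ne_top_of_le_ne_top ?_ (ENNReal.tsum_le_tsum h))
  rw [ENNReal.tsum_geometric]
  simp

/-- Uniform convergence with a continuous limit tolerates moving arguments; here these are the
empirical ranks of the test point. -/
lemma tendsto_apply_of_tendstoUniformlyOn_cube {d : ℕ} {q : ℕ → (Fin d → ℝ) → ℝ}
    {c : (Fin d → ℝ) → ℝ} (hq : TendstoUniformlyOn q c atTop (cube d))
    (hc : ContinuousOn c (cube d)) {u : ℕ → Fin d → ℝ} {u₀ : Fin d → ℝ} (hu : ∀ k, u k ∈ cube d)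
    (hu₀ : u₀ ∈ cube d) (h : Tendsto u atTop (𝓝 u₀)) :
    Tendsto (fun k => q k (u k)) atTop (𝓝 (c u₀)) :=
  tendsto_comp_of_locally_uniform_limit_within (hc u₀ hu₀)
    (tendsto_nhdsWithin_iff.2 ⟨h, Eventually.of_forall hu⟩)
    fun v hv => ⟨cube d, self_mem_nhdsWithin, hq v hv⟩

end DCC

theorem theorem1 {d K : ℕ} [NeZero K] (hd : 1 ≤ d)
    -- population
    (r : ℝ) (hr : (d : ℝ) / 2 < r)
    (P : Measure (DCC.Obs d K)) [IsProbabilityMeasure P]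
    (p C c : Fin K → (Fin d → ℝ) → ℝ) (Lc : ℝ≥0)
    (hP : DCC.Regular P r p C c Lc)
    -- tuning: kernel, bandwidths, network depth, width, size, Lipschitz radius,
    -- Monte-Carlo sample size, penalty weight
    (κ : ℝ → ℝ) (hκ : DCC.IsSecondOrderKernel κ)
    (h : Fin d → Fin K → ℕ → ℝ) (hh : ∀ j y, DCC.IsBandwidth (h j y))
    (L W S M : ℕ → ℕ) (lam : ℕ → ℝ) (hgrowth : DCC.Growth d r L W S M lam)
    (Λ : ℝ≥0) (hΛ : Lc < Λ)
    -- training sample `D`, test pair `Z`, Monte-Carlo draws `V`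
    {Ω : Type*} [MeasurableSpace Ω] (μ : Measure Ω) [IsProbabilityMeasure μ]
    (D : ℕ → Ω → DCC.Obs d K) (hDm : ∀ i, Measurable (D i))
    (hDlaw : ∀ i, μ.map (D i) = P) (hDind : iIndepFun D μ)
    (Z : Ω → DCC.Obs d K) (hZm : Measurable Z) (hZlaw : μ.map Z = P)
    (V : ℕ → Fin K → ℕ → Ω → (Fin d → ℝ)) (hVm : ∀ n y m, Measurable (V n y m))
    (hVlaw : ∀ n y m, μ.map (V n y m) = volume.restrict (DCC.cube d))
    (hVind : ∀ n y, iIndepFun (V n y) μ)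
    -- fitted network parameters: (near-)maximizers over the sieve
    (θ : (n : ℕ) → Fin K → Ω → DCC.NetParam d (L n) (W n))
    (hθm : ∀ n y, Measurable (θ n y))
    (tol : ℕ → ℝ) (htol : Tendsto tol atTop (𝓝 0))
    (hθ : ∀ y, Tendsto (fun n => μ {ω | ¬ (θ n y ω ∈ DCC.sieve (S n) Λ ∧
        ∀ ϑ ∈ (DCC.sieve (S n) Λ : Set (DCC.NetParam d (L n) (W n))),
          DCC.objective (fun i => D i ω) n (M n) (fun m => V n y m ω) (lam n) y ϑ ≤
            DCC.objective (fun i => D i ω) n (M n) (fun m => V n y m ω) (lam n) y (θ n y ω)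
              + tol n)}) atTop (𝓝 0))
    -- the test pair is independent of everything used in training
    (hZind : IndepFun Z
      (fun ω => ((fun i => D i ω, fun n y m => V n y m ω, fun n y => θ n y ω) :
        (ℕ → DCC.Obs d K) × (ℕ → Fin K → ℕ → (Fin d → ℝ)) ×
          ((n : ℕ) → Fin K → DCC.NetParam d (L n) (W n)))) μ) :
    Tendsto
      (fun n => μ.real {ω | DCC.classifier κ h (fun i => D i ω) n (M n)
        (fun y m => V n y m ω) (fun y => θ n y ω) (Z ω).1 ≠ (Z ω).2})
      atTop (𝓝 (μ.real {ω | DCC.bayesRule P p (Z ω).1 ≠ (Z ω).2})) := by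
  have hDT : IndepFun Z (fun ω i => D i ω) μ := hZind.comp measurable_id measurable_fst
  obtain ⟨s, hs, hls, hsize⟩ := hgrowth.exists_scale hd hr
  refine tendsto_of_subseq_tendsto fun ns hns => ?_
  have hpow : ∀ k : ℕ, (0 : ℝ≥0∞) < (1 / 2) ^ k := fun k =>
    ENNReal.pow_pos (by simp) k
  -- The `k`-th index is taken so late that sizes fit, the weighted Monte-Carlo variance is at most
  -- `2 ^ (-k)`, and the failure of the optimizer and a kernel error above `2 ^ (-k)` each have
  -- probability at most `2 ^ (-k)`. All bounds are summable.
  obtain ⟨φ, hφ, hQ⟩ := extraction_forall_of_eventually (P := fun k m =>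
    (2 * d + s (ns m) * d ≤ L (ns m) ∧ 2 ^ (s (ns m) * d + 2 * d) ≤ W (ns m) ∧
      ∀ w, w = 2 ^ (s (ns m) * d + 2 * d) →
        w * d + w + L (ns m) * (w * w) + L (ns m) * w + w + 1 ≤ S (ns m)) ∧
    0 < M (ns m) ∧ 0 ≤ lam (ns m) ∧ (lam (ns m) + 1) / M (ns m) ≤ (1 / 2 : ℝ) ^ k ∧
    (∀ y, μ {ω | ¬ (θ (ns m) y ω ∈ DCC.sieve (S (ns m)) Λ ∧
      ∀ ϑ ∈ (DCC.sieve (S (ns m)) Λ : Set (DCC.NetParam d (L (ns m)) (W (ns m)))),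
        DCC.objective (fun i => D i ω) (ns m) (M (ns m)) (fun l => V (ns m) y l ω) (lam (ns m)) y ϑ
          ≤ DCC.objective (fun i => D i ω) (ns m) (M (ns m)) (fun l => V (ns m) y l ω)
            (lam (ns m)) y (θ (ns m) y ω) + tol (ns m))} ≤ (1 / 2 : ℝ≥0∞) ^ k) ∧
    ∀ j y, μ {ω | (1 / 2 : ℝ) ^ k ≤ |DCC.kde κ (h j y) (fun i => D i ω) (ns m) j y ((Z ω).1 j) -
      DCC.margPDF P j y ((Z ω).1 j)|} ≤ (1 / 2 : ℝ≥0∞) ^ k) fun k => by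
    exact (hns.eventually hsize).and <|
      (hns.eventually (hgrowth.mc_tendsto.eventually_gt_atTop 0)).and <|
      (hns.eventually (hgrowth.penalty_tendsto.eventually_ge_atTop 0)).and <|
      (hns.eventually ((hgrowth.tendsto_penalty_div hd hr).eventually
        (ge_mem_nhds (by positivity)))).and <|
      (eventually_all.2 fun y => hns.eventually ((hθ y).eventually (ge_mem_nhds (hpow k)))).and <|
      eventually_all.2 fun j => eventually_all.2 fun y => hns.eventually
        ((hP.tendsto_measure_kde_test hDm hDlaw hDind hZm hZlaw hDT j y hκ (hh j y)
          (by positivity)).eventually (ge_mem_nhds (hpow k)))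
  refine ⟨φ, ?_⟩
  have hN : Tendsto (fun k => ns (φ k)) atTop atTop := hns.comp hφ.tendsto_atTop
  have hcop := ae_all_iff.2 fun y => hP.ae_tendstoUniformlyOn_nnDensity hd hDm hDlaw hDind y
    (V := fun k => V (ns (φ k)) y) (N := fun k => ns (φ k)) (L := fun k => L (ns (φ k)))
    (W := fun k => W (ns (φ k))) (S := fun k => S (ns (φ k))) (M := fun k => M (ns (φ k)))
    (s := fun k => s (ns (φ k))) (lam := fun k => lam (ns (φ k))) (tol := fun k => tol (ns (φ k)))
    (θ := fun k => θ (ns (φ k)) y)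
    (fun k => hVm _ y) (fun k => hVlaw _ y) (fun k => hVind _ y) hN (fun k => (hQ k).2.1)
    (fun k => (hQ k).2.2.1) (fun k => (hQ k).2.2.2.1) (hs.comp hN) (hls.comp hN)
    (fun k => (hQ k).1.1) (fun k => (hQ k).1.2.1) (fun k => (hQ k).1.2.2) hΛ.le (htol.comp hN)
    ((DCC.ae_eventually_notMem_of_measure_le fun k => (hQ k).2.2.2.2.1 y).mono
      fun ω hω => hω.mono fun k hk => not_not.1 hk)
  have hkde := ae_all_iff.2 fun j => ae_all_iff.2 fun y =>
    DCC.ae_eventually_notMem_of_measure_le fun k => (hQ k).2.2.2.2.2 j y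
  have hτ : Measurable fun ω => ((fun i => D i ω, fun n y m => V n y m ω, fun n y => θ n y ω) :
      (ℕ → DCC.Obs d K) × (ℕ → Fin K → ℕ → (Fin d → ℝ)) ×
        ((n : ℕ) → Fin K → DCC.NetParam d (L n) (W n))) :=
    (measurable_pi_iff.2 hDm).prodMk ((measurable_pi_iff.2 fun n => measurable_pi_iff.2 fun y =>
      measurable_pi_iff.2 fun m => hVm n y m).prodMk
        (measurable_pi_iff.2 fun n => measurable_pi_iff.2 fun y => hθm n y))
  -- The classifier is a measurable function of the training triple and the test point, which brings
  -- the independence of the two to bear.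
  refine hP.tendsto_error hZm hZlaw hτ hZind (G := fun k w => DCC.classifier κ h w.1.1 (ns (φ k))
    (M (ns (φ k))) (w.1.2.1 (ns (φ k))) (w.1.2.2 (ns (φ k))) w.2) (fun k => ?_) ?_
  · refine DCC.measurable_classifier (Ω := ((ℕ → DCC.Obs d K) × (ℕ → Fin K → ℕ → (Fin d → ℝ)) ×
      ((n : ℕ) → Fin K → DCC.NetParam d (L n) (W n))) × (Fin d → ℝ)) hκ.measurable h
      (D := fun i w => w.1.1 i) (fun i => ?_) _ _ (v := fun y m w => w.1.2.1 (ns (φ k)) y m)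
      (fun y m => ?_) (θ := fun y w => w.1.2.2 (ns (φ k)) y) (fun y => ?_) measurable_snd
    · exact (measurable_pi_apply i).comp (measurable_fst.comp measurable_fst)
    · exact (measurable_pi_apply m).comp ((measurable_pi_apply y).comp
        ((measurable_pi_apply _).comp (measurable_fst.comp (measurable_snd.comp measurable_fst))))
    · exact (measurable_pi_apply y).comp
        ((measurable_pi_apply _).comp (measurable_snd.comp (measurable_snd.comp measurable_fst)))
  · filter_upwards [hcop, hkde, ae_all_iff.2 fun y => hP.ae_tendstoUniformly_pit hDm hDlaw hDind y,
      ae_all_iff.2 fun y => DCC.ae_tendsto_empPrior hDm hDlaw hDind (hP.prior_pos y)] with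
      ω hω₁ hω₂ hω₃ hω₄
    have hscore : ∀ y, Tendsto (fun k => DCC.empPrior (fun i => D i ω) (ns (φ k)) y *
        DCC.densityEst κ h (fun i => D i ω) (ns (φ k)) (M (ns (φ k)))
          (fun m => V (ns (φ k)) y m ω) (θ (ns (φ k)) y ω) y (Z ω).1) atTop
        (𝓝 (DCC.prior P y * p y (Z ω).1)) := by
      intro y
      refine ((hω₄ y).comp hN).mul ?_
      rw [hP.factorization y]
      refine Tendsto.mul ?_ (tendsto_finsetProd _ fun j _ => ?_)
      · have hnum := DCC.tendsto_apply_of_tendstoUniformlyOn_cube (hω₁ y).1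
          (hP.copula_lipschitz y).continuousOn
          (fun k => DCC.pit_mem_cube (fun i => D i ω) (ns (φ k)) y (Z ω).1)
          (hP.cdfVec_mem_cube y (Z ω).1) (((hω₃ y).tendsto_at (Z ω).1).comp hN)
        have hdiv := hnum.div (hω₁ y).2 one_ne_zero
        rw [div_one] at hdiv
        exact hdiv.congr fun k => (DCC.neuralCopula_eq _ _ _ _).symm
      · rw [← tendsto_sub_nhds_zero_iff]
        refine squeeze_zero_norm' ?_ (tendsto_pow_atTop_nhds_zero_of_lt_one
          (by norm_num : (0 : ℝ) ≤ 1 / 2) (by norm_num))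
        exact (hω₂ j y).mono fun k hk => (not_le.1 hk).le
    -- Posteriors are the scores over a denominator common to all classes, so equality of the
    -- maximal scores passes to them.
    exact (DCC.eventually_apply_firstArgmax_eq hscore).mono fun k hk => by
      rw [DCC.posterior, DCC.posterior]
      exact congrArg (· / _) hk
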